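/- **Setting.** A finite set $V\subset\mathbb Z^2$ has inner boundary $\partial_iV$ (sites of $V$ with a neighbour outside $V$), outer boundary $\partial_oV$ (sites outside $V$ with a neighbour in $V$) and strict interior $\mathring V=V\setminus\partial_iV$. Each nearest-neighbour edge of $\mathbb Z^2$ is bisected by an edge of the dual lattice $\mathbb Z^2+(\frac12,\frac12)$; let $(\partial_eV)^*$ be the set of dual edges bisecting the edges between $V$ and $\mathbb Z^2\setminus V$. Any such set of dual edges is cut into closed loops by the *splitting rule*: at a dual vertex at which all four dual edges belong to the set, the south edge is followed by the west one and the north edge by the east one. A *geometric contour* $\gamma$ is the finite set of edges of a closed path of distinct dual edges that obeys this rule at every dual vertex through which it passes twice; $|\gamma|$ is its number of edges, $\operatorname{diam}(\gamma)$ its sup-norm diameter, and $\mathsf{Int}(\gamma)$ the finite set of sites it encloses when its corners are rounded off according to the rule. $V$ is *simply-connected* if $(\partial_eV)^*$ is a geometric contour. For $h\in\mathbb Z$ and a boundary signing $\eta\in\{+,-,\emptyset,f\}^{\partial_iV}$ let $\Omega_{\eta,h,V}$ be the set of $\varphi:\mathbb Z^2\to\mathbb Z$ with $\varphi=h$ off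 $V$, $\varphi\ge0$ on $V$, and, for each $v\in\partial_iV$, $\varphi_v\ge h$ if $\eta_v=+$, $\varphi_v\le h$ if $\eta_v=-$, $\varphi_v=h$ if $\eta_v=\emptyset$ (no further constraint if $\eta_v=f$). The *contour collection* of $\varphi$ consists, over all heights $j$, of the loops $\gamma$ into which the dual edges separating $\{\varphi\ge j\}$ from $\{\varphi<j\}$ are cut by the splitting rule; $\gamma$ is an up-$j$-contour if $\varphi\ge j$ on $\partial_i\mathsf{Int}(\gamma)$ and $\varphi<j$ on $\partial_o\mathsf{Int}(\gamma)$, and a down-$(j-1)$-contour if $\varphi\le j-1$ on $\partial_i\mathsf{Int}(\gamma)$ and $\varphi>j-1$ on $\partial_o\mathsf{Int}(\gamma)$. Let $\mathscr G_{\eta,h,V}$ be the set of contour collections of the $\varphi\in\Omega_{\eta,h,V}$. For $\beta>0$ and $\lambda\ge0$ a contour has weight $W(\gamma)=e^{-\beta|\gamma|-\lambda|\mathsf{Int}(\gamma)|}$ if it is an up-contour and $W(\gamma)=e^{-\beta|\gamma|+\lambda|\mathsf{Int}(\gamma)|}$ if it is a down-contour. A contour is *$h$-elementary* if $\operatorname{diam}(\gamma)\le\min(\lambda^{-1},e^{3\beta(h+1)})$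 (with $\lambda^{-1}=\infty$ if $\lambda=0$). Put $$Z_{\eta,h,V}=e^{-\lambda h|V|}\sum_{\Gamma\in\mathscr G_{\eta,h,V}}\prod_{\gamma\in\Gamma}W(\gamma),$$ and let $Z^{\mathsf{el}}_{\eta,h,V}$ be the same expression with the sum restricted to the collections all of whose contours are $h$-elementary. Writing $\pm$ for the constant signings, the *$h$-renormalized weight* of $\gamma$ is $$W^{\mathsf{rn}}_h(\gamma)=e^{-\beta|\gamma|}\frac{Z_{+,h+1,\mathsf{Int}(\gamma)}}{Z_{+,h,\mathsf{Int}(\gamma)}}\ \text{ if }\gamma\text{ is an up-contour},\qquad W^{\mathsf{rn}}_h(\gamma)=e^{-\beta|\gamma|}\frac{Z_{-,h-1,\mathsf{Int}(\gamma)}}{Z_{-,h,\mathsf{Int}(\gamma)}}\ \text{ if }\gamma\text{ is a down-contour}.$$ **Theorem.** There exists an absolute constant $\beta_0>0$ such that for every $\beta>\beta_0$ and every $\lambda\in[0,1]$ the following holds. 0. For every finite simply-connected $V\subset\mathbb Z^2$, every boundary signing $\eta$ and every $h\in\mathbb Z$, the series defining $Z_{\eta,h,V}$ converges (hence so does the one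 defining $Z^{\mathsf{el}}_{\eta,h,V}$). 1. For every finite simply-connected $V\subset\mathbb Z^2$, all integers $0\le k<m$ and every boundary signing $\eta$, $$e^{-2|V|e^{-(4\beta-\lambda)(k+1)}}\ \le\ e^{-\lambda(m-k)|V|}\,\frac{Z^{\mathsf{el}}_{\eta,k,V}}{Z^{\mathsf{el}}_{\eta,m,V}}\ \le\ 2e^{-\frac12|\mathring V|e^{-(4\beta-\lambda)(k+1)}}.$$ 2. For every integer $h\ge0$ and every $h$-elementary contour $\gamma$, up or down, $$W^{\mathsf{rn}}_h(\gamma)\le e^{-(\beta-2)|\gamma|}.$$ -/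

import Mathlib

namespace SOS

noncomputable section

/-! ### Geometry of the square lattice and of its dual -/

/-- Sites of the square lattice. -/
abbrev Site := ℤ × ℤ

/-- Nearest-neighbour relation of the square lattice. -/
def Adj (x y : Site) : Prop := |x.1 - y.1| + |x.2 - y.2| = 1

/-- The inner boundary: the sites of `V` with a neighbour outside `V`. -/
def innerBoundary (V : Set Site) : Set Site := {x | x ∈ V ∧ ∃ y, y ∉ V ∧ Adj x y}

/-- The outer boundary: the sites outside `V` with a neighbour in `V`. -/
def outerBoundary (V : Set Site) : Set Site := {x | x ∉ V ∧ ∃ y, y ∈ V ∧ Adj x y}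

/-- The strict interior of a set of sites. -/
def strictInterior (V : Set Site) : Set Site := V \ innerBoundary V

/-- Vertices of the dual lattice: the pair `(a, b)` stands for the point `(a + 1/2, b + 1/2)`. -/
abbrev DualVertex := ℤ × ℤ

/-- Edges of the dual lattice: `hor v` goes from `v` to `v + (1, 0)`, and `ver v` goes from `v` to
`v + (0, 1)`. -/
inductive DualEdge where
  | hor (v : DualVertex) : DualEdge
  | ver (v : DualVertex) : DualEdge

/-- The left (lower) end of a dual edge. -/
def DualEdge.tail : DualEdge → DualVertex
  | .hor v => v
  | .ver v => v

/-- The right (upper) end of a dual edge. -/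
def DualEdge.head : DualEdge → DualVertex
  | .hor v => (v.1 + 1, v.2)
  | .ver v => (v.1, v.2 + 1)

/-- The dual edge `e` joins the dual vertices `u` and `v`. -/
def DualEdge.Joins (e : DualEdge) (u v : DualVertex) : Prop :=
  (e.tail = u ∧ e.head = v) ∨ (e.tail = v ∧ e.head = u)

/-- One end (the lower or left one) of the lattice edge bisected by a dual edge. -/
def DualEdge.side₁ : DualEdge → Site
  | .hor v => (v.1 + 1, v.2)
  | .ver v => (v.1, v.2 + 1)

/-- The other end (the upper or right one) of the lattice edge bisected by a dual edge. -/
def DualEdge.side₂ : DualEdge → Site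
  | .hor v => (v.1 + 1, v.2 + 1)
  | .ver v => (v.1 + 1, v.2 + 1)

/-- The dual edges bisecting the edge boundary of `A`. -/
def dualBoundary (A : Set Site) : Set DualEdge := {e | Xor (e.side₁ ∈ A) (e.side₂ ∈ A)}

/-- The four dual edges at a dual vertex. -/
def eastEdge (v : DualVertex) : DualEdge := .hor v
def northEdge (v : DualVertex) : DualEdge := .ver v
def westEdge (v : DualVertex) : DualEdge := .hor (v.1 - 1, v.2)
def southEdge (v : DualVertex) : DualEdge := .ver (v.1, v.2 - 1)

/-- All four dual edges at `v` belong to `B`. -/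
def IsCross (B : Set DualEdge) (v : DualVertex) : Prop :=
  eastEdge v ∈ B ∧ northEdge v ∈ B ∧ westEdge v ∈ B ∧ southEdge v ∈ B

/-- The canonical splitting rule at a dual vertex: `e, f` are its south and west edges, or its
north and east edges. -/
def Linked (v : DualVertex) (e f : DualEdge) : Prop :=
  (e = southEdge v ∧ f = westEdge v) ∨ (e = westEdge v ∧ f = southEdge v) ∨
  (e = northEdge v ∧ f = eastEdge v) ∨ (e = eastEdge v ∧ f = northEdge v)

/-- `γ` is one of the loops into which the set `B` of dual edges is cut by the splitting rule:
`γ ⊆ B` consists of the edges `e 0, …, e (n - 1)`, pairwise distinct, of a closed path of the dual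
lattice through the dual vertices `v 0, …, v n = v 0` (both sequences are continued
`n`-periodically), and consecutive edges of the path are linked at every dual vertex at which all
four dual edges are in `B`. -/
def IsLoopOf (B : Set DualEdge) (γ : Finset DualEdge) : Prop :=
  (γ : Set DualEdge) ⊆ B ∧
  ∃ (n : ℕ) (v : ℕ → DualVertex) (e : ℕ → DualEdge),
    0 < n ∧
    (∀ i, v (i + n) = v i) ∧ (∀ i, e (i + n) = e i) ∧
    (∀ i, (e i).Joins (v i) (v (i + 1))) ∧
    (∀ i < n, ∀ j < n, e i = e j → i = j) ∧
    (∀ f, f ∈ γ ↔ ∃ i < n, e i = f) ∧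
    (∀ i, IsCross B (v (i + 1)) → Linked (v (i + 1)) (e i) (e (i + 1)))

/-- A geometric contour: a closed path of distinct dual edges, which obeys the splitting rule
where it passes twice through a dual vertex. -/
def IsGeometricContour (γ : Finset DualEdge) : Prop := IsLoopOf (γ : Set DualEdge) γ

/-- The sites interior to a contour, with the corners of the contour rounded off according to the
splitting rule, so that the contour is a simple closed curve. A site is then interior when the
horizontal half-line from it to the east crosses the contour an odd number of times. -/
def Inside (γ : Finset DualEdge) : Set Site :=
  {x | Odd {a : ℤ | x.1 ≤ a ∧ DualEdge.ver (a, x.2 - 1) ∈ γ}.ncard}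

/-- A set of sites is simply-connected if the dual of its edge boundary is a geometric contour. -/
def SimplyConnectedDomain (V : Set Site) : Prop :=
  ∃ γ : Finset DualEdge, IsGeometricContour γ ∧ (γ : Set DualEdge) = dualBoundary V

/-- The diameter of a contour in the sup-norm, which is attained at ends of dual edges. (The
distance of `ℤ × ℤ` is the one of the sup-norm.) -/
def contourDiam (γ : Finset DualEdge) : ℝ :=
  Metric.diam {u : DualVertex | ∃ e ∈ γ, u = e.tail ∨ u = e.head}

/-! ### Configurations and boundary signings -/

/-- The four values of a boundary signing: `+`, `-`, `∅` and `f`. -/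
inductive Sgn where
  | plus : Sgn
  | minus : Sgn
  | empty : Sgn
  | free : Sgn

/-- The constraint put on the height `a` of a site of the inner boundary by the sign of this site,
for the constant boundary height `k`. -/
def Sgn.Allows (k a : ℤ) : Sgn → Prop
  | .plus => k ≤ a
  | .minus => a ≤ k
  | .empty => a = k
  | .free => True

/-- The configurations on `V` with floor `0`, constant boundary height `k` and boundary signing
`η`. They are extended by `k` outside `V`; only the values of `η` on the inner boundary of `V`
matter. -/
def Config (η : Site → Sgn) (k : ℤ) (V : Set Site) : Set (Site → ℤ) :=
  {φ | (∀ x, x ∉ V → φ x = k) ∧ (∀ x ∈ V, 0 ≤ φ x) ∧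
    ∀ x ∈ innerBoundary V, (η x).Allows k (φ x)}

/-! ### The contour representation -/

/-- The direction of a contour. -/
inductive Direction where
  | up : Direction
  | down : Direction

/-- A contour with its direction and its height. -/
structure Contour where
  loop : Finset DualEdge
  dir : Direction
  height : ℤ

/-- `γ` is an up-`h`-contour of `φ`. -/
def IsUpContour (φ : Site → ℤ) (h : ℤ) (γ : Finset DualEdge) : Prop :=
  IsLoopOf (dualBoundary {x | h ≤ φ x}) γ ∧
  (∀ x ∈ innerBoundary (Inside γ), h ≤ φ x) ∧ (∀ x ∈ outerBoundary (Inside γ), φ x < h)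

/-- `γ` is a down-`h`-contour of `φ`. -/
def IsDownContour (φ : Site → ℤ) (h : ℤ) (γ : Finset DualEdge) : Prop :=
  IsLoopOf (dualBoundary {x | φ x ≤ h}) γ ∧
  (∀ x ∈ innerBoundary (Inside γ), φ x ≤ h) ∧ (∀ x ∈ outerBoundary (Inside γ), h < φ x)

/-- The contour collection of a configuration. -/
def contours (φ : Site → ℤ) : Set Contour :=
  {c | match c.dir with
    | .up => IsUpContour φ c.height c.loop
    | .down => IsDownContour φ c.height c.loop}

/-- The admissible contour collections whose configuration has floor `0`, boundary height `h` and
boundary signing `η` on `V`. -/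
def Collections (η : Site → Sgn) (h : ℤ) (V : Set Site) : Set (Set Contour) :=
  contours '' Config η h V

/-- The weight of a contour, for the inverse temperature `β` and the external field `lam`. -/
def weight (β lam : ℝ) (c : Contour) : ℝ :=
  match c.dir with
  | .up => Real.exp (-β * c.loop.card - lam * (Inside c.loop).ncard)
  | .down => Real.exp (-β * c.loop.card + lam * (Inside c.loop).ncard)

/-- The weight of a collection of contours (a finite one, in all cases of interest). -/
def collectionWeight (β lam : ℝ) (Γ : Set Contour) : ℝ := ∏ᶠ c ∈ Γ, weight β lam c

/-- The partition function on `V` with boundary height `h` and boundary signing `η`. -/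
def Z (β lam : ℝ) (η : Site → Sgn) (h : ℤ) (V : Set Site) : ℝ :=
  Real.exp (-lam * h * V.ncard) * ∑' Γ : Collections η h V, collectionWeight β lam Γ

/-! ### Elementary contours and renormalized weights -/

/-- `h`-elementary contours: the diameter is at most `lam⁻¹` (which is infinite if `lam = 0`) and
at most `exp (3 β (h + 1))`. -/
def IsElementary (β lam : ℝ) (h : ℤ) (γ : Finset DualEdge) : Prop :=
  lam * contourDiam γ ≤ 1 ∧ contourDiam γ ≤ Real.exp (3 * β * (h + 1))

/-- The admissible collections all of whose contours are `h`-elementary. -/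
def ElementaryCollections (β lam : ℝ) (η : Site → Sgn) (h : ℤ) (V : Set Site) :
    Set (Set Contour) :=
  {Γ | Γ ∈ Collections η h V ∧ ∀ c ∈ Γ, IsElementary β lam h c.loop}

/-- The elementary partition function. -/
def Zel (β lam : ℝ) (η : Site → Sgn) (h : ℤ) (V : Set Site) : ℝ :=
  Real.exp (-lam * h * V.ncard) *
    ∑' Γ : ElementaryCollections β lam η h V, collectionWeight β lam Γ

/-- The `h`-renormalized weight of a contour with the given direction. -/
def renormalizedWeight (β lam : ℝ) (h : ℤ) (γ : Finset DualEdge) : Direction → ℝ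
  | .up => Real.exp (-β * γ.card) *
      (Z β lam (fun _ => .plus) (h + 1) (Inside γ) / Z β lam (fun _ => .plus) h (Inside γ))
  | .down => Real.exp (-β * γ.card) *
      (Z β lam (fun _ => .minus) (h - 1) (Inside γ) / Z β lam (fun _ => .minus) h (Inside γ))

end

end SOS

set_option linter.unusedSimpArgs false

namespace SOS

noncomputable section

/-! ### Local geometry at a dual vertex -/

/-! Subtracting the boundary height turns a contour collection into a configuration `ψ` that
vanishes off `V` and stays above the floor `-h`. The product of the contour weights becomes the
Gibbs weight `exp (-β * energy ψ - lam * mass ψ)` (`collectionWeight_contours`, `confEquiv`). The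
prefactors cancel against `exp (-lam * (m - k) * |V|)`, so the ratios compare two sets `Conf V η f
D` that differ only in the floor `f` and in the admitted loops `D`. Everything then follows from
Peierls arguments on such sets.

Geometry: at each dual vertex the splitting rule joins the north-west and the south-east site, for a
set and for its complement alike. It is thus the self-dual adjacency of the triangular lattice. Sets
that do not touch in this lattice have separate loops (`Separated.isLoopOf_or`). Therefore raising
the heights inside a down-contour by one, or lowering them inside an up-contour, creates no new
loops (`isLoopOf_raise`, `isLoopOf_lower`) and saves the energy `|γ|`. The first move respects the
floor; the second needs the floor lowered by one inside `γ`.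

Since `|Int γ| ≤ diam γ * |γ| / 2`, the condition `lam * diam γ ≤ 1` makes the field harmless for
down-contours, and there are at most `n * 4 ^ n` contours of length `n` around a site. The cheapest
way to reach depth `j` at `x` is a spike over `x` alone, with factor `exp (-(4 * β - lam))` per
level; two low sites require a contour of length at least 6. This gives `totalWeight_below_le`.
Hence lowering the floor at a site where it is at most `-k` multiplies the weight by at most `exp
(1.5 * s)`, with `s = spike β lam k` (`totalWeight_floor_le`).

This pays for the removal of up-contours as well: by `diam γ ≤ exp (3 * β * (k + 1))` the total
price `1.5 * s * |Int γ|` is at most `|γ|`. So long contours of either direction are rare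
(`totalWeight_big_le`). For the lower bound on the ratio, one forbids the loops that are not
`k`-elementary, at cost `0.5 * s` per site, and raises the floor, at cost `1.5 * s` per site. For
the upper bound, a site of the strict interior is flat with probability at least 0.9, and a spike of
depth `k + 1` planted there gains a factor `1 + 0.9 * s` (`totalWeight_deepen`).

Inside an elementary contour every loop has at most the diameter of that contour, so the floor
comparison also controls the full partition functions in the renormalized weights. -/

/-- Adjacency of the triangular lattice that is obtained from the square lattice by adding the
diagonals that run from the north-west to the south-east. -/
def TriAdj (x y : Site) : Prop :=
  Adj x y ∨ (y.1 = x.1 + 1 ∧ y.2 = x.2 - 1) ∨ (y.1 = x.1 - 1 ∧ y.2 = x.2 + 1)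

/-- No site of `X` is equal or adjacent to a site of `Y` in the triangular lattice. -/
def Separated (X Y : Set Site) : Prop := ∀ x ∈ X, ∀ y ∈ Y, x ≠ y ∧ ¬ TriAdj x y

instance instDecidableEqDualEdge : DecidableEq DualEdge := Classical.decEq _

/-- The dual edge `e` has the end `v`. -/
def AtVertex (v : DualVertex) (e : DualEdge) : Prop :=
  e = eastEdge v ∨ e = northEdge v ∨ e = westEdge v ∨ e = southEdge v

theorem adj_iff {x y : Site} : Adj x y ↔
    (y.1 = x.1 + 1 ∧ y.2 = x.2) ∨ (y.1 = x.1 - 1 ∧ y.2 = x.2) ∨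
    (y.1 = x.1 ∧ y.2 = x.2 + 1) ∨ (y.1 = x.1 ∧ y.2 = x.2 - 1) := by
  unfold Adj
  grind

theorem Adj.symm {x y : Site} (h : Adj x y) : Adj y x := by
  rw [adj_iff] at *; omega

theorem TriAdj.symm {x y : Site} (h : TriAdj x y) : TriAdj y x := by
  unfold TriAdj at *; rw [adj_iff] at *; omega

theorem Separated.symm {X Y : Set Site} (h : Separated X Y) : Separated Y X :=
  fun y hy x hx => ⟨(h x hx y hy).1.symm, fun h' => (h x hx y hy).2 h'.symm⟩

theorem mem_dualBoundary {A : Set Site} {e : DualEdge} :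
    e ∈ dualBoundary A ↔ ¬ (e.side₁ ∈ A ↔ e.side₂ ∈ A) := by
  simp only [dualBoundary, Set.mem_ofPred_eq, Xor]; tauto

theorem dualBoundary_compl (A : Set Site) : dualBoundary Aᶜ = dualBoundary A := by
  ext e; simp only [mem_dualBoundary, Set.mem_compl_iff]; tauto

theorem adj_sides (e : DualEdge) : Adj e.side₁ e.side₂ := by
  rw [adj_iff]; cases e <;> simp [DualEdge.side₁, DualEdge.side₂]

theorem exists_edge_of_adj {x y : Site} (h : Adj x y) :
    ∃ e : DualEdge, (e.side₁ = x ∧ e.side₂ = y) ∨ (e.side₁ = y ∧ e.side₂ = x) := by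
  obtain ⟨a, b⟩ := x
  obtain ⟨c, d⟩ := y
  rw [adj_iff] at h
  simp only at h
  rcases h with ⟨rfl, rfl⟩ | ⟨rfl, rfl⟩ | ⟨rfl, rfl⟩ | ⟨rfl, rfl⟩
  · exact ⟨.ver (a, d - 1), Or.inl (by simp [DualEdge.side₁, DualEdge.side₂])⟩
  · exact ⟨.ver (a - 1, d - 1), Or.inr (by simp [DualEdge.side₁, DualEdge.side₂])⟩
  · exact ⟨.hor (c - 1, b), Or.inl (by simp [DualEdge.side₁, DualEdge.side₂])⟩
  · exact ⟨.hor (c - 1, b - 1), Or.inr (by simp [DualEdge.side₁, DualEdge.side₂])⟩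

theorem atVertex_iff {v : DualVertex} {e : DualEdge} : AtVertex v e ↔ e.tail = v ∨ e.head = v := by
  obtain ⟨a, b⟩ := v
  rcases e with ⟨c, d⟩ | ⟨c, d⟩ <;>
  simp [AtVertex, eastEdge, northEdge, westEdge, southEdge, DualEdge.tail, DualEdge.head] <;> omega

theorem DualEdge.Joins.atVertex_left {e : DualEdge} {u v : DualVertex} (h : e.Joins u v) :
    AtVertex u e := by
  rw [atVertex_iff]; rcases h with h | h <;> tauto

theorem DualEdge.Joins.atVertex_right {e : DualEdge} {u v : DualVertex} (h : e.Joins u v) :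
    AtVertex v e := by
  rw [atVertex_iff]; rcases h with h | h <;> tauto

theorem DualEdge.tail_ne_head (e : DualEdge) : e.tail ≠ e.head := by
  rcases e with ⟨c, d⟩ | ⟨c, d⟩ <;> simp [DualEdge.tail, DualEdge.head]

theorem DualEdge.Joins.ne {e : DualEdge} {u v : DualVertex} (h : e.Joins u v) : u ≠ v := by
  rcases h with h | h
  · rw [← h.1, ← h.2]; exact e.tail_ne_head
  · rw [← h.1, ← h.2]; exact e.tail_ne_head.symm

/-- The edges `e` and `f` of `B` follow each other at the dual vertex `v` when `B` is cut by the
splitting rule. -/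
structure Partner (B : Set DualEdge) (v : DualVertex) (e f : DualEdge) : Prop where
  left_mem : e ∈ B
  right_mem : f ∈ B
  ne : e ≠ f
  left_at : AtVertex v e
  right_at : AtVertex v f
  linked : IsCross B v → Linked v e f

theorem Linked.symm {v : DualVertex} {e f : DualEdge} (h : Linked v e f) : Linked v f e := by
  unfold Linked at *; tauto

theorem Partner.symm {B : Set DualEdge} {v : DualVertex} {e f : DualEdge} (h : Partner B v e f) :
    Partner B v f e :=
  ⟨h.right_mem, h.left_mem, h.ne.symm, h.right_at, h.left_at, fun hc => (h.linked hc).symm⟩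

section Star

variable (v : DualVertex) (A : Set Site)

theorem mem_east : eastEdge v ∈ dualBoundary A ↔
    ¬ ((v.1 + 1, v.2) ∈ A ↔ (v.1 + 1, v.2 + 1) ∈ A) := by
  rw [mem_dualBoundary]; rfl

theorem mem_north : northEdge v ∈ dualBoundary A ↔
    ¬ ((v.1, v.2 + 1) ∈ A ↔ (v.1 + 1, v.2 + 1) ∈ A) := by
  rw [mem_dualBoundary]; rfl

theorem mem_west : westEdge v ∈ dualBoundary A ↔
    ¬ ((v.1, v.2) ∈ A ↔ (v.1, v.2 + 1) ∈ A) := by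
  rw [mem_dualBoundary]; simp [westEdge, DualEdge.side₁, DualEdge.side₂]

theorem mem_south : southEdge v ∈ dualBoundary A ↔
    ¬ ((v.1, v.2) ∈ A ↔ (v.1 + 1, v.2) ∈ A) := by
  rw [mem_dualBoundary]; simp [southEdge, DualEdge.side₁, DualEdge.side₂]

theorem east_ne_north : eastEdge v ≠ northEdge v := by simp [eastEdge, northEdge]
theorem east_ne_west : eastEdge v ≠ westEdge v := by
  simp only [eastEdge, westEdge, ne_eq, DualEdge.hor.injEq, Prod.ext_iff]; omega
theorem east_ne_south : eastEdge v ≠ southEdge v := by simp [eastEdge, southEdge]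
theorem north_ne_west : northEdge v ≠ westEdge v := by simp [northEdge, westEdge]
theorem north_ne_south : northEdge v ≠ southEdge v := by
  simp only [northEdge, southEdge, ne_eq, DualEdge.ver.injEq, Prod.ext_iff]; omega
theorem west_ne_south : westEdge v ≠ southEdge v := by simp [westEdge, southEdge]

end Star

/-- The pairs of edges that follow each other at `v`, up to their order, with the configurations
of the four sites around `v` in which this happens. -/
def PartnerPattern (A : Set Site) (v : DualVertex) (e f : DualEdge) : Prop :=
  (e = southEdge v ∧ f = westEdge v ∧ ¬ ((v.1, v.2) ∈ A ↔ (v.1 + 1, v.2) ∈ A) ∧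
    ¬ ((v.1, v.2) ∈ A ↔ (v.1, v.2 + 1) ∈ A)) ∨
  (e = northEdge v ∧ f = eastEdge v ∧ ¬ ((v.1 + 1, v.2 + 1) ∈ A ↔ (v.1 + 1, v.2) ∈ A) ∧
    ¬ ((v.1 + 1, v.2 + 1) ∈ A ↔ (v.1, v.2 + 1) ∈ A)) ∨
  (e = southEdge v ∧ f = northEdge v ∧ ((v.1, v.2) ∈ A ↔ (v.1, v.2 + 1) ∈ A) ∧
    ((v.1 + 1, v.2) ∈ A ↔ (v.1 + 1, v.2 + 1) ∈ A) ∧ ¬ ((v.1, v.2) ∈ A ↔ (v.1 + 1, v.2) ∈ A)) ∨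
  (e = westEdge v ∧ f = eastEdge v ∧ ((v.1, v.2) ∈ A ↔ (v.1 + 1, v.2) ∈ A) ∧
    ((v.1, v.2 + 1) ∈ A ↔ (v.1 + 1, v.2 + 1) ∈ A) ∧ ¬ ((v.1, v.2) ∈ A ↔ (v.1, v.2 + 1) ∈ A)) ∨
  (e = southEdge v ∧ f = eastEdge v ∧ ((v.1, v.2) ∈ A ↔ (v.1, v.2 + 1) ∈ A) ∧
    ((v.1, v.2) ∈ A ↔ (v.1 + 1, v.2 + 1) ∈ A) ∧ ¬ ((v.1, v.2) ∈ A ↔ (v.1 + 1, v.2) ∈ A)) ∨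
  (e = northEdge v ∧ f = westEdge v ∧ ((v.1, v.2) ∈ A ↔ (v.1 + 1, v.2) ∈ A) ∧
    ((v.1, v.2) ∈ A ↔ (v.1 + 1, v.2 + 1) ∈ A) ∧ ¬ ((v.1, v.2) ∈ A ↔ (v.1, v.2 + 1) ∈ A))

/-- A finite check over the sixteen occupations of the four sites around `v`; it is what makes the
continuation of a loop unique. -/
theorem Partner.pattern {A : Set Site} {v : DualVertex} {e f : DualEdge}
    (h : Partner (dualBoundary A) v e f) : PartnerPattern A v e f ∨ PartnerPattern A v f e := by
  obtain ⟨h1, h2, h3, h4, h5, h6⟩ := h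
  have n1 := east_ne_north v
  have n2 := east_ne_west v
  have n3 := east_ne_south v
  have n4 := north_ne_west v
  have n5 := north_ne_south v
  have n6 := west_ne_south v
  simp only [PartnerPattern]
  rcases h4 with rfl | rfl | rfl | rfl <;> rcases h5 with rfl | rfl | rfl | rfl <;>
    first
    | exact absurd rfl h3
    | (simp only [IsCross, Linked, mem_east, mem_north, mem_west, mem_south, n1, n2, n3, n4, n5, n6,
        n1.symm, n2.symm, n3.symm, n4.symm, n5.symm, n6.symm, and_true, and_false,
        false_and, or_false, false_or, or_true, true_and] at h1 h2 h6 ⊢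
       clear h3 n1 n2 n3 n4 n5 n6
       by_cases a1 : (v.1, v.2) ∈ A <;> by_cases a2 : (v.1 + 1, v.2) ∈ A <;>
       by_cases a3 : (v.1, v.2 + 1) ∈ A <;> by_cases a4 : (v.1 + 1, v.2 + 1) ∈ A <;>
       simp only [a1, a2, a3, a4, not_true_eq_false, not_false_eq_true, iff_true, iff_false,
        forall_true_left, false_imp_iff, and_self, or_true, true_or, and_true, true_and, and_false,
        or_self, imp_false, not_not, imp_self, false_and, or_false] at h1 h2 h6 ⊢)

set_option maxHeartbeats 1000000 in
theorem PartnerPattern.unique_of {A : Set Site} {v : DualVertex} {e f g : DualEdge}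
    (hf : PartnerPattern A v e f ∨ PartnerPattern A v f e)
    (hg : PartnerPattern A v e g ∨ PartnerPattern A v g e) : f = g := by
  have n1 := east_ne_north v
  have n2 := east_ne_west v
  have n3 := east_ne_south v
  have n4 := north_ne_west v
  have n5 := north_ne_south v
  have n6 := west_ne_south v
  simp only [PartnerPattern] at hf hg
  rcases hf with (⟨rfl, rfl, h⟩ | ⟨rfl, rfl, h⟩ | ⟨rfl, rfl, h⟩ | ⟨rfl, rfl, h⟩ | ⟨rfl, rfl, h⟩ |
    ⟨rfl, rfl, h⟩) | (⟨rfl, rfl, h⟩ | ⟨rfl, rfl, h⟩ | ⟨rfl, rfl, h⟩ | ⟨rfl, rfl, h⟩ |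
    ⟨rfl, rfl, h⟩ | ⟨rfl, rfl, h⟩) <;>
  simp only [n1, n2, n3, n4, n5, n6, n1.symm, n2.symm, n3.symm, n4.symm, n5.symm, n6.symm,
    true_and, false_and, or_false, false_or, and_false, or_assoc] at hg <;>
  clear n1 n2 n3 n4 n5 n6 <;>
  rcases hg with ⟨rfl, hg⟩ | ⟨rfl, hg⟩ | ⟨rfl, hg⟩ <;> first | rfl | (exfalso; tauto)

/-- The splitting rule leaves at most one continuation. -/
theorem Partner.unique {A : Set Site} {v : DualVertex} {e f g : DualEdge}
    (hf : Partner (dualBoundary A) v e f) (hg : Partner (dualBoundary A) v e g) : f = g :=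
  PartnerPattern.unique_of hf.pattern hg.pattern

/-! ### Orientation of boundary edges -/

/-- The end of a boundary edge of `A` to which one travels with `A` on the left. -/
def target (A : Set Site) (e : DualEdge) : DualVertex := by
  classical exact
  match e with
  | .hor v => if (DualEdge.hor v).side₂ ∈ A then (DualEdge.hor v).head else v
  | .ver v => if (DualEdge.ver v).side₁ ∈ A then (DualEdge.ver v).head else v

/-- The end of a boundary edge of `A` from which one travels with `A` on the left. -/
def source (A : Set Site) (e : DualEdge) : DualVertex := by
  classical exact
  match e with
  | .hor v => if (DualEdge.hor v).side₂ ∈ A then v else (DualEdge.hor v).head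
  | .ver v => if (DualEdge.ver v).side₁ ∈ A then v else (DualEdge.ver v).head

theorem joins_source_target (A : Set Site) (e : DualEdge) : e.Joins (source A e) (target A e) := by
  rcases e with v | v <;> simp only [source, target] <;> split_ifs <;>
    simp [DualEdge.Joins, DualEdge.tail]

section SourceTarget

variable (v : DualVertex) (A : Set Site)

theorem target_east : target A (eastEdge v) = v ↔ (v.1 + 1, v.2 + 1) ∉ A := by
  simp only [target, eastEdge, DualEdge.side₂, DualEdge.head]; split_ifs <;> simp [Prod.ext_iff, *]
theorem target_north : target A (northEdge v) = v ↔ (v.1, v.2 + 1) ∉ A := by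
  simp only [target, northEdge, DualEdge.side₁, DualEdge.head]; split_ifs <;> simp [Prod.ext_iff, *]
theorem target_west : target A (westEdge v) = v ↔ (v.1, v.2 + 1) ∈ A := by
  by_cases h : (v.1, v.2 + 1) ∈ A <;>
    simp [target, westEdge, DualEdge.side₂, DualEdge.head, h, Prod.ext_iff]
theorem target_south : target A (southEdge v) = v ↔ (v.1, v.2) ∈ A := by
  simp only [target, southEdge, DualEdge.side₁, DualEdge.head, sub_add_cancel]
  split_ifs <;> simp_all [Prod.ext_iff]
theorem source_east : source A (eastEdge v) = v ↔ (v.1 + 1, v.2 + 1) ∈ A := by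
  simp only [source, eastEdge, DualEdge.side₂, DualEdge.head]; split_ifs <;> simp [Prod.ext_iff, *]
theorem source_north : source A (northEdge v) = v ↔ (v.1, v.2 + 1) ∈ A := by
  simp only [source, northEdge, DualEdge.side₁, DualEdge.head]; split_ifs <;> simp [Prod.ext_iff, *]
theorem source_west : source A (westEdge v) = v ↔ (v.1, v.2 + 1) ∉ A := by
  by_cases h : (v.1, v.2 + 1) ∈ A <;>
    simp [source, westEdge, DualEdge.side₂, DualEdge.head, h, Prod.ext_iff]
theorem source_south : source A (southEdge v) = v ↔ (v.1, v.2) ∉ A := by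
  simp only [source, southEdge, DualEdge.side₁, DualEdge.head, sub_add_cancel]
  split_ifs <;> simp_all [Prod.ext_iff]

end SourceTarget

/-- One can continue with `A` on the left. -/
theorem exists_continuation {A : Set Site} {e : DualEdge} (he : e ∈ dualBoundary A) :
    ∃ f, source A f = target A e ∧ Partner (dualBoundary A) (target A e) e f := by
  obtain ⟨v, hv⟩ : ∃ v, target A e = v := ⟨_, rfl⟩
  rw [hv]
  have h4 : AtVertex v e := by
    rw [← hv]; exact (joins_source_target A e).atVertex_right
  have n1 := east_ne_north v
  have n2 := east_ne_west v
  have n3 := east_ne_south v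
  have n4 := north_ne_west v
  have n5 := north_ne_south v
  have n6 := west_ne_south v
  have key : ∀ f, f ∈ dualBoundary A → source A f = v → e ≠ f → AtVertex v f →
      (IsCross (dualBoundary A) v → Linked v e f) →
      ∃ f, source A f = v ∧ Partner (dualBoundary A) v e f :=
    fun f h1 h2 h3 h5 h6 => ⟨f, h2, he, h1, h3, h4, h5, h6⟩
  have kE := key (eastEdge v)
  have kN := key (northEdge v)
  have kW := key (westEdge v)
  have kS := key (southEdge v)
  simp only [source_east, source_north, source_west, source_south, AtVertex, true_or, or_true,
    forall_true_left] at kE kN kW kS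
  rcases h4 with rfl | rfl | rfl | rfl <;>
    simp only [target_east, target_north, target_west, target_south] at hv <;>
    simp only [IsCross, Linked, mem_east, mem_north, mem_west, mem_south, n1, n2, n3, n4, n5, n6,
      n1.symm, n2.symm, n3.symm, n4.symm, n5.symm, n6.symm, and_true, true_and, and_false,
      false_and, or_false, false_or, or_true, true_or, ne_eq, not_true_eq_false, not_false_eq_true,
      forall_true_left, false_imp_iff] at he kE kN kW kS <;>
    by_cases a1 : (v.1, v.2) ∈ A <;> by_cases a2 : (v.1 + 1, v.2) ∈ A <;>
    by_cases a3 : (v.1, v.2 + 1) ∈ A <;> by_cases a4 : (v.1 + 1, v.2 + 1) ∈ A <;>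
    simp only [a1, a2, a3, a4, not_true_eq_false, not_false_eq_true, iff_true, iff_false, true_iff,
      false_iff, forall_true_left, false_imp_iff, and_true, true_and, and_false,
      false_and] at hv he kE kN kW kS <;>
    first
    | exact kE
    | exact kN
    | exact kW
    | exact kS

/-! ### The loops of a set of dual edges -/

/-- The path of a loop, with its consecutive edges being partners. -/
theorem IsLoopOf.exists_path {B : Set DualEdge} {γ : Finset DualEdge} (h : IsLoopOf B γ) :
    ∃ (n : ℕ) (v : ℕ → DualVertex) (e : ℕ → DualEdge), 0 < n ∧ (∀ i, v (i + n) = v i) ∧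
      (∀ i, e (i + n) = e i) ∧ (∀ i, (e i).Joins (v i) (v (i + 1))) ∧
      (∀ i < n, ∀ j < n, e i = e j → i = j) ∧ (∀ f, f ∈ γ ↔ ∃ i < n, e i = f) ∧
      (∀ i, e i ∈ γ) ∧ (∀ i, Partner B (v (i + 1)) (e i) (e (i + 1))) := by
  obtain ⟨hB, n, v, e, hn, hv, he, hj, hd, hm, hl⟩ := h
  have hmod : ∀ i, e i = e (i % n) := fun i => by
    have hp : Function.Periodic e n := he
    exact (hp.map_mod_nat i).symm
  have hmem : ∀ i, e i ∈ γ := fun i => (hm _).2 ⟨i % n, Nat.mod_lt _ hn, (hmod i).symm⟩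
  refine ⟨n, v, e, hn, hv, he, hj, hd, hm, hmem, fun i => ⟨hB (hmem i), hB (hmem _), ?_,
    (hj i).atVertex_right, (hj (i + 1)).atVertex_left, hl i⟩⟩
  -- Equal consecutive edges would force `n = 1`, and then an edge would join a dual vertex to
  -- itself.
  intro heq
  rw [hmod i, hmod (i + 1)] at heq
  have h1 := hd _ (Nat.mod_lt _ hn) _ (Nat.mod_lt _ hn) heq
  have h2 : n ∣ 1 := by
    have := (Nat.modEq_iff_dvd' (Nat.le_succ i)).1 h1
    simpa using this
  have h3 : n = 1 := Nat.dvd_one.1 h2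
  subst h3
  exact (hj i).ne (hv i).symm

theorem IsLoopOf.nonempty {B : Set DualEdge} {γ : Finset DualEdge} (h : IsLoopOf B γ) :
    γ.Nonempty := by
  obtain ⟨n, v, e, -, -, -, -, -, -, hm, -⟩ := h.exists_path
  exact ⟨_, hm 0⟩

/-- A property that passes from an edge of a loop to its partners holds along the whole loop. -/
theorem IsLoopOf.induction {B : Set DualEdge} {γ : Finset DualEdge} (h : IsLoopOf B γ)
    {P : DualEdge → Prop} {e₀ : DualEdge} (h₀ : e₀ ∈ γ) (hP : P e₀)
    (step : ∀ v e f, e ∈ γ → f ∈ γ → Partner B v e f → P e → P f) : ∀ e ∈ γ, P e := by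
  obtain ⟨n, v, e, hn, hv, he, hj, hd, hm, hmem, hp⟩ := h.exists_path
  obtain ⟨i, hi, rfl⟩ := (hm _).1 h₀
  have key : ∀ k, P (e (i + k)) := by
    intro k
    induction k with
    | zero => exact hP
    | succ k ih => exact step _ _ _ (hmem _) (hmem _) (hp (i + k)) ih
  intro f hf
  obtain ⟨j, hj, rfl⟩ := (hm _).1 hf
  have := key (n - i + j)
  rwa [show i + (n - i + j) = j + n by omega, he] at this

/-- A loop contains the partners of its edges. -/
theorem IsLoopOf.partner_mem {A : Set Site} {γ : Finset DualEdge} (h : IsLoopOf (dualBoundary A) γ)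
    {v : DualVertex} {e f : DualEdge} (he : e ∈ γ) (hp : Partner (dualBoundary A) v e f) :
    f ∈ γ := by
  obtain ⟨n, u, c, hn, hu, hc, hj, hd, hm, hmem, hpar⟩ := h.exists_path
  obtain ⟨i, hi, rfl⟩ := (hm _).1 he
  -- At either end of the edge, its neighbour along the path is a partner, and partners are unique.
  have hends : v = u i ∨ v = u (i + 1) := by
    have h1 := atVertex_iff.1 hp.left_at
    rcases hj i with h2 | h2 <;> rw [h2.1, h2.2] at h1 <;> tauto
  rcases hends with rfl | rfl
  · have h1 := hpar (i + n - 1)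
    rw [show i + n - 1 + 1 = i + n by omega, hu, hc] at h1
    rw [hp.unique h1.symm]
    exact hmem _
  · rw [hp.unique (hpar i)]
    exact hmem _

theorem IsLoopOf.subset_of_common_edge {A : Set Site} {γ γ' : Finset DualEdge}
    (h : IsLoopOf (dualBoundary A) γ) (h' : IsLoopOf (dualBoundary A) γ') {e : DualEdge}
    (he : e ∈ γ) (he' : e ∈ γ') : γ ⊆ γ' :=
  h.induction (P := fun e => e ∈ γ') he he' fun _ _ _ _ _ hp h1 => h'.partner_mem h1 hp

/-- Distinct loops of an edge boundary are disjoint. -/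
theorem IsLoopOf.eq_of_common_edge {A : Set Site} {γ γ' : Finset DualEdge}
    (h : IsLoopOf (dualBoundary A) γ) (h' : IsLoopOf (dualBoundary A) γ') {e : DualEdge}
    (he : e ∈ γ) (he' : e ∈ γ') : γ = γ' :=
  (h.subset_of_common_edge h' he he').antisymm (h'.subset_of_common_edge h he' he)

/-- Every edge of a finite edge boundary lies on a loop. -/
theorem exists_loop_of_mem {A : Set Site} (hA : (dualBoundary A).Finite) {e : DualEdge}
    (he : e ∈ dualBoundary A) : ∃ γ, IsLoopOf (dualBoundary A) γ ∧ e ∈ γ := by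
  classical
  have hch : ∀ e : dualBoundary A, ∃ f : dualBoundary A, source A f = target A e ∧
      Partner (dualBoundary A) (target A e) e f := fun e => by
    obtain ⟨f, h1, h2⟩ := exists_continuation e.2
    exact ⟨⟨f, h2.right_mem⟩, h1, h2⟩
  choose nx hsrc hpar using hch
  have : Finite (dualBoundary A) := hA
  -- The predecessor is unique as well, so the successor map is injective on a finite set: every
  -- edge is periodic, and its orbit is the loop.
  have hinj : Function.Injective nx := by
    intro a b hab
    have h1 := hpar a
    have h2 := hpar b
    rw [← hsrc] at h1 h2
    rw [← hab] at h2
    exact Subtype.ext (h1.symm.unique h2.symm)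
  set a : dualBoundary A := ⟨e, he⟩
  have hper : a ∈ Function.periodicPts nx := hinj.mem_periodicPts a
  set n := Function.minimalPeriod nx a
  have hn : 0 < n := Function.minimalPeriod_pos_of_mem_periodicPts hper
  let c : ℕ → dualBoundary A := fun i => nx^[i] a
  have hc : ∀ i, c (i + n) = c i := fun i => by
    simp only [c, n]
    exact Function.iterate_add_minimalPeriod_eq
  have hsucc : ∀ i, c (i + 1) = nx (c i) := fun i => Function.iterate_succ_apply' nx i a
  refine ⟨(Finset.range n).image fun i => (c i : DualEdge), ⟨?_, n, fun i => source A (c i),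
    fun i => c i, hn, fun i => by simp only [hc], fun i => by simp only [hc], fun i => ?_, ?_, ?_,
    fun i => ?_⟩, ?_⟩
  · intro f hf
    simp only [Finset.coe_image, Set.mem_image] at hf
    obtain ⟨i, -, rfl⟩ := hf
    exact (c i).2
  · simp only [hsucc, hsrc]
    exact joins_source_target A _
  · intro i hi j hj hij
    exact Function.iterate_injOn_Iio_minimalPeriod hi hj (Subtype.ext hij)
  · intro f; simp
  · simp only [hsucc, hsrc]
    exact (hpar (c i)).linked
  · simp only [Finset.mem_image, Finset.mem_range]
    exact ⟨0, hn, rfl⟩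

/-! ### Separated sets -/

theorem Separated.dualBoundary_union {X Y : Set Site} (h : Separated X Y) :
    dualBoundary (X ∪ Y) = dualBoundary X ∪ dualBoundary Y := by
  ext e
  have ha := adj_sides e
  have h1 := fun a b => (h e.side₁ a e.side₂ b).2 (Or.inl ha)
  have h2 := fun a b => (h e.side₂ a e.side₁ b).2 (Or.inl ha.symm)
  have h3 := fun a b => (h e.side₁ a e.side₁ b).1 rfl
  have h4 := fun a b => (h e.side₂ a e.side₂ b).1 rfl
  simp only [Set.mem_union, mem_dualBoundary]
  tauto

/-- Only a new cross at `v` could spoil the pairing. If the pair is not already one that the rule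
links, a cross in the union would need the north-west and the south-east site in different sets,
which separation excludes. -/
theorem Separated.partner {X Y : Set Site} (h : Separated X Y) {v : DualVertex} {e f : DualEdge}
    (hp : Partner (dualBoundary X) v e f) : Partner (dualBoundary (X ∪ Y)) v e f := by
  have hU := h.dualBoundary_union
  refine ⟨hU ▸ Or.inl hp.left_mem, hU ▸ Or.inl hp.right_mem, hp.ne, hp.left_at, hp.right_at, ?_⟩
  have key : ∀ e f, PartnerPattern X v e f → IsCross (dualBoundary (X ∪ Y)) v →
      Linked v e f := by
    clear hp
    rintro e f hpat ⟨c1, c2, c3, c4⟩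
    simp only [mem_east, mem_north, mem_west, mem_south, Set.mem_union] at c1 c2 c3 c4
    have t5 : TriAdj (v.1, v.2 + 1) (v.1 + 1, v.2) := Or.inr (Or.inl (by simp))
    have s1 := fun a b => (h _ a _ b).2 t5
    have s2 := fun a b => (h _ a _ b).2 t5.symm
    unfold PartnerPattern at hpat
    unfold Linked
    rcases hpat with hpat | hpat | hpat | hpat | hpat | hpat
    · exact Or.inl ⟨hpat.1, hpat.2.1⟩
    · exact Or.inr (Or.inr (Or.inl ⟨hpat.1, hpat.2.1⟩))
    all_goals
      exfalso
      obtain ⟨-, -, k1, k2, k3⟩ := hpat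
      clear t5 hU h
      by_cases b1 : (v.1 + 1, v.2) ∈ X <;> by_cases b2 : (v.1, v.2 + 1) ∈ X <;>
      simp only [b1, b2, iff_true, iff_false, true_or, false_or, not_true_eq_false, true_iff,
        not_false_eq_true, not_not, false_imp_iff, forall_true_left] at c1 c2 c3 c4 k1 k2 k3 s1 s2 <;>
      tauto
  intro hc
  rcases hp.pattern with h' | h'
  · exact key e f h' hc
  · exact (key f e h' hc).symm

theorem Separated.isLoopOf {X Y : Set Site} (h : Separated X Y) {γ : Finset DualEdge}
    (hγ : IsLoopOf (dualBoundary X) γ) : IsLoopOf (dualBoundary (X ∪ Y)) γ := by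
  obtain ⟨n, v, e, hn, hv, he, hj, hd, hm, hmem, hp⟩ := hγ.exists_path
  refine ⟨fun f hf => ?_, n, v, e, hn, hv, he, hj, hd, hm, fun i => (h.partner (hp i)).linked⟩
  rw [h.dualBoundary_union]
  exact Or.inl (hγ.1 hf)

/-- A loop of the union of two separated sets is a loop of one of the two sets. -/
theorem Separated.isLoopOf_or {X Y : Set Site} (h : Separated X Y) {γ : Finset DualEdge}
    (hfin : (dualBoundary (X ∪ Y)).Finite) (hγ : IsLoopOf (dualBoundary (X ∪ Y)) γ) :
    IsLoopOf (dualBoundary X) γ ∨ IsLoopOf (dualBoundary Y) γ := by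
  obtain ⟨e, he⟩ := hγ.nonempty
  have hU := h.dualBoundary_union
  have hmem := hγ.1 he
  rw [hU] at hmem
  rcases hmem with hX | hY
  · left
    obtain ⟨γ', h1, h2⟩ := exists_loop_of_mem (hfin.subset (hU ▸ Set.subset_union_left)) hX
    rwa [hγ.eq_of_common_edge (h.isLoopOf h1) he h2]
  · right
    obtain ⟨γ', h1, h2⟩ := exists_loop_of_mem (hfin.subset (hU ▸ Set.subset_union_right)) hY
    have h3 := h.symm.isLoopOf h1
    rw [Set.union_comm] at h3
    rwa [hγ.eq_of_common_edge h3 he h2]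

/-! ### The interior of a contour -/

/-- A finite set of dual edges lies in a box. -/
theorem exists_box (γ : Finset DualEdge) : ∃ M : ℤ, 0 < M ∧ ∀ e ∈ γ,
    -M < e.tail.1 ∧ e.tail.1 < M ∧ -M < e.tail.2 ∧ e.tail.2 < M := by
  induction γ using Finset.induction_on with
  | empty => exact ⟨1, by simp⟩
  | insert e γ _ ih =>
    obtain ⟨M, hM, h⟩ := ih
    refine ⟨M + |e.tail.1| + |e.tail.2|, by positivity, fun f hf => ?_⟩
    have h1 := abs_nonneg e.tail.1
    have h2 := abs_nonneg e.tail.2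
    rcases Finset.mem_insert.1 hf with rfl | hf
    · have := neg_abs_le f.tail.1
      have := le_abs_self f.tail.1
      have := neg_abs_le f.tail.2
      have := le_abs_self f.tail.2
      omega
    · have := h f hf
      omega

/-- The number of edges of `γ` that cross the horizontal half-line from `x` to the east. -/
def rayCount (γ : Finset DualEdge) (x : Site) : ℕ :=
  {a : ℤ | x.1 ≤ a ∧ DualEdge.ver (a, x.2 - 1) ∈ γ}.ncard

theorem mem_inside {γ : Finset DualEdge} {x : Site} : x ∈ Inside γ ↔ Odd (rayCount γ x) := Iff.rfl

theorem finite_ray (γ : Finset DualEdge) (x : Site) :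
    {a : ℤ | x.1 ≤ a ∧ DualEdge.ver (a, x.2 - 1) ∈ γ}.Finite := by
  refine Set.Finite.of_finite_image (f := fun a => DualEdge.ver (a, x.2 - 1))
    (γ.finite_toSet.subset ?_) ?_
  · rintro _ ⟨a, ha, rfl⟩
    exact ha.2
  · intro a _ b _ hab
    simpa using hab

theorem rayCount_succ (γ : Finset DualEdge) (a b : ℤ) :
    rayCount γ (a, b) = rayCount γ (a + 1, b) + (if DualEdge.ver (a, b - 1) ∈ γ then 1 else 0) := by
  classical
  unfold rayCount
  split_ifs with h
  · rw [← Set.ncard_insert_of_notMem (a := a) (by simp) (finite_ray γ (a + 1, b))]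
    congr 1
    ext c
    simp only [Set.mem_ofPred_eq, Set.mem_insert_iff]
    constructor
    · rintro ⟨h1, h2⟩
      rcases h1.eq_or_lt with h3 | h3
      · exact Or.inl h3.symm
      · exact Or.inr ⟨h3, h2⟩
    · rintro (rfl | ⟨h1, h2⟩)
      · exact ⟨le_rfl, h⟩
      · exact ⟨by omega, h2⟩
  · rw [add_zero]
    congr 1
    ext c
    simp only [Set.mem_ofPred_eq]
    constructor
    · rintro ⟨h1, h2⟩
      rcases h1.eq_or_lt with h3 | h3
      · subst h3; exact absurd h2 h
      · exact ⟨h3, h2⟩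
    · rintro ⟨h1, h2⟩
      exact ⟨by omega, h2⟩

theorem rayCount_eq_zero {γ : Finset DualEdge} {x : Site}
    (h : ∀ a, x.1 ≤ a → DualEdge.ver (a, x.2 - 1) ∉ γ) : rayCount γ x = 0 := by
  unfold rayCount
  convert Set.ncard_empty ℤ
  ext a
  simp only [Set.mem_ofPred_eq, Set.mem_empty_iff_false, iff_false, not_and]
  exact h a

/-- A closed path has an even number of edges at every dual vertex. -/
theorem IsGeometricContour.even_degree {γ : Finset DualEdge} (h : IsGeometricContour γ)
    (v : DualVertex) : Even ((if eastEdge v ∈ γ then 1 else 0) + (if northEdge v ∈ γ then 1 else 0) +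
      (if westEdge v ∈ γ then 1 else 0) + (if southEdge v ∈ γ then 1 else 0) : ℕ) := by
  classical
  obtain ⟨n, u, e, hn, hu, he, hj, hd, hm, hmem, hp⟩ := h.exists_path
  have h1 : (γ.filter (AtVertex v)).card = (if eastEdge v ∈ γ then 1 else 0) +
      (if northEdge v ∈ γ then 1 else 0) + (if westEdge v ∈ γ then 1 else 0) +
      (if southEdge v ∈ γ then 1 else 0) := by
    have : γ.filter (AtVertex v) =
        ({eastEdge v, northEdge v, westEdge v, southEdge v} : Finset DualEdge).filter (· ∈ γ) := by
      ext f
      simp only [Finset.mem_filter, AtVertex, Finset.mem_insert, Finset.mem_singleton]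
      tauto
    rw [this, Finset.card_filter, Finset.sum_insert, Finset.sum_insert, Finset.sum_insert,
      Finset.sum_singleton, add_assoc, add_assoc]
    · simpa using west_ne_south v
    · simpa using ⟨north_ne_west v, north_ne_south v⟩
    · simpa using ⟨east_ne_north v, east_ne_west v, east_ne_south v⟩
  rw [← h1]
  have h2 : γ.filter (AtVertex v) = ((Finset.range n).filter fun i => AtVertex v (e i)).image e := by
    ext f
    simp only [Finset.mem_filter, Finset.mem_image, Finset.mem_range]
    constructor
    · rintro ⟨h1, h2⟩
      obtain ⟨i, hi, rfl⟩ := (hm f).1 h1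
      exact ⟨i, ⟨hi, h2⟩, rfl⟩
    · rintro ⟨i, ⟨hi, h2⟩, rfl⟩
      exact ⟨hmem i, h2⟩
  rw [h2, Finset.card_image_of_injOn, Finset.card_filter]
  -- Edges at `v` are counted by the visits of their two ends; periodicity makes both counts equal,
  -- so their sum is even.
  · have h3 : ∀ i, (if AtVertex v (e i) then 1 else 0) =
        (if u i = v then 1 else 0) + (if u (i + 1) = v then 1 else 0) := by
      intro i
      have h4 : AtVertex v (e i) ↔ u i = v ∨ u (i + 1) = v := by
        rw [atVertex_iff]
        rcases hj i with h5 | h5 <;> rw [h5.1, h5.2]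
        exact or_comm
      have h5 := (hj i).ne
      by_cases h6 : u i = v <;> by_cases h7 : u (i + 1) = v <;> simp [h4, h6, h7]
      exact h5 (h6.trans h7.symm)
    simp only [h3, Finset.sum_add_distrib]
    have h4 : ∑ i ∈ Finset.range n, (if u (i + 1) = v then 1 else 0) =
        ∑ i ∈ Finset.range n, (if u i = v then 1 else 0) := by
      have h5 := Finset.sum_range_succ (fun i => if u i = v then 1 else 0) n
      have h6 := Finset.sum_range_succ' (fun i => if u i = v then 1 else 0) n
      have h7 := hu 0
      rw [zero_add] at h7
      simp only [h7] at h5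
      omega
    rw [h4]
    exact ⟨_, rfl⟩
  · intro i hi j hj hij
    simp only [Finset.coe_filter, Finset.mem_range, Set.mem_ofPred_eq] at hi hj
    exact hd i hi.1 j hj.1 hij

/-- The claim is trivial far to the east. Moving one column to the west changes the parity by the
four edges at one dual vertex, whose number is even. -/
theorem IsGeometricContour.even_rayCount {γ : Finset DualEdge} (h : IsGeometricContour γ)
    (a b : ℤ) : Even (rayCount γ (a, b) + rayCount γ (a, b + 1) +
      if DualEdge.hor (a - 1, b) ∈ γ then 1 else 0) := by
  obtain ⟨M, hM, hbox⟩ := exists_box γ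
  rcases le_total (M + 1) a with ha | ha
  · rw [rayCount_eq_zero, rayCount_eq_zero, if_neg]
    · simp
    · intro h1; have := hbox _ h1; simp [DualEdge.tail] at this; omega
    · intro c hc h1; have := hbox _ h1; simp [DualEdge.tail] at this hc; omega
    · intro c hc h1; have := hbox _ h1; simp [DualEdge.tail] at this hc; omega
  · induction a, ha using Int.leInductionDown with
    | base =>
      rw [rayCount_eq_zero, rayCount_eq_zero, if_neg]
      · simp
      · intro h1; have := hbox _ h1; simp [DualEdge.tail] at this
      · intro c hc h1; have := hbox _ h1; simp [DualEdge.tail] at this hc; omega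
      · intro c hc h1; have := hbox _ h1; simp [DualEdge.tail] at this hc; omega
    | pred a ha ih =>
      have h1 : Even ((if DualEdge.hor (a - 1, b) ∈ γ then 1 else 0) +
          (if DualEdge.ver (a - 1, b) ∈ γ then 1 else 0) +
          (if DualEdge.hor (a - 1 - 1, b) ∈ γ then 1 else 0) +
          (if DualEdge.ver (a - 1, b - 1) ∈ γ then 1 else 0) : ℕ) := h.even_degree (a - 1, b)
      have h2 := rayCount_succ γ (a - 1) b
      have h3 := rayCount_succ γ (a - 1) (b + 1)
      rw [add_sub_cancel_right] at h3
      rw [sub_add_cancel] at h2 h3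
      rw [h2, h3]
      rw [Nat.even_iff] at *
      omega

/-- A contour is the edge boundary of its interior. -/
theorem IsGeometricContour.dualBoundary_inside {γ : Finset DualEdge} (h : IsGeometricContour γ) :
    dualBoundary (Inside γ) = γ := by
  ext e
  rw [mem_dualBoundary, mem_inside, mem_inside, Finset.mem_coe]
  rcases e with ⟨a, b⟩ | ⟨a, b⟩
  · have h1 := h.even_rayCount (a + 1) b
    simp only [DualEdge.side₁, DualEdge.side₂]
    rw [add_sub_cancel_right, Nat.even_add, Nat.even_add] at h1
    rw [← Nat.not_even_iff_odd, ← Nat.not_even_iff_odd]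
    split_ifs at h1 with h2
    · simp only [Nat.not_even_one, iff_false, h2, iff_true] at h1 ⊢; tauto
    · simp only [Even.zero, iff_true, h2, iff_false] at h1 ⊢; tauto
  · have h1 := rayCount_succ γ a (b + 1)
    simp only [DualEdge.side₁, DualEdge.side₂]
    rw [add_sub_cancel_right] at h1
    rw [h1, Nat.odd_add]
    split_ifs with h2
    · simp only [Nat.not_even_one, iff_false, h2, iff_true]; tauto
    · simp [h2]

theorem iff_of_forall_succ {P : ℤ → Prop} {m : ℤ} (h : ∀ a, m ≤ a → (P a ↔ P (a + 1))) {a : ℤ}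
    (ha : m ≤ a) : P m ↔ P a := by
  induction a, ha using Int.leInduction with
  | base => exact Iff.rfl
  | succ a ha ih => exact ih.trans (h a ha)

theorem mem_dualBoundary_hor {A : Set Site} {a b : ℤ} : DualEdge.hor (a, b) ∈ dualBoundary A ↔
    ¬ ((a + 1, b) ∈ A ↔ (a + 1, b + 1) ∈ A) := mem_dualBoundary

theorem mem_dualBoundary_ver {A : Set Site} {a b : ℤ} : DualEdge.ver (a, b) ∈ dualBoundary A ↔
    ¬ ((a, b + 1) ∈ A ↔ (a + 1, b + 1) ∈ A) := mem_dualBoundary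

theorem inside_subset_box {γ : Finset DualEdge} (h : IsGeometricContour γ) {M : ℤ}
    (hM : ∀ e ∈ γ, -M < e.tail.1 ∧ e.tail.1 < M ∧ -M < e.tail.2 ∧ e.tail.2 < M) {x : Site}
    (hx : x ∈ Inside γ) : -M < x.1 ∧ x.1 < M ∧ -M < x.2 ∧ x.2 ≤ M := by
  obtain ⟨a, ha, hγ⟩ : ∃ a, x.1 ≤ a ∧ DualEdge.ver (a, x.2 - 1) ∈ γ := by
    by_contra! hc
    rw [mem_inside, rayCount_eq_zero hc] at hx
    simp at hx
  have h1 := hM _ hγ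
  simp only [DualEdge.tail] at h1
  refine ⟨?_, by omega, by omega, by omega⟩
  by_contra! hlt
  have hI := h.dualBoundary_inside
  -- In a column to the west of the box no horizontal edge of `γ` is met, so an interior site could
  -- be moved north to a row whose ray misses `γ`.
  have h2 := iff_of_forall_succ (P := fun b => (x.1, b) ∈ Inside γ) (m := x.2)
    (fun b _ => by
      by_contra hne
      have h3 : DualEdge.hor (x.1 - 1, b) ∈ dualBoundary (Inside γ) := by
        rw [mem_dualBoundary_hor, sub_add_cancel]; exact hne
      rw [hI] at h3
      have := hM _ h3
      simp only [DualEdge.tail] at this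
      omega) (a := M + 1) (by omega)
  have h3 : (x.1, M + 1) ∈ Inside γ := h2.1 hx
  rw [mem_inside, rayCount_eq_zero] at h3
  · simp at h3
  · intro c _ h4
    have := hM _ h4
    simp only [DualEdge.tail] at this
    omega

theorem IsGeometricContour.finite_inside {γ : Finset DualEdge} (h : IsGeometricContour γ) :
    (Inside γ).Finite := by
  obtain ⟨M, -, hM⟩ := exists_box γ
  refine ((Set.finite_Icc (-M) M).prod (Set.finite_Icc (-M) M)).subset fun x hx => ?_
  have := inside_subset_box h hM hx
  simp only [Set.mem_prod, Set.mem_Icc]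
  omega

theorem IsLoopOf.isGeometricContour {B : Set DualEdge} {γ : Finset DualEdge} (h : IsLoopOf B γ) :
    IsGeometricContour γ := by
  obtain ⟨hB, n, v, e, hn, hv, he, hj, hd, hm, hl⟩ := h
  exact ⟨subset_rfl, n, v, e, hn, hv, he, hj, hd, hm, fun i hc =>
    hl i ⟨hB hc.1, hB hc.2.1, hB hc.2.2.1, hB hc.2.2.2⟩⟩

/-- All sites of `A` along the edge boundary of `I` lie inside `I`. -/
def InnerSide (A I : Set Site) : Prop := ∀ x y, TriAdj x y → x ∈ I → y ∉ I → x ∈ A ∧ y ∉ A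

/-- The compared property says that the `A`-side of an edge is its side in `I`. Since every boundary
edge of `I` is one of `A`, agreement of the two sets can change only across an edge of `A` that is
not one of `I`, and partners have no such edge between them. -/
theorem side_dichotomy_step {A I : Set Site} {v : DualVertex} {e f : DualEdge}
    (hsub : dualBoundary I ⊆ dualBoundary A) (he : e ∈ dualBoundary I) (hf : f ∈ dualBoundary I)
    (hp : PartnerPattern A v e f) :
    (e.side₁ ∈ A ↔ e.side₁ ∈ I) ↔ (f.side₁ ∈ A ↔ f.side₁ ∈ I) := by
  have k1 := @hsub (eastEdge v)
  have k2 := @hsub (northEdge v)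
  have k3 := @hsub (westEdge v)
  have k4 := @hsub (southEdge v)
  have s1 : (eastEdge v).side₁ = (v.1 + 1, v.2) := rfl
  have s2 : (northEdge v).side₁ = (v.1, v.2 + 1) := rfl
  have s3 : (westEdge v).side₁ = (v.1, v.2) := by simp [westEdge, DualEdge.side₁]
  have s4 : (southEdge v).side₁ = (v.1, v.2) := by simp [southEdge, DualEdge.side₁]
  rw [mem_east, mem_east] at k1
  rw [mem_north, mem_north] at k2
  rw [mem_west, mem_west] at k3
  rw [mem_south, mem_south] at k4
  rcases hp with ⟨rfl, rfl, hp⟩ | ⟨rfl, rfl, hp⟩ | ⟨rfl, rfl, hp⟩ | ⟨rfl, rfl, hp⟩ |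
    ⟨rfl, rfl, hp⟩ | ⟨rfl, rfl, hp⟩ <;>
  simp only [mem_east, mem_north, mem_west, mem_south] at he hf <;>
  simp only [s1, s2, s3, s4]
  · have l1 := k1 hf
    have l2 := k2 he
    clear k1 k2 k3 k4 hp hsub s1 s2 s3 s4
    tauto
  · obtain ⟨hp, -⟩ := hp
    clear k1 k2 k4 hsub he hf s1 s2 s3 s4
    tauto
  · obtain ⟨hp, -⟩ := hp
    clear k1 k2 k3 hsub he hf s1 s2 s3 s4
    tauto
  · have l1 := k4 he
    clear k1 k2 k3 k4 hp hsub hf s1 s2 s3 s4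
    tauto
  · have l1 := k3 hf
    clear k1 k2 k3 k4 hp hsub he s1 s2 s3 s4
    tauto

/-- Edges settle the square-lattice adjacencies. For the added diagonals the splitting rule enters:
at a cross of `A` the loop contains both or neither of two linked edges, so the two ends of the
diagonal cannot be separated by `Inside γ` while both lying in `A` or both outside. -/
theorem innerSide_of_forall {A : Set Site} {γ : Finset DualEdge}
    (h : IsLoopOf (dualBoundary A) γ) (hσ : ∀ e ∈ γ, e.side₁ ∈ A ↔ e.side₁ ∈ Inside γ) :
    InnerSide A (Inside γ) := by
  have hI := h.isGeometricContour.dualBoundary_inside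
  have hsub : ∀ e, e ∈ dualBoundary (Inside γ) → e ∈ dualBoundary A := fun e he =>
    h.1 (by rwa [hI] at he)
  have hσ' : ∀ e, e ∈ dualBoundary (Inside γ) → (e.side₁ ∈ A ↔ e.side₁ ∈ Inside γ) :=
    fun e he => hσ e (by rwa [hI] at he)
  have hdiag : ∀ v : DualVertex, ¬ ((v.1 + 1, v.2) ∈ Inside γ ↔ (v.1, v.2 + 1) ∈ Inside γ) →
      ((v.1 + 1, v.2) ∈ A ↔ (v.1 + 1, v.2) ∈ Inside γ) ∧
      ((v.1, v.2 + 1) ∈ A ↔ (v.1, v.2 + 1) ∈ Inside γ) := by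
    intro v hv
    have hc : IsCross (dualBoundary A) v →
        (westEdge v ∈ dualBoundary (Inside γ) ↔ southEdge v ∈ dualBoundary (Inside γ)) ∧
        (northEdge v ∈ dualBoundary (Inside γ) ↔ eastEdge v ∈ dualBoundary (Inside γ)) := by
      intro hc
      have p1 : Partner (dualBoundary A) v (westEdge v) (southEdge v) :=
        ⟨hc.2.2.1, hc.2.2.2, west_ne_south v, by simp [AtVertex], by simp [AtVertex],
          fun _ => by simp [Linked]⟩
      have p2 : Partner (dualBoundary A) v (northEdge v) (eastEdge v) :=
        ⟨hc.2.1, hc.1, (east_ne_north v).symm, by simp [AtVertex], by simp [AtVertex],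
          fun _ => by simp [Linked]⟩
      rw [hI]
      exact ⟨⟨fun h1 => h.partner_mem h1 p1, fun h1 => h.partner_mem h1 p1.symm⟩,
        ⟨fun h1 => h.partner_mem h1 p2, fun h1 => h.partner_mem h1 p2.symm⟩⟩
    have k1 := hsub (eastEdge v)
    have k2 := hsub (northEdge v)
    have k3 := hsub (westEdge v)
    have k4 := hsub (southEdge v)
    have l1 := hσ' (eastEdge v)
    have l2 := hσ' (northEdge v)
    have l3 := hσ' (westEdge v)
    have l4 := hσ' (southEdge v)
    have s1 : (eastEdge v).side₁ = (v.1 + 1, v.2) := rfl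
    have s2 : (northEdge v).side₁ = (v.1, v.2 + 1) := rfl
    have s3 : (westEdge v).side₁ = (v.1, v.2) := by simp [westEdge, DualEdge.side₁]
    have s4 : (southEdge v).side₁ = (v.1, v.2) := by simp [southEdge, DualEdge.side₁]
    simp only [IsCross, mem_east, mem_north, mem_west, mem_south, s1, s2, s3, s4] at *
    clear hσ hσ' hsub hI h s1 s2 s3 s4
    by_cases h1 : (v.1 + 1, v.2) ∈ Inside γ <;> by_cases h2 : (v.1 + 1, v.2 + 1) ∈ Inside γ <;>
      by_cases h3 : (v.1, v.2) ∈ Inside γ <;> by_cases h4 : (v.1, v.2 + 1) ∈ Inside γ <;>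
      simp only [h1, h2, h3, h4, iff_true, iff_false, not_true_eq_false, not_false_eq_true,
        forall_true_left, false_imp_iff, true_iff, not_not, iff_self, and_self] at * <;> tauto
  rintro ⟨a, b⟩ ⟨c, d⟩ hadj hx hy
  rcases hadj with hadj | ⟨h1, h2⟩ | ⟨h1, h2⟩
  · obtain ⟨e, ⟨h1, h2⟩ | ⟨h1, h2⟩⟩ := exists_edge_of_adj hadj
    · have he : e ∈ dualBoundary (Inside γ) := by rw [mem_dualBoundary, h1, h2]; tauto
      have h3 := hσ' e he
      have h4 := hsub e he
      rw [mem_dualBoundary, h1, h2] at h4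
      rw [h1] at h3
      tauto
    · have he : e ∈ dualBoundary (Inside γ) := by rw [mem_dualBoundary, h1, h2]; tauto
      have h3 := hσ' e he
      have h4 := hsub e he
      rw [mem_dualBoundary, h1, h2] at h4
      rw [h1] at h3
      tauto
  · simp only at h1 h2
    subst h1 h2
    have := hdiag (a, b - 1)
    simp only [sub_add_cancel] at this
    tauto
  · simp only at h1 h2
    subst h1 h2
    have := hdiag (a - 1, b)
    simp only [sub_add_cancel] at this
    tauto

/-- Either all sites of `A` along a loop of the edge boundary of `A` lie inside the loop, or all of
them lie outside. -/
theorem IsLoopOf.innerSide_or {A : Set Site} {γ : Finset DualEdge}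
    (h : IsLoopOf (dualBoundary A) γ) : InnerSide A (Inside γ) ∨ InnerSide Aᶜ (Inside γ) := by
  have hI := h.isGeometricContour.dualBoundary_inside
  have hsub : dualBoundary (Inside γ) ⊆ dualBoundary A := by rw [hI]; exact h.1
  obtain ⟨e₀, h₀⟩ := h.nonempty
  have hstep : ∀ v e f, e ∈ γ → f ∈ γ → Partner (dualBoundary A) v e f →
      ((e.side₁ ∈ A ↔ e.side₁ ∈ Inside γ) ↔ (f.side₁ ∈ A ↔ f.side₁ ∈ Inside γ)) := by
    intro v e f he hf hp
    have he' : e ∈ dualBoundary (Inside γ) := by rw [hI]; exact he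
    have hf' : f ∈ dualBoundary (Inside γ) := by rw [hI]; exact hf
    rcases hp.pattern with h1 | h1
    · exact side_dichotomy_step hsub he' hf' h1
    · exact (side_dichotomy_step hsub hf' he' h1).symm
  have hall := h.induction (P := fun e => (e₀.side₁ ∈ A ↔ e₀.side₁ ∈ Inside γ) ↔
    (e.side₁ ∈ A ↔ e.side₁ ∈ Inside γ)) h₀ Iff.rfl
    (fun v e f he hf hp h1 => h1.trans (hstep v e f he hf hp))
  by_cases hc : e₀.side₁ ∈ A ↔ e₀.side₁ ∈ Inside γ
  · exact Or.inl (innerSide_of_forall h fun e he => (hall e he).1 hc)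
  · right
    rw [← dualBoundary_compl] at h
    refine innerSide_of_forall h fun e he => ?_
    have := (hall e he).2.mt hc
    rw [Set.mem_compl_iff]
    tauto

/-! ### Simply-connected domains -/

theorem SimplyConnectedDomain.nonempty {V : Set Site} (h : SimplyConnectedDomain V) :
    V.Nonempty := by
  obtain ⟨γ, h1, h2⟩ := h
  obtain ⟨e, he⟩ := IsLoopOf.nonempty h1
  have : e ∈ dualBoundary V := h2 ▸ he
  rw [mem_dualBoundary] at this
  by_cases hc : e.side₁ ∈ V
  · exact ⟨_, hc⟩
  · exact ⟨e.side₂, by tauto⟩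

/-- The value of a predicate at the outer side of a boundary edge is the same for partners, if the
predicate is locally constant outside. -/
theorem outer_value_step {V : Set Site} {P : Site → Prop}
    (hP : ∀ x y, x ∉ V → y ∉ V → TriAdj x y → (P x ↔ P y)) {v : DualVertex} {e f : DualEdge}
    (hp : PartnerPattern V v e f) :
    ((e.side₁ ∉ V ∧ P e.side₁) ∨ (e.side₂ ∉ V ∧ P e.side₂)) ↔
    ((f.side₁ ∉ V ∧ P f.side₁) ∨ (f.side₂ ∉ V ∧ P f.side₂)) := by
  have s1 : (eastEdge v).side₁ = (v.1 + 1, v.2) := rfl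
  have s2 : (northEdge v).side₁ = (v.1, v.2 + 1) := rfl
  have s3 : (westEdge v).side₁ = (v.1, v.2) := by simp [westEdge, DualEdge.side₁]
  have s4 : (southEdge v).side₁ = (v.1, v.2) := by simp [southEdge, DualEdge.side₁]
  have t1 : (eastEdge v).side₂ = (v.1 + 1, v.2 + 1) := rfl
  have t2 : (northEdge v).side₂ = (v.1 + 1, v.2 + 1) := rfl
  have t3 : (westEdge v).side₂ = (v.1, v.2 + 1) := by simp [westEdge, DualEdge.side₂]
  have t4 : (southEdge v).side₂ = (v.1 + 1, v.2) := by simp [southEdge, DualEdge.side₂]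
  have q1 := fun a b => hP (v.1, v.2) (v.1 + 1, v.2) a b (Or.inl (adj_iff.2 (by simp)))
  have q2 := fun a b => hP (v.1, v.2) (v.1, v.2 + 1) a b (Or.inl (adj_iff.2 (by simp)))
  have q3 := fun a b => hP (v.1 + 1, v.2) (v.1 + 1, v.2 + 1) a b (Or.inl (adj_iff.2 (by simp)))
  have q4 := fun a b => hP (v.1, v.2 + 1) (v.1 + 1, v.2 + 1) a b (Or.inl (adj_iff.2 (by simp)))
  have q5 := fun a b => hP (v.1, v.2 + 1) (v.1 + 1, v.2) a b (Or.inr (Or.inl (by simp)))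
  clear hP
  rcases hp with ⟨rfl, rfl, hp⟩ | ⟨rfl, rfl, hp⟩ | ⟨rfl, rfl, hp⟩ | ⟨rfl, rfl, hp⟩ |
    ⟨rfl, rfl, hp⟩ | ⟨rfl, rfl, hp⟩ <;>
  simp only [s1, s2, s3, s4, t1, t2, t3, t4] <;>
  clear s1 s2 s3 s4 t1 t2 t3 t4 <;>
  by_cases h1 : (v.1 + 1, v.2) ∈ V <;> by_cases h2 : (v.1 + 1, v.2 + 1) ∈ V <;>
  by_cases h3 : (v.1, v.2) ∈ V <;> by_cases h4 : (v.1, v.2 + 1) ∈ V <;>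
  simp only [h1, h2, h3, h4, iff_true, iff_false, not_true_eq_false, not_false_eq_true, true_and,
    false_and, or_false, false_or, forall_true_left, false_imp_iff, true_iff, not_not, iff_self,
    and_self, and_false, and_true] at hp q1 q2 q3 q4 q5 ⊢ <;>
  tauto

/-- The complement of a finite simply-connected set is connected in the triangular lattice. -/
theorem SimplyConnectedDomain.iff_of_locally_constant {V : Set Site} (hV : SimplyConnectedDomain V)
    (hfin : V.Finite) {P : Site → Prop}
    (hP : ∀ x y, x ∉ V → y ∉ V → TriAdj x y → (P x ↔ P y)) {x y : Site} (hx : x ∉ V)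
    (hy : y ∉ V) : P x ↔ P y := by
  obtain ⟨m, hm, hmax⟩ := Set.exists_max_image V (fun x => x.1) hfin hV.nonempty
  obtain ⟨γ, hγ, hγV⟩ := hV
  unfold IsGeometricContour at hγ
  rw [hγV] at hγ
  set Q : DualEdge → Prop := fun e =>
    (e.side₁ ∉ V ∧ P e.side₁) ∨ (e.side₂ ∉ V ∧ P e.side₂) with hQ
  have hout : ∀ z : Site, m.1 < z.1 → z ∉ V := fun z hz hzV => (hmax z hzV).not_gt hz
  set e₀ : DualEdge := .ver (m.1, m.2 - 1)
  have h1 : (m.1 + 1, m.2) ∉ V := hout _ (by simp)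
  have he₀ : e₀ ∈ γ := by
    rw [← Finset.mem_coe, hγV, mem_dualBoundary_ver, sub_add_cancel]
    have : (m.1, m.2) ∈ V := hm
    tauto
  have hQ₀ : Q e₀ ↔ P (m.1 + 1, m.2) := by
    have : (m.1, m.2) ∈ V := hm
    simp only [hQ, e₀, DualEdge.side₁, DualEdge.side₂, sub_add_cancel]
    tauto
  -- The boundary is a single loop, so the value of `P` along its outer side is constant.
  have hall : ∀ e ∈ γ, (Q e₀ ↔ Q e) := hγ.induction (P := fun e => Q e₀ ↔ Q e) he₀ Iff.rfl
    (fun v e f _ _ hp hq => by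
      rcases hp.pattern with h | h
      · exact hq.trans (outer_value_step hP h)
      · exact hq.trans (outer_value_step hP h).symm)
  have hfar : ∀ b, P (m.1 + 1, b) ↔ P (m.1 + 1, m.2) := by
    have hs : ∀ b, P (m.1 + 1, b) ↔ P (m.1 + 1, b + 1) := fun b =>
      hP _ _ (hout _ (by simp)) (hout _ (by simp)) (Or.inl (adj_iff.2 (by simp)))
    intro b
    rcases le_total b m.2 with hb | hb
    · exact iff_of_forall_succ (P := fun b => P (m.1 + 1, b)) (fun a _ => hs a) hb
    · exact (iff_of_forall_succ (P := fun b => P (m.1 + 1, b)) (fun a _ => hs a) hb).symm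
  have hright : ∀ a b, m.1 + 1 ≤ a → (P (m.1 + 1, b) ↔ P (a, b)) := fun a b ha =>
    iff_of_forall_succ (P := fun a => P (a, b)) (fun c hc =>
      hP _ _ (hout _ (by simp; omega)) (hout _ (by simp; omega))
        (Or.inl (adj_iff.2 (by simp)))) ha
  have key : ∀ a b, (a, b) ∉ V → (P (a, b) ↔ P (m.1 + 1, m.2)) := by
    intro a b
    rcases le_total (m.1 + 1) a with ha | ha
    · exact fun _ => (hright a b ha).symm.trans (hfar b)
    · induction a, ha using Int.leInductionDown with
      | base => exact fun _ => hfar b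
      | pred a ha ih =>
        intro h2
        -- When the westward walk leaves `V`, the edge just crossed lies on the single loop, which
        -- transports the value of `P` from `e₀`.
        by_cases h3 : (a, b) ∈ V
        · have h4 : DualEdge.ver (a - 1, b - 1) ∈ γ := by
            rw [← Finset.mem_coe, hγV, mem_dualBoundary_ver, sub_add_cancel, sub_add_cancel]
            tauto
          have h5 : Q (DualEdge.ver (a - 1, b - 1)) ↔ P (a - 1, b) := by
            simp only [hQ, DualEdge.side₁, DualEdge.side₂, sub_add_cancel]
            tauto
          rw [← h5, ← hall _ h4, hQ₀]
        · rw [← ih h3]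
          exact hP _ _ h2 h3 (Or.inl (adj_iff.2 (by simp)))
  exact (key x.1 x.2 hx).trans (key y.1 y.2 hy).symm

/-- A loop of the edge boundary of a set which is trivial outside of a finite simply-connected
domain has its interior in this domain. -/
theorem IsLoopOf.inside_subset {V A : Set Site} (hV : SimplyConnectedDomain V) (hfin : V.Finite)
    (hA : ∀ x y, x ∉ V → y ∉ V → (x ∈ A ↔ y ∈ A)) {γ : Finset DualEdge}
    (hγ : IsLoopOf (dualBoundary A) γ) : Inside γ ⊆ V := by
  have hIfin := hγ.isGeometricContour.finite_inside
  obtain ⟨z, hz⟩ := (hfin.union hIfin).infinite_compl.nonempty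
  simp only [Set.mem_compl_iff, Set.mem_union, not_or] at hz
  intro x hx
  by_contra hxV
  -- Off `V` the set `A` is trivial, so `Inside γ` is locally constant there; a site of it outside
  -- `V` would force the far site `z` inside.
  refine hz.2 ((hV.iff_of_locally_constant hfin (P := fun x => x ∈ Inside γ)
    (fun x y hx hy hadj => ?_) hxV hz.1).1 hx)
  have h1 := hA x y hx hy
  rcases hγ.innerSide_or with h | h
  · have h2 := h x y hadj
    have h3 := h y x hadj.symm
    tauto
  · have h2 := h x y hadj
    have h3 := h y x hadj.symm
    simp only [Set.mem_compl_iff] at h2 h3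
    tauto

/-! ### Perimeter, diameter and volume -/

theorem exists_east {I : Set Site} (hI : I.Finite) {s : Site} (hs : s ∈ I) :
    ∃ a, s.1 ≤ a ∧ (a, s.2) ∈ I ∧ DualEdge.ver (a, s.2 - 1) ∈ dualBoundary I := by
  have h1 : {x ∈ I | x.2 = s.2}.Finite := hI.subset (fun x hx => hx.1)
  obtain ⟨m, ⟨hm, hm2⟩, hmax⟩ := Set.exists_max_image _ (fun x => x.1) h1 ⟨s, hs, rfl⟩
  have h2 : (m.1, s.2) ∈ I := by rw [← hm2]; exact hm
  refine ⟨m.1, hmax s ⟨hs, rfl⟩, h2, ?_⟩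
  rw [mem_dualBoundary_ver, sub_add_cancel]
  have : (m.1 + 1, s.2) ∉ I := fun h => by
    have := hmax _ ⟨h, rfl⟩
    simp at this
  tauto

theorem exists_west {I : Set Site} (hI : I.Finite) {s : Site} (hs : s ∈ I) :
    ∃ a, a ≤ s.1 ∧ (a, s.2) ∈ I ∧ DualEdge.ver (a - 1, s.2 - 1) ∈ dualBoundary I := by
  have h1 : {x ∈ I | x.2 = s.2}.Finite := hI.subset (fun x hx => hx.1)
  obtain ⟨m, ⟨hm, hm2⟩, hmin⟩ := Set.exists_min_image _ (fun x => x.1) h1 ⟨s, hs, rfl⟩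
  have h2 : (m.1, s.2) ∈ I := by rw [← hm2]; exact hm
  refine ⟨m.1, hmin s ⟨hs, rfl⟩, h2, ?_⟩
  rw [mem_dualBoundary_ver, sub_add_cancel, sub_add_cancel]
  have : (m.1 - 1, s.2) ∉ I := fun h => by
    have := hmin _ ⟨h, rfl⟩
    simp at this
  tauto

theorem exists_north {I : Set Site} (hI : I.Finite) {s : Site} (hs : s ∈ I) :
    ∃ b, s.2 ≤ b ∧ (s.1, b) ∈ I ∧ DualEdge.hor (s.1 - 1, b) ∈ dualBoundary I := by
  have h1 : {x ∈ I | x.1 = s.1}.Finite := hI.subset (fun x hx => hx.1)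
  obtain ⟨m, ⟨hm, hm2⟩, hmax⟩ := Set.exists_max_image _ (fun x => x.2) h1 ⟨s, hs, rfl⟩
  have h2 : (s.1, m.2) ∈ I := by rw [← hm2]; exact hm
  refine ⟨m.2, hmax s ⟨hs, rfl⟩, h2, ?_⟩
  rw [mem_dualBoundary_hor, sub_add_cancel]
  have : (s.1, m.2 + 1) ∉ I := fun h => by
    have := hmax _ ⟨h, rfl⟩
    simp at this
  tauto

theorem exists_south {I : Set Site} (hI : I.Finite) {s : Site} (hs : s ∈ I) :
    ∃ b, b ≤ s.2 ∧ (s.1, b) ∈ I ∧ DualEdge.hor (s.1 - 1, b - 1) ∈ dualBoundary I := by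
  have h1 : {x ∈ I | x.1 = s.1}.Finite := hI.subset (fun x hx => hx.1)
  obtain ⟨m, ⟨hm, hm2⟩, hmin⟩ := Set.exists_min_image _ (fun x => x.2) h1 ⟨s, hs, rfl⟩
  have h2 : (s.1, m.2) ∈ I := by rw [← hm2]; exact hm
  refine ⟨m.2, hmin s ⟨hs, rfl⟩, h2, ?_⟩
  rw [mem_dualBoundary_hor, sub_add_cancel, sub_add_cancel]
  have : (s.1, m.2 - 1) ∉ I := fun h => by
    have := hmin _ ⟨h, rfl⟩
    simp at this
  tauto

/-- The perimeter is at least twice the number of nonempty rows and columns. -/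
theorem two_mul_rows_add_columns_le {I : Set Site} (hI : I.Finite) {γ : Finset DualEdge}
    (hγ : dualBoundary I = γ) :
    2 * (Prod.snd '' I).ncard + 2 * (Prod.fst '' I).ncard ≤ γ.card := by
  classical
  set R := (hI.image Prod.snd).toFinset
  set C := (hI.image Prod.fst).toFinset
  have hR : ∀ b ∈ R, ∃ a a', a ≤ a' ∧ DualEdge.ver (a - 1, b - 1) ∈ γ ∧
      DualEdge.ver (a', b - 1) ∈ γ := by
    intro b hb
    simp only [R, Set.Finite.mem_toFinset, Set.mem_image] at hb
    obtain ⟨s, hs, rfl⟩ := hb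
    obtain ⟨a, h1, -, h2⟩ := exists_west hI hs
    obtain ⟨a', h3, -, h4⟩ := exists_east hI hs
    rw [hγ] at h2 h4
    exact ⟨a, a', h1.trans h3, h2, h4⟩
  have hC : ∀ a ∈ C, ∃ b b', b ≤ b' ∧ DualEdge.hor (a - 1, b - 1) ∈ γ ∧
      DualEdge.hor (a - 1, b') ∈ γ := by
    intro b hb
    simp only [C, Set.Finite.mem_toFinset, Set.mem_image] at hb
    obtain ⟨s, hs, rfl⟩ := hb
    obtain ⟨a, h1, -, h2⟩ := exists_south hI hs
    obtain ⟨a', h3, -, h4⟩ := exists_north hI hs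
    rw [hγ] at h2 h4
    exact ⟨a, a', h1.trans h3, h2, h4⟩
  choose! w w' hw1 hw2 hw3 using hR
  choose! s s' hs1 hs2 hs3 using hC
  set A1 := R.image fun b => DualEdge.ver (w b - 1, b - 1)
  set A2 := R.image fun b => DualEdge.ver (w' b, b - 1)
  set A3 := C.image fun a => DualEdge.hor (a - 1, s a - 1)
  set A4 := C.image fun a => DualEdge.hor (a - 1, s' a)
  have c1 : A1.card = R.card := Finset.card_image_of_injective _ fun a b h => by
    simp only [DualEdge.ver.injEq, Prod.mk.injEq] at h; omega
  have c2 : A2.card = R.card := Finset.card_image_of_injective _ fun a b h => by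
    simp only [DualEdge.ver.injEq, Prod.mk.injEq] at h; omega
  have c3 : A3.card = C.card := Finset.card_image_of_injective _ fun a b h => by
    simp only [DualEdge.hor.injEq, Prod.mk.injEq] at h; omega
  have c4 : A4.card = C.card := Finset.card_image_of_injective _ fun a b h => by
    simp only [DualEdge.hor.injEq, Prod.mk.injEq] at h; omega
  have d1 : Disjoint A1 A2 := by
    rw [Finset.disjoint_left]
    intro e h1 h2
    simp only [A1, A2, Finset.mem_image] at h1 h2
    obtain ⟨b, hb, rfl⟩ := h1
    obtain ⟨c, hc, h⟩ := h2
    simp only [DualEdge.ver.injEq, Prod.mk.injEq] at h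
    obtain rfl : c = b := by omega
    have := hw1 c hc
    omega
  have d2 : Disjoint A3 A4 := by
    rw [Finset.disjoint_left]
    intro e h1 h2
    simp only [A3, A4, Finset.mem_image] at h1 h2
    obtain ⟨b, hb, rfl⟩ := h1
    obtain ⟨c, hc, h⟩ := h2
    simp only [DualEdge.hor.injEq, Prod.mk.injEq] at h
    obtain rfl : c = b := by omega
    have := hs1 c hc
    omega
  have d3 : Disjoint (A1 ∪ A2) (A3 ∪ A4) := by
    rw [Finset.disjoint_left]
    intro e h1 h2
    simp only [A1, A2, A3, A4, Finset.mem_union, Finset.mem_image] at h1 h2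
    rcases h1 with ⟨b, hb, rfl⟩ | ⟨b, hb, rfl⟩ <;> rcases h2 with ⟨c, hc, h⟩ | ⟨c, hc, h⟩ <;>
      cases h
  have hsub : (A1 ∪ A2) ∪ (A3 ∪ A4) ⊆ γ := by
    intro e he
    simp only [A1, A2, A3, A4, Finset.mem_union, Finset.mem_image] at he
    rcases he with (⟨b, hb, rfl⟩ | ⟨b, hb, rfl⟩) | (⟨b, hb, rfl⟩ | ⟨b, hb, rfl⟩)
    · exact hw2 b hb
    · exact hw3 b hb
    · exact hs2 b hb
    · exact hs3 b hb
  have := Finset.card_le_card hsub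
  rw [Finset.card_union_of_disjoint d3, Finset.card_union_of_disjoint d1,
    Finset.card_union_of_disjoint d2] at this
  rw [Set.ncard_eq_toFinset_card _ (hI.image Prod.snd),
    Set.ncard_eq_toFinset_card _ (hI.image Prod.fst)]
  change 2 * R.card + 2 * C.card ≤ _
  omega

theorem ncard_le_rows_mul_columns {I : Set Site} (hI : I.Finite) :
    I.ncard ≤ (Prod.snd '' I).ncard * (Prod.fst '' I).ncard := by
  have h1 : I ⊆ (Prod.fst '' I) ×ˢ (Prod.snd '' I) := fun x hx =>
    ⟨Set.mem_image_of_mem _ hx, Set.mem_image_of_mem _ hx⟩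
  have h2 := Set.ncard_le_ncard h1 ((hI.image _).prod (hI.image _))
  rw [Set.ncard_prod] at h2
  rwa [mul_comm]

/-! ### Diameters of contours -/

theorem finite_ends (γ : Finset DualEdge) :
    {u : DualVertex | ∃ e ∈ γ, u = e.tail ∨ u = e.head}.Finite := by
  have : {u : DualVertex | ∃ e ∈ γ, u = e.tail ∨ u = e.head} =
      ((γ.image DualEdge.tail ∪ γ.image DualEdge.head : Finset DualVertex) : Set DualVertex) := by
    ext u
    simp only [Set.mem_ofPred_eq, Finset.coe_union, Finset.coe_image, Set.mem_union, Set.mem_image,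
      Finset.mem_coe]
    constructor
    · rintro ⟨e, he, rfl | rfl⟩
      · exact Or.inl ⟨e, he, rfl⟩
      · exact Or.inr ⟨e, he, rfl⟩
    · rintro (⟨e, he, rfl⟩ | ⟨e, he, rfl⟩)
      · exact ⟨e, he, Or.inl rfl⟩
      · exact ⟨e, he, Or.inr rfl⟩
  rw [this]
  exact Finset.finite_toSet _

theorem dist_le_contourDiam {γ : Finset DualEdge} {e f : DualEdge} (he : e ∈ γ) (hf : f ∈ γ)
    {u v : DualVertex} (hu : AtVertex u e) (hv : AtVertex v f) : dist u v ≤ contourDiam γ := by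
  rw [atVertex_iff] at hu hv
  exact Metric.dist_le_diam_of_mem (finite_ends γ).isBounded
    ⟨e, he, hu.imp Eq.symm Eq.symm⟩ ⟨f, hf, hv.imp Eq.symm Eq.symm⟩

theorem contourDiam_le {γ : Finset DualEdge} {C : ℝ} (hC : 0 ≤ C)
    (h : ∀ e ∈ γ, ∀ f ∈ γ, ∀ u v, AtVertex u e → AtVertex v f → dist u v ≤ C) :
    contourDiam γ ≤ C := by
  refine Metric.diam_le_of_forall_dist_le hC ?_
  rintro u ⟨e, he, hu⟩ v ⟨f, hf, hv⟩
  exact h e he f hf u v (atVertex_iff.2 (hu.imp Eq.symm Eq.symm))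
    (atVertex_iff.2 (hv.imp Eq.symm Eq.symm))

theorem contourDiam_nonneg (γ : Finset DualEdge) : 0 ≤ contourDiam γ := Metric.diam_nonneg

theorem width_le_contourDiam {I : Set Site} (hI : I.Finite) {γ : Finset DualEdge}
    (hγ : dualBoundary I = γ) {s t : Site} (hs : s ∈ I) (ht : t ∈ I) :
    (t.1 - s.1 + 1 : ℝ) ≤ contourDiam γ := by
  obtain ⟨a, h1, -, h2⟩ := exists_west hI hs
  obtain ⟨a', h3, -, h4⟩ := exists_east hI ht
  rw [hγ] at h2 h4
  have h5 := dist_le_contourDiam h4 h2 (u := (a', t.2 - 1)) (v := (a - 1, s.2 - 1))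
    (atVertex_iff.2 (Or.inl rfl)) (atVertex_iff.2 (Or.inl rfl))
  rw [Prod.dist_eq] at h5
  have h6 := (le_max_left _ _).trans h5
  simp only [Int.dist_eq] at h6
  have h7 := (le_abs_self _).trans h6
  push_cast at h7
  have h8 : (a : ℝ) ≤ s.1 := by exact_mod_cast h1
  have h9 : (t.1 : ℝ) ≤ a' := by exact_mod_cast h3
  linarith

theorem height_le_contourDiam {I : Set Site} (hI : I.Finite) {γ : Finset DualEdge}
    (hγ : dualBoundary I = γ) {s t : Site} (hs : s ∈ I) (ht : t ∈ I) :
    (t.2 - s.2 + 1 : ℝ) ≤ contourDiam γ := by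
  obtain ⟨a, h1, -, h2⟩ := exists_south hI hs
  obtain ⟨a', h3, -, h4⟩ := exists_north hI ht
  rw [hγ] at h2 h4
  have h5 := dist_le_contourDiam h4 h2 (u := (t.1 - 1, a')) (v := (s.1 - 1, a - 1))
    (atVertex_iff.2 (Or.inl rfl)) (atVertex_iff.2 (Or.inl rfl))
  rw [Prod.dist_eq] at h5
  have h6 := (le_max_right _ _).trans h5
  simp only [Int.dist_eq] at h6
  have h7 := (le_abs_self _).trans h6
  push_cast at h7
  have h8 : (a : ℝ) ≤ s.2 := by exact_mod_cast h1
  have h9 : (t.2 : ℝ) ≤ a' := by exact_mod_cast h3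
  linarith

/-- An end of a dual edge is close to both sides of this edge. -/
theorem AtVertex.near_side {v : DualVertex} {e : DualEdge} (h : AtVertex v e) {s : Site}
    (hs : s = e.side₁ ∨ s = e.side₂) : s.1 - 1 ≤ v.1 ∧ v.1 ≤ s.1 ∧ s.2 - 1 ≤ v.2 ∧ v.2 ≤ s.2 := by
  rcases h with rfl | rfl | rfl | rfl <;> rcases hs with rfl | rfl <;>
    simp [eastEdge, northEdge, westEdge, southEdge, DualEdge.side₁, DualEdge.side₂]

/-- If all edges of `γ` touch `I`, then the diameter of `γ` is controlled by the extension
of `I`. -/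
theorem contourDiam_le_of_touch {I : Set Site} {γ : Finset DualEdge} {C : ℝ} (hC : 0 ≤ C)
    (hw : ∀ s ∈ I, ∀ t ∈ I, (t.1 - s.1 + 1 : ℝ) ≤ C)
    (hh : ∀ s ∈ I, ∀ t ∈ I, (t.2 - s.2 + 1 : ℝ) ≤ C)
    (h : ∀ e ∈ γ, e.side₁ ∈ I ∨ e.side₂ ∈ I) : contourDiam γ ≤ C := by
  refine contourDiam_le hC fun e he f hf u v hu hv => ?_
  obtain ⟨s, hs, hs'⟩ : ∃ s ∈ I, s = e.side₁ ∨ s = e.side₂ := by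
    rcases h e he with h | h
    · exact ⟨_, h, Or.inl rfl⟩
    · exact ⟨_, h, Or.inr rfl⟩
  obtain ⟨t, ht, ht'⟩ : ∃ s ∈ I, s = f.side₁ ∨ s = f.side₂ := by
    rcases h f hf with h | h
    · exact ⟨_, h, Or.inl rfl⟩
    · exact ⟨_, h, Or.inr rfl⟩
  obtain ⟨a1, a2, a3, a4⟩ := hu.near_side hs'
  obtain ⟨b1, b2, b3, b4⟩ := hv.near_side ht'
  have w1 := hw s hs t ht
  have w2 := hw t ht s hs
  have v1 := hh s hs t ht
  have v2 := hh t ht s hs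
  rw [Prod.dist_eq, Int.dist_eq, Int.dist_eq]
  have := (Int.cast_le (R := ℝ)).2 a1
  have := (Int.cast_le (R := ℝ)).2 a2
  have := (Int.cast_le (R := ℝ)).2 a3
  have := (Int.cast_le (R := ℝ)).2 a4
  have := (Int.cast_le (R := ℝ)).2 b1
  have := (Int.cast_le (R := ℝ)).2 b2
  have := (Int.cast_le (R := ℝ)).2 b3
  have := (Int.cast_le (R := ℝ)).2 b4
  push_cast at *
  refine max_le (abs_le.2 ⟨?_, ?_⟩) (abs_le.2 ⟨?_, ?_⟩) <;> linarith

/-- The volume of a set is at most half its perimeter times its diameter. -/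
theorem ncard_le_contourDiam_mul {I : Set Site} (hI : I.Finite) {γ : Finset DualEdge}
    (hγ : dualBoundary I = γ) : (I.ncard : ℝ) ≤ contourDiam γ * (γ.card / 2) := by
  rcases I.eq_empty_or_nonempty with rfl | hne
  · simp only [Set.ncard_empty, Nat.cast_zero]
    exact mul_nonneg (contourDiam_nonneg γ) (by positivity)
  have h1 := two_mul_rows_add_columns_le hI hγ
  have h2 := ncard_le_rows_mul_columns hI
  have h3 : ((Prod.fst '' I).ncard : ℝ) ≤ contourDiam γ := by
    obtain ⟨s, hs, hmin⟩ := Set.exists_min_image I (fun x => x.1) hI hne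
    obtain ⟨t, ht, hmax⟩ := Set.exists_max_image I (fun x => x.1) hI hne
    refine le_trans ?_ (width_le_contourDiam hI hγ hs ht)
    have h4 : Prod.fst '' I ⊆ Set.Icc s.1 t.1 := by
      rintro _ ⟨x, hx, rfl⟩
      exact ⟨hmin x hx, hmax x hx⟩
    have h5 := Set.ncard_le_ncard h4 (Set.finite_Icc _ _)
    have h6 : (Set.Icc s.1 t.1).ncard = (t.1 + 1 - s.1).toNat := by
      rw [← Finset.coe_Icc, Set.ncard_coe_finset, Int.card_Icc]
    rw [h6] at h5
    have h7 := hmin t ht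
    have h8 : ((Prod.fst '' I).ncard : ℤ) ≤ t.1 + 1 - s.1 := by omega
    have h9 := (Int.cast_le (R := ℝ)).2 h8
    push_cast at h9
    linarith
  have h4 : (I.ncard : ℝ) ≤ (Prod.snd '' I).ncard * (Prod.fst '' I).ncard := by exact_mod_cast h2
  have h5 : (2 * (Prod.snd '' I).ncard : ℝ) ≤ γ.card := by
    have : 2 * (Prod.snd '' I).ncard ≤ γ.card := by omega
    exact_mod_cast this
  calc (I.ncard : ℝ) ≤ (Prod.snd '' I).ncard * (Prod.fst '' I).ncard := h4
    _ ≤ (γ.card / 2) * contourDiam γ := by gcongr; linarith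
    _ = _ := mul_comm _ _

/-- The diameter of a contour is at most its length. -/
theorem IsLoopOf.contourDiam_le_card {B : Set DualEdge} {γ : Finset DualEdge} (h : IsLoopOf B γ) :
    contourDiam γ ≤ γ.card := by
  classical
  obtain ⟨n, u, e, hn, hu, he, hj, hd, hm, hmem, hp⟩ := h.exists_path
  have hcard : γ.card = n := by
    have : γ = (Finset.range n).image e := by
      ext f; simp [hm]
    rw [this, Finset.card_image_of_injOn, Finset.card_range]
    intro i hi j hj hij
    exact hd i (by simpa using hi) j (by simpa using hj) hij
  have hstep : ∀ i k, dist (u i) (u (i + k)) ≤ k := by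
    intro i k
    induction k with
    | zero => simp
    | succ k ih =>
      refine (dist_triangle _ (u (i + k)) _).trans ?_
      have h1 : dist (u (i + k)) (u (i + (k + 1))) ≤ 1 := by
        have h2 := hj (i + k)
        rw [add_assoc] at h2
        have h3 : ∀ f : DualEdge, dist f.tail f.head ≤ 1 := by
          rintro (⟨a, b⟩ | ⟨a, b⟩) <;>
            simp [DualEdge.tail, DualEdge.head, Prod.dist_eq, Int.dist_eq]
        rcases h2 with h2 | h2
        · rw [← h2.1, ← h2.2]; exact h3 _
        · rw [← h2.1, ← h2.2, dist_comm]; exact h3 _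
      push_cast
      linarith
  have hends : ∀ f ∈ γ, ∀ w, AtVertex w f → ∃ i ≤ n, u i = w := by
    intro f hf w hw
    obtain ⟨i, hi, rfl⟩ := (hm f).1 hf
    rw [atVertex_iff] at hw
    rcases hj i with h2 | h2 <;> rw [h2.1, h2.2] at hw <;> rcases hw with hw | hw
    exacts [⟨i, hi.le, hw⟩, ⟨i + 1, hi, hw⟩, ⟨i + 1, hi, hw⟩, ⟨i, hi.le, hw⟩]
  refine contourDiam_le (by positivity) fun f hf g hg w w' hw hw' => ?_
  obtain ⟨i, hi, rfl⟩ := hends f hf w hw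
  obtain ⟨j, hj, rfl⟩ := hends g hg w' hw'
  rw [hcard]
  rcases le_total i j with hij | hij
  · obtain ⟨k, rfl⟩ := Nat.exists_eq_add_of_le hij
    refine (hstep i k).trans ?_
    exact_mod_cast (by omega : k ≤ n)
  · obtain ⟨k, rfl⟩ := Nat.exists_eq_add_of_le hij
    rw [dist_comm]
    refine (hstep j k).trans ?_
    exact_mod_cast (by omega : k ≤ n)

/-! ### Counting contours -/

/-- The dual edge that leaves `u` in one of the four directions. -/
def dirEdge (u : DualVertex) (d : Fin 4) : DualEdge :=
  ![eastEdge u, northEdge u, westEdge u, southEdge u] d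

/-- The dual vertex next to `u` in one of the four directions. -/
def dirStep (u : DualVertex) (d : Fin 4) : DualVertex :=
  ![(u.1 + 1, u.2), (u.1, u.2 + 1), (u.1 - 1, u.2), (u.1, u.2 - 1)] d

/-- The edges along a walk. -/
def walkEdges : DualVertex → List (Fin 4) → Finset DualEdge
  | _, [] => ∅
  | u, d :: l => insert (dirEdge u d) (walkEdges (dirStep u d) l)

theorem DualEdge.Joins.exists_dir {e : DualEdge} {u v : DualVertex} (h : e.Joins u v) :
    ∃ d, e = dirEdge u d ∧ v = dirStep u d := by
  obtain ⟨u1, u2⟩ := u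
  obtain ⟨v1, v2⟩ := v
  rcases e with ⟨a, b⟩ | ⟨a, b⟩ <;>
    simp only [DualEdge.Joins, DualEdge.tail, DualEdge.head, Prod.mk.injEq] at h <;>
    rcases h with ⟨⟨rfl, rfl⟩, rfl, rfl⟩ | ⟨⟨rfl, rfl⟩, rfl, rfl⟩
  · exact ⟨0, rfl, rfl⟩
  · exact ⟨2, by simp [dirEdge, westEdge], by simp [dirStep]⟩
  · exact ⟨1, rfl, rfl⟩
  · exact ⟨3, by simp [dirEdge, southEdge], by simp [dirStep]⟩

theorem exists_walk (n : ℕ) : ∀ (u : ℕ → DualVertex) (e : ℕ → DualEdge),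
    (∀ i, (e i).Joins (u i) (u (i + 1))) →
    ∃ l : List (Fin 4), l.length = n ∧ walkEdges (u 0) l = (Finset.range n).image e := by
  induction n with
  | zero => exact fun u e _ => ⟨[], rfl, by simp [walkEdges]⟩
  | succ n ih =>
    intro u e h
    obtain ⟨l, hl, hw⟩ := ih (fun i => u (i + 1)) (fun i => e (i + 1)) (fun i => h (i + 1))
    obtain ⟨d, h1, h2⟩ := (h 0).exists_dir
    refine ⟨d :: l, by simp [hl], ?_⟩
    rw [walkEdges, ← h1, ← h2, hw]
    ext f
    simp only [Finset.mem_insert, Finset.mem_image, Finset.mem_range]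
    constructor
    · rintro (rfl | ⟨i, hi, rfl⟩)
      · exact ⟨0, by omega, rfl⟩
      · exact ⟨i + 1, by omega, rfl⟩
    · rintro ⟨i, hi, rfl⟩
      rcases i with _ | i
      · exact Or.inl rfl
      · exact Or.inr ⟨i, by omega, rfl⟩

/-- The contours of length `n` around a site `x`. -/
def contoursAround (x : Site) (n : ℕ) : Set (Finset DualEdge) :=
  {γ | IsGeometricContour γ ∧ γ.card = n ∧ x ∈ Inside γ}

/-- The contour meets the row of `x` on its east side at distance less than `n`, since its diameter
is at most `n`. That distance and the `n` directions of a walk starting there determine it. -/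
theorem exists_code {x : Site} {n : ℕ} {γ : Finset DualEdge} (h : γ ∈ contoursAround x n) :
    ∃ (k : Fin n) (l : List.Vector (Fin 4) n),
      walkEdges (x.1 + (k : ℕ), x.2 - 1) l.1 = γ := by
  obtain ⟨hγ, hcard, hx⟩ := h
  have hI := hγ.finite_inside
  have hb := hγ.dualBoundary_inside
  obtain ⟨a, ha, haI, hae⟩ := exists_east hI hx
  rw [hb] at hae
  have h1 := (width_le_contourDiam hI hb hx haI).trans (IsLoopOf.contourDiam_le_card hγ)
  rw [hcard] at h1
  have h2 : a - x.1 + 1 ≤ n := by exact_mod_cast h1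
  have h3 : a = x.1 + ((a - x.1).toNat : ℕ) := by omega
  obtain ⟨N, u, e, hn, hu, he, hj, hd, hm, hmem, hp⟩ := IsLoopOf.exists_path hγ
  have hγN : γ = (Finset.range N).image e := by
    ext f; simp [hm]
  obtain rfl : N = n := by
    rw [← hcard, hγN, Finset.card_image_of_injOn, Finset.card_range]
    intro i hi j hj hij
    exact hd i (by simpa using hi) j (by simpa using hj) hij
  obtain ⟨j, huj⟩ : ∃ j, u j = (a, x.2 - 1) := by
    obtain ⟨i, hi, hei⟩ := (hm _).1 hae
    rcases hj i with h4 | h4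
    · exact ⟨i, by rw [← h4.1, hei]; rfl⟩
    · exact ⟨i + 1, by rw [← h4.1, hei]; rfl⟩
  obtain ⟨l, hl, hw⟩ := exists_walk N (fun i => u (j + i)) (fun i => e (j + i))
    (fun i => hj (j + i))
  refine ⟨⟨(a - x.1).toNat, by omega⟩, ⟨l, hl⟩, ?_⟩
  rw [← h3, ← huj]
  refine hw.trans ?_
  ext f
  rw [hm]
  simp only [Finset.mem_image, Finset.mem_range]
  have hper : Function.Periodic e N := he
  constructor
  · rintro ⟨i, hi, rfl⟩
    exact ⟨(j + i) % N, Nat.mod_lt _ hn, hper.map_mod_nat _⟩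
  · rintro ⟨i, hi, rfl⟩
    -- The walk starts at index `j`, so the index is shifted back by `j` modulo the period.
    refine ⟨(i + (N - j % N)) % N, Nat.mod_lt _ hn, ?_⟩
    rw [← hper.map_mod_nat, ← hper.map_mod_nat i]
    congr 1
    have h5 := Nat.mod_lt j hn
    have h6 : (j + (i + (N - j % N)) % N) ≡ i [MOD N] := by
      calc (j + (i + (N - j % N)) % N) ≡ j % N + (i + (N - j % N)) [MOD N] :=
            Nat.ModEq.add (Nat.mod_modEq _ _).symm (Nat.mod_modEq _ _)
        _ = i + N := by omega
        _ ≡ i [MOD N] := by simp [Nat.ModEq]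
    exact h6

/-- There are at most `n * 4 ^ n` contours of length `n` around a site. -/
theorem encard_contoursAround_le (x : Site) (n : ℕ) :
    (contoursAround x n).encard ≤ (n * 4 ^ n : ℕ) := by
  classical
  set S : Finset (Finset DualEdge) := (Finset.univ : Finset (Fin n × List.Vector (Fin 4) n)).image
    fun p => walkEdges (x.1 + (p.1 : ℕ), x.2 - 1) p.2.1
  have h1 : contoursAround x n ⊆ S := by
    intro γ hγ
    obtain ⟨k, l, h⟩ := exists_code hγ
    simp only [S, Finset.coe_image, Finset.coe_univ, Set.image_univ, Set.mem_range, Prod.exists]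
    exact ⟨k, l, h⟩
  refine (Set.encard_le_encard h1).trans ?_
  rw [Set.encard_coe_eq_coe_finsetCard]
  have h2 : S.card ≤ n * 4 ^ n := by
    refine Finset.card_image_le.trans ?_
    simp [card_vector]
  exact_mod_cast h2

/-! ### Energy and volume of a configuration in terms of its contours -/

/-- The gradient energy of a configuration. -/
def energy (φ : Site → ℤ) : ℝ := ∑ᶠ e : DualEdge, |(φ e.side₁ : ℝ) - φ e.side₂|

/-- The sum of all heights. -/
def mass (φ : Site → ℤ) : ℝ := ∑ᶠ x : Site, (φ x : ℝ)

/-- The sites at which the height is at least `j`. -/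
def superlevel (φ : Site → ℤ) (j : ℤ) : Set Site := {x | j ≤ φ x}

theorem mem_superlevel {φ : Site → ℤ} {j : ℤ} {x : Site} : x ∈ superlevel φ j ↔ j ≤ φ x := Iff.rfl

/-- The dual edges that touch a finite set are finitely many. -/
theorem finite_touching {W : Set Site} (hW : W.Finite) :
    {e : DualEdge | e.side₁ ∈ W ∨ e.side₂ ∈ W}.Finite := by
  have h := ((hW.image fun x => DualEdge.hor (x.1 - 1, x.2)).union
    (hW.image fun x => DualEdge.hor (x.1 - 1, x.2 - 1))).union
    ((hW.image fun x => DualEdge.ver (x.1, x.2 - 1)).union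
    (hW.image fun x => DualEdge.ver (x.1 - 1, x.2 - 1)))
  refine h.subset ?_
  rintro (⟨a, b⟩ | ⟨a, b⟩) (he | he) <;>
    simp only [DualEdge.side₁, DualEdge.side₂] at he
  · exact Or.inl (Or.inl ⟨_, he, by simp⟩)
  · exact Or.inl (Or.inr ⟨_, he, by simp⟩)
  · exact Or.inr (Or.inl ⟨_, he, by simp⟩)
  · exact Or.inr (Or.inr ⟨_, he, by simp⟩)

theorem finite_gradient {φ : Site → ℤ} {h : ℤ} (hφ : {x | φ x ≠ h}.Finite) :
    {e : DualEdge | φ e.side₁ ≠ φ e.side₂}.Finite := by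
  refine (finite_touching hφ).subset fun e he => ?_
  simp only [Set.mem_ofPred_eq] at *
  by_contra! hc
  exact he (hc.1.trans hc.2.symm)

theorem mem_dualBoundary_superlevel {φ : Site → ℤ} {j : ℤ} {e : DualEdge} :
    e ∈ dualBoundary (superlevel φ j) ↔
      j ∈ Finset.Ioc (min (φ e.side₁) (φ e.side₂)) (max (φ e.side₁) (φ e.side₂)) := by
  rw [mem_dualBoundary, mem_superlevel, mem_superlevel, Finset.mem_Ioc]
  omega

theorem finite_dualBoundary_superlevel {φ : Site → ℤ} {h : ℤ} (hφ : {x | φ x ≠ h}.Finite) (j : ℤ) :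
    (dualBoundary (superlevel φ j)).Finite := by
  refine (finite_gradient hφ).subset fun e he => ?_
  rw [mem_dualBoundary_superlevel, Finset.mem_Ioc] at he
  simp only [Set.mem_ofPred_eq]
  omega

/-- A contour is a loop of the superlevel set of this height. -/
def Contour.level (c : Contour) : ℤ :=
  match c.dir with
  | .up => c.height
  | .down => c.height + 1

/-- The change of height when one enters the contour. -/
def Contour.sign (c : Contour) : ℤ :=
  match c.dir with
  | .up => 1
  | .down => -1

theorem sublevel_eq_compl (φ : Site → ℤ) (j : ℤ) : {x | φ x ≤ j} = (superlevel φ (j + 1))ᶜ := by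
  ext x; simp [superlevel, Int.lt_add_one_iff]

theorem isLoopOf_of_mem_contours {φ : Site → ℤ} {c : Contour} (hc : c ∈ contours φ) :
    IsLoopOf (dualBoundary (superlevel φ c.level)) c.loop := by
  obtain ⟨γ, d, j⟩ := c
  cases d
  · exact hc.1
  · have h : IsDownContour φ j γ := hc
    have h1 := h.1
    rwa [sublevel_eq_compl, dualBoundary_compl] at h1

/-- The characteristic function of a set of sites. -/
def char (A : Set Site) (x : Site) : ℤ := A.indicator 1 x

theorem char_of_mem {A : Set Site} {x : Site} (h : x ∈ A) : char A x = 1 := by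
  simp [char, h]

theorem char_of_notMem {A : Set Site} {x : Site} (h : x ∉ A) : char A x = 0 := by
  simp [char, h]

theorem char_sides_eq {A : Set Site} {e : DualEdge} (h : e ∉ dualBoundary A) :
    char A e.side₁ = char A e.side₂ := by
  rw [mem_dualBoundary, not_not] at h
  by_cases h1 : e.side₁ ∈ A
  · rw [char_of_mem h1, char_of_mem (h.1 h1)]
  · rw [char_of_notMem h1, char_of_notMem (h1 ∘ h.2)]

/-- The direction of a contour records whether the superlevel set lies inside or outside of it,
hence the sign relating the two jumps. -/
theorem sign_mul_jump {φ : Site → ℤ} {c : Contour} (hc : c ∈ contours φ) {e : DualEdge}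
    (he : e ∈ c.loop) :
    c.sign * (char (Inside c.loop) e.side₁ - char (Inside c.loop) e.side₂) =
      char (superlevel φ c.level) e.side₁ - char (superlevel φ c.level) e.side₂ := by
  have hI := (isLoopOf_of_mem_contours hc).isGeometricContour.dualBoundary_inside
  have he' : e ∈ dualBoundary (Inside c.loop) := by rw [hI]; exact he
  have ha := adj_sides e
  obtain ⟨γ, d, j⟩ := c
  rw [mem_dualBoundary] at he'
  by_cases h1 : e.side₁ ∈ Inside γ
  · have h2 : e.side₂ ∉ Inside γ := by tauto
    have h3 : e.side₁ ∈ innerBoundary (Inside γ) := ⟨h1, _, h2, ha⟩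
    have h4 : e.side₂ ∈ outerBoundary (Inside γ) := ⟨h2, _, h1, ha.symm⟩
    simp only [char_of_mem h1, char_of_notMem h2]
    cases d
    · have hc : IsUpContour φ j γ := hc
      rw [char_of_mem, char_of_notMem]
      · rfl
      · exact not_le.2 (hc.2.2 _ h4)
      · exact hc.2.1 _ h3
    · have hc : IsDownContour φ j γ := hc
      rw [char_of_notMem, char_of_mem]
      · rfl
      · exact hc.2.2 _ h4
      · have := hc.2.1 _ h3
        simp only [mem_superlevel, Contour.level]
        omega
  · have h2 : e.side₂ ∈ Inside γ := by tauto
    have h3 : e.side₂ ∈ innerBoundary (Inside γ) := ⟨h2, _, h1, ha.symm⟩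
    have h4 : e.side₁ ∈ outerBoundary (Inside γ) := ⟨h1, _, h2, ha⟩
    simp only [char_of_mem h2, char_of_notMem h1]
    cases d
    · have hc : IsUpContour φ j γ := hc
      rw [char_of_notMem, char_of_mem]
      · rfl
      · exact hc.2.1 _ h3
      · exact not_le.2 (hc.2.2 _ h4)
    · have hc : IsDownContour φ j γ := hc
      rw [char_of_mem, char_of_notMem]
      · rfl
      · have := hc.2.1 _ h3
        simp only [mem_superlevel, Contour.level]
        omega
      · exact hc.2.2 _ h4

/-- The dichotomy `IsLoopOf.innerSide_or` decides the direction. A down-contour carries the height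
`j - 1`, which `Contour.level` shifts back to `j`. -/
theorem exists_contour_of_isLoopOf {φ : Site → ℤ} {j : ℤ} {γ : Finset DualEdge}
    (hγ : IsLoopOf (dualBoundary (superlevel φ j)) γ) :
    ∃ c ∈ contours φ, c.loop = γ ∧ c.level = j := by
  rcases hγ.innerSide_or with h | h
  · refine ⟨⟨γ, .up, j⟩, ⟨hγ, ?_, ?_⟩, rfl, rfl⟩
    · rintro x ⟨hx, y, hy, hadj⟩
      exact (h x y (Or.inl hadj) hx hy).1
    · rintro x ⟨hx, y, hy, hadj⟩
      exact not_le.1 (h y x (Or.inl hadj.symm) hy hx).2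
  · refine ⟨⟨γ, .down, j - 1⟩, ⟨?_, ?_, ?_⟩, rfl, sub_add_cancel j 1⟩
    · rw [sublevel_eq_compl, dualBoundary_compl, sub_add_cancel]
      exact hγ
    · rintro x ⟨hx, y, hy, hadj⟩
      have := (h x y (Or.inl hadj) hx hy).1
      rw [Set.mem_compl_iff, mem_superlevel] at this
      change φ x ≤ j - 1
      omega
    · rintro x ⟨hx, y, hy, hadj⟩
      have := (h y x (Or.inl hadj.symm) hy hx).2
      rw [Set.mem_compl_iff, not_not, mem_superlevel] at this
      change j - 1 < φ x
      omega

theorem Contour.ext_of_level_sign {c c' : Contour} (h1 : c.loop = c'.loop)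
    (h2 : c.level = c'.level) (h3 : c.sign = c'.sign) : c = c' := by
  obtain ⟨γ, d, j⟩ := c
  obtain ⟨γ', d', j'⟩ := c'
  cases d <;> cases d' <;> simp_all [Contour.level, Contour.sign]

/-- The contours through an edge are parametrized by the heights between the heights of the two
sides. -/
theorem bijOn_level {φ : Site → ℤ} {h : ℤ} (hφ : {x | φ x ≠ h}.Finite) (e : DualEdge) :
    Set.BijOn Contour.level {c | c ∈ contours φ ∧ e ∈ c.loop}
      (Finset.Ioc (min (φ e.side₁) (φ e.side₂)) (max (φ e.side₁) (φ e.side₂))) := by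
  refine ⟨?_, ?_, ?_⟩
  · rintro c ⟨hc, he⟩
    exact mem_dualBoundary_superlevel.1 ((isLoopOf_of_mem_contours hc).1 he)
  · rintro c ⟨hc, he⟩ c' ⟨hc', he'⟩ hl
    have h1 := isLoopOf_of_mem_contours hc
    have h2 := isLoopOf_of_mem_contours hc'
    rw [← hl] at h2
    have h3 := h1.eq_of_common_edge h2 he he'
    refine Contour.ext_of_level_sign h3 hl ?_
    have h4 := sign_mul_jump hc he
    have h5 := sign_mul_jump hc' he'
    rw [← hl, ← h3, ← h4] at h5
    refine (mul_right_cancel₀ ?_ h5).symm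
    have h6 : e ∈ dualBoundary (Inside c.loop) := by
      rw [h1.isGeometricContour.dualBoundary_inside]; exact he
    rw [mem_dualBoundary] at h6
    by_cases h7 : e.side₁ ∈ Inside c.loop
    · rw [char_of_mem h7, char_of_notMem (by tauto)]; decide
    · rw [char_of_notMem h7, char_of_mem (by tauto)]; decide
  · intro j hj
    obtain ⟨γ, hγ, he⟩ := exists_loop_of_mem (finite_dualBoundary_superlevel hφ j)
      (mem_dualBoundary_superlevel.2 hj)
    obtain ⟨c, hc, rfl, rfl⟩ := exists_contour_of_isLoopOf hγ
    exact ⟨c, ⟨hc, he⟩, rfl⟩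

theorem finite_contours {φ : Site → ℤ} {h : ℤ} (hφ : {x | φ x ≠ h}.Finite) :
    (contours φ).Finite := by
  have h1 : contours φ ⊆ ⋃ e ∈ {e : DualEdge | φ e.side₁ ≠ φ e.side₂},
      {c | c ∈ contours φ ∧ e ∈ c.loop} := by
    intro c hc
    have h2 := isLoopOf_of_mem_contours hc
    obtain ⟨e, he⟩ := h2.nonempty
    have h3 := h2.1 he
    rw [mem_dualBoundary_superlevel, Finset.mem_Ioc] at h3
    simp only [Set.mem_iUnion]
    exact ⟨e, by simp only [Set.mem_ofPred_eq]; omega, hc, he⟩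
  refine ((finite_gradient hφ).biUnion fun e _ => ?_).subset h1
  have h2 := bijOn_level hφ e
  exact Set.Finite.of_finite_image (f := Contour.level)
    (by rw [h2.image_eq]; exact Finset.finite_toSet _) h2.injOn

/-- Double counting of pairs of a contour and an edge: an edge lies on one contour for each level
between its two heights. -/
theorem sum_card_loop {φ : Site → ℤ} {h : ℤ} (hφ : {x | φ x ≠ h}.Finite) :
    ∑ c ∈ (finite_contours hφ).toFinset, (c.loop.card : ℝ) = energy φ := by
  classical
  set K := (finite_contours hφ).toFinset
  set E := (finite_gradient hφ).toFinset
  have h1 : ∀ c ∈ K, (c.loop.card : ℝ) = ∑ e ∈ E, if e ∈ c.loop then 1 else 0 := by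
    intro c hc
    have h2 := isLoopOf_of_mem_contours ((finite_contours hφ).mem_toFinset.1 hc)
    rw [Finset.sum_boole]
    congr 2
    ext e
    simp only [Finset.mem_filter, E, Set.Finite.mem_toFinset, Set.mem_ofPred_eq]
    refine ⟨fun he => ⟨?_, he⟩, fun he => he.2⟩
    have h3 := h2.1 he
    rw [mem_dualBoundary_superlevel, Finset.mem_Ioc] at h3
    omega
  rw [Finset.sum_congr rfl h1, Finset.sum_comm]
  have h2 : ∀ e ∈ E, ∑ c ∈ K, (if e ∈ c.loop then (1 : ℝ) else 0) =
      |(φ e.side₁ : ℝ) - φ e.side₂| := by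
    intro e _
    rw [Finset.sum_boole]
    have h3 := bijOn_level hφ e
    have h4 : (K.filter fun c => e ∈ c.loop).card =
        (Finset.Ioc (min (φ e.side₁) (φ e.side₂)) (max (φ e.side₁) (φ e.side₂))).card := by
      refine Finset.card_nbij Contour.level ?_ ?_ ?_
      · intro c hc
        exact h3.mapsTo (by simpa [K] using hc)
      · refine h3.injOn.mono fun c hc => by simpa [K] using hc
      · refine h3.surjOn.mono (fun c hc => by simpa [K] using hc) subset_rfl
    rw [h4, Int.card_Ioc]
    have h5 : (max (φ e.side₁) (φ e.side₂) - min (φ e.side₁) (φ e.side₂)) =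
        |φ e.side₁ - φ e.side₂| := by
      rw [max_sub_min_eq_abs, abs_sub_comm]
    rw [h5]
    have h6 : ((|φ e.side₁ - φ e.side₂|.toNat : ℤ) : ℝ) = |(φ e.side₁ : ℝ) - φ e.side₂| := by
      rw [Int.toNat_of_nonneg (abs_nonneg _)]
      push_cast
      rfl
    exact_mod_cast h6
  rw [Finset.sum_congr rfl h2, energy, finsum_eq_sum_of_support_subset]
  intro e he
  simp only [E, Set.Finite.coe_toFinset, Set.mem_ofPred_eq]
  intro h3
  simp [h3] at he

theorem eq_of_forall_edge {G : Site → ℤ} (h : ∀ e : DualEdge, G e.side₁ = G e.side₂) (x y : Site) :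
    G x = G y := by
  have h1 : ∀ a b, G (a, b) = G (a + 1, b) := fun a b => by
    have := h (.ver (a, b - 1))
    simpa [DualEdge.side₁, DualEdge.side₂] using this
  have h2 : ∀ a b, G (a, b) = G (a, b + 1) := fun a b => by
    have := h (.hor (a - 1, b))
    simpa [DualEdge.side₁, DualEdge.side₂] using this
  have k1 : ∀ b a, G (a, b) = G (0, b) := fun b a => by
    induction a using Int.induction_on with
    | zero => rfl
    | succ i ih => rw [← h1, ih]
    | pred i ih => rw [h1, sub_add_cancel, ih]
  have k2 : ∀ b, G (0, b) = G (0, 0) := fun b => by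
    induction b using Int.induction_on with
    | zero => rfl
    | succ i ih => rw [← h2, ih]
    | pred i ih => rw [h2, sub_add_cancel, ih]
  have key : ∀ z : Site, G z = G (0, 0) := fun ⟨a, b⟩ => by rw [k1, k2]
  rw [key x, key y]

/-- The heights are recovered from the contours. -/
theorem sum_sign_mul_char {φ : Site → ℤ} {h : ℤ} (hφ : {x | φ x ≠ h}.Finite) (x : Site) :
    ∑ c ∈ (finite_contours hφ).toFinset, c.sign * char (Inside c.loop) x = φ x - h := by
  classical
  set K := (finite_contours hφ).toFinset
  have hK : ∀ c ∈ K, c ∈ contours φ := fun c hc => (finite_contours hφ).mem_toFinset.1 hc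
  set G : Site → ℤ := fun x => ∑ c ∈ K, c.sign * char (Inside c.loop) x - φ x with hG
  -- Across `e` exactly the contours through `e` jump, one for each level separating the two
  -- heights. So `G` is constant on the lattice and can be evaluated far away.
  have hedge : ∀ e : DualEdge, G e.side₁ = G e.side₂ := by
    intro e
    have h1 : ∑ c ∈ K, c.sign * char (Inside c.loop) e.side₁ -
        ∑ c ∈ K, c.sign * char (Inside c.loop) e.side₂ = φ e.side₁ - φ e.side₂ := by
      rw [← Finset.sum_sub_distrib]
      have h2 : ∀ c ∈ K, c.sign * char (Inside c.loop) e.side₁ -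
          c.sign * char (Inside c.loop) e.side₂ = if e ∈ c.loop then
            (char (superlevel φ c.level) e.side₁ - char (superlevel φ c.level) e.side₂) else 0 := by
        intro c hc
        split_ifs with he
        · rw [← mul_sub, sign_mul_jump (hK c hc) he]
        · have hI := (isLoopOf_of_mem_contours (hK c hc)).isGeometricContour.dualBoundary_inside
          rw [char_sides_eq (by rw [hI]; exact he), sub_self]
      rw [Finset.sum_congr rfl h2, ← Finset.sum_filter]
      have h3 := bijOn_level hφ e
      have h4 : ∑ c ∈ K.filter (fun c => e ∈ c.loop),
          (char (superlevel φ c.level) e.side₁ - char (superlevel φ c.level) e.side₂) =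
          ∑ j ∈ Finset.Ioc (min (φ e.side₁) (φ e.side₂)) (max (φ e.side₁) (φ e.side₂)),
          (char (superlevel φ j) e.side₁ - char (superlevel φ j) e.side₂) := by
        refine Finset.sum_nbij Contour.level ?_ ?_ ?_ fun c _ => rfl
        · intro c hc
          exact h3.mapsTo (by simpa [K] using hc)
        · refine h3.injOn.mono fun c hc => by simpa [K] using hc
        · refine h3.surjOn.mono (fun c hc => by simpa [K] using hc) subset_rfl
      rw [h4]
      rcases le_total (φ e.side₁) (φ e.side₂) with hle | hle
      · rw [min_eq_left hle, max_eq_right hle]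
        have h5 : ∀ j ∈ Finset.Ioc (φ e.side₁) (φ e.side₂),
            char (superlevel φ j) e.side₁ - char (superlevel φ j) e.side₂ = -1 := by
          intro j hj
          rw [Finset.mem_Ioc] at hj
          rw [char_of_notMem (by rw [mem_superlevel]; omega),
            char_of_mem (by rw [mem_superlevel]; omega)]
          rfl
        rw [Finset.sum_congr rfl h5, Finset.sum_const, Int.card_Ioc, nsmul_eq_mul]
        have : ((φ e.side₂ - φ e.side₁).toNat : ℤ) = φ e.side₂ - φ e.side₁ :=
          Int.toNat_of_nonneg (by omega)
        rw [this]; ring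
      · rw [min_eq_right hle, max_eq_left hle]
        have h5 : ∀ j ∈ Finset.Ioc (φ e.side₂) (φ e.side₁),
            char (superlevel φ j) e.side₁ - char (superlevel φ j) e.side₂ = 1 := by
          intro j hj
          rw [Finset.mem_Ioc] at hj
          rw [char_of_mem (by rw [mem_superlevel]; omega),
            char_of_notMem (by rw [mem_superlevel]; omega)]
          rfl
        rw [Finset.sum_congr rfl h5, Finset.sum_const, Int.card_Ioc, nsmul_eq_mul]
        have : ((φ e.side₁ - φ e.side₂).toNat : ℤ) = φ e.side₁ - φ e.side₂ :=
          Int.toNat_of_nonneg (by omega)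
        rw [this]; ring
    simp only [hG]
    linarith
  have hfin : ({x | φ x ≠ h} ∪ ⋃ c ∈ contours φ, Inside c.loop).Finite :=
    hφ.union ((finite_contours hφ).biUnion fun c hc =>
      (isLoopOf_of_mem_contours hc).isGeometricContour.finite_inside)
  obtain ⟨z, hz⟩ := hfin.infinite_compl.nonempty
  simp only [Set.mem_compl_iff, Set.mem_union, Set.mem_ofPred_eq, Set.mem_iUnion, not_or, not_not,
    not_exists] at hz
  have h2 := eq_of_forall_edge hedge x z
  have h3 : G z = -h := by
    simp only [hG]
    rw [hz.1, Finset.sum_eq_zero]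
    · ring
    · intro c hc
      rw [char_of_notMem (hz.2 c (hK c hc)), mul_zero]
  rw [h3] at h2
  simp only [hG] at h2
  linarith

theorem sum_sign_mul_ncard {φ : Site → ℤ} {h : ℤ} (hφ : {x | φ x ≠ h}.Finite) :
    ∑ c ∈ (finite_contours hφ).toFinset, (c.sign : ℝ) * (Inside c.loop).ncard =
      mass (fun x => φ x - h) := by
  classical
  set K := (finite_contours hφ).toFinset
  have hK : ∀ c ∈ K, (Inside c.loop).Finite := fun c hc =>
    (isLoopOf_of_mem_contours
      ((finite_contours hφ).mem_toFinset.1 hc)).isGeometricContour.finite_inside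
  have hfin : ({x | φ x ≠ h} ∪ ⋃ c ∈ K, Inside c.loop).Finite :=
    hφ.union (K.finite_toSet.biUnion hK)
  set U := hfin.toFinset
  rw [mass, finsum_eq_sum_of_support_subset (s := U)]
  · have h1 : ∀ x ∈ U, ((φ x - h : ℤ) : ℝ) =
        ∑ c ∈ K, (c.sign : ℝ) * (char (Inside c.loop) x : ℝ) := by
      intro x _
      rw [← sum_sign_mul_char hφ x]
      push_cast
      rfl
    rw [Finset.sum_congr rfl h1, Finset.sum_comm]
    refine Finset.sum_congr rfl fun c hc => ?_
    rw [← Finset.mul_sum]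
    congr 1
    have h2 : ∀ x ∈ U, (char (Inside c.loop) x : ℝ) = if x ∈ Inside c.loop then 1 else 0 := by
      intro x _
      split_ifs with h3
      · rw [char_of_mem h3]; simp
      · rw [char_of_notMem h3]; simp
    rw [Finset.sum_congr rfl h2, Finset.sum_boole, ← Set.ncard_coe_finset]
    congr 2
    ext x
    simp only [U, Finset.coe_filter, Set.Finite.mem_toFinset, Set.mem_union, Set.mem_iUnion,
      Set.mem_ofPred_eq]
    exact ⟨fun hx => ⟨Or.inr ⟨c, hc, hx⟩, hx⟩, fun hx => hx.2⟩
  · intro x hx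
    simp only [Function.mem_support, ne_eq, Int.cast_eq_zero] at hx
    simp only [U, Set.Finite.coe_toFinset, Set.mem_union, Set.mem_ofPred_eq]
    exact Or.inl fun h1 => hx (by omega)

theorem weight_eq (β lam : ℝ) (c : Contour) :
    weight β lam c = Real.exp (-β * c.loop.card - lam * (c.sign * (Inside c.loop).ncard)) := by
  obtain ⟨γ, d, j⟩ := c
  cases d <;> simp [weight, Contour.sign]

/-- The weight of the contours of a configuration is its Gibbs weight. -/
theorem collectionWeight_contours (β lam : ℝ) {φ : Site → ℤ} {h : ℤ}
    (hφ : {x | φ x ≠ h}.Finite) : collectionWeight β lam (contours φ) =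
      Real.exp (-β * energy φ - lam * mass (fun x => φ x - h)) := by
  rw [collectionWeight, finprod_mem_eq_finite_toFinset_prod _ (finite_contours hφ)]
  simp only [weight_eq]
  rw [← Real.exp_sum, Finset.sum_sub_distrib, ← Finset.mul_sum, ← Finset.mul_sum,
    sum_card_loop hφ, sum_sign_mul_ncard hφ]

theorem eq_of_contours_eq {φ φ' : Site → ℤ} {h : ℤ} (hφ : {x | φ x ≠ h}.Finite)
    (hφ' : {x | φ' x ≠ h}.Finite) (heq : contours φ = contours φ') : φ = φ' := by
  funext x
  have h1 := sum_sign_mul_char hφ x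
  have h2 := sum_sign_mul_char hφ' x
  simp only [heq] at h1
  linarith

open scoped ENNReal

/-! ### Removing a contour from a configuration -/

/-- A loop of a set that is glued from two sets along the boundary of `I` is a loop of one of the
two sets, if all cuts are clean. -/
theorem isLoopOf_glue {X X' I : Set Site} {γ : Finset DualEdge}
    (h1 : Separated (X \ I) (X' ∩ I)) (h2 : Separated (X \ I) (X ∩ I))
    (h3 : Separated (X' \ I) (X' ∩ I)) (hfin : (dualBoundary (X \ I ∪ X' ∩ I)).Finite)
    (hγ : IsLoopOf (dualBoundary (X \ I ∪ X' ∩ I)) γ) :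
    IsLoopOf (dualBoundary X) γ ∨ IsLoopOf (dualBoundary X') γ := by
  rcases h1.isLoopOf_or hfin hγ with h | h
  · left
    have := h2.isLoopOf h
    rwa [Set.sdiff_union_inter] at this
  · right
    have := h3.symm.isLoopOf h
    rwa [Set.inter_union_sdiff] at this

theorem separated_of_inner {X X' I : Set Site}
    (h : ∀ x y, TriAdj x y → x ∈ I → y ∉ I → x ∉ X') : Separated (X \ I) (X' ∩ I) := by
  rintro y ⟨-, hy⟩ x ⟨hx, hxI⟩
  exact ⟨fun heq => hy (heq ▸ hxI), fun hadj => h x y hadj.symm hxI hy hx⟩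

theorem separated_of_outer {X X' I : Set Site}
    (h : ∀ x y, TriAdj x y → x ∈ I → y ∉ I → y ∉ X) : Separated (X \ I) (X' ∩ I) := by
  rintro y ⟨hyX, hy⟩ x ⟨hx, hxI⟩
  exact ⟨fun heq => hy (heq ▸ hxI), fun hadj => h x y hadj.symm hxI hy hyX⟩

theorem finite_support_add_char {ψ : Site → ℤ} (hψ : {x | ψ x ≠ 0}.Finite) {I : Set Site}
    (hI : I.Finite) (s : ℤ) : {x | ψ x + s * char I x ≠ 0}.Finite := by
  refine (hψ.union hI).subset fun x hx => ?_
  simp only [Set.mem_ofPred_eq, Set.mem_union] at *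
  by_contra! hc
  rw [hc.1, char_of_notMem hc.2] at hx
  simp at hx

theorem superlevel_add_char (ψ : Site → ℤ) (I : Set Site) (s i : ℤ) :
    superlevel (fun x => ψ x + s * char I x) i = superlevel ψ i \ I ∪ superlevel ψ (i - s) ∩ I := by
  ext x
  by_cases hx : x ∈ I
  · simp only [superlevel, Set.mem_ofPred_eq, char_of_mem hx, Set.mem_union, Set.mem_sdiff, hx,
      Set.mem_inter_iff, not_true_eq_false, and_false, and_true, false_or]
    omega
  · simp only [superlevel, Set.mem_ofPred_eq, char_of_notMem hx, Set.mem_union, Set.mem_sdiff, hx,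
      Set.mem_inter_iff, not_false_eq_true, and_false, and_true, or_false]
    omega

theorem compl_glue (X X' I : Set Site) : (X \ I ∪ X' ∩ I)ᶜ = Xᶜ \ I ∪ X'ᶜ ∩ I := by
  ext x
  simp only [Set.mem_compl_iff, Set.mem_union, Set.mem_sdiff, Set.mem_inter_iff]
  tauto

/-- Raising the heights inside a down-contour by one creates no new loops. -/
theorem isLoopOf_raise {ψ : Site → ℤ} (hψ : {x | ψ x ≠ 0}.Finite) {I : Set Site} (hI : I.Finite)
    {j : ℤ} (hside : InnerSide (superlevel ψ j)ᶜ I) {i : ℤ} {γ : Finset DualEdge}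
    (hγ : IsLoopOf (dualBoundary (superlevel (fun x => ψ x + 1 * char I x) i)) γ) :
    ∃ k, IsLoopOf (dualBoundary (superlevel ψ k)) γ := by
  have hfin := finite_dualBoundary_superlevel (finite_support_add_char hψ hI 1) i
  simp only [InnerSide, Set.mem_compl_iff, mem_superlevel, not_le, not_lt] at hside
  -- Across the boundary of `I` the heights go from below `j` inside to at least `j` outside. For `i
  -- ≤ j` the complements of the superlevel sets do not reach the boundary from outside; for `i > j`
  -- the superlevel sets do not reach it from inside. Either way the cut is clean.
  rcases le_or_gt i j with hij | hij
  · rw [← dualBoundary_compl] at hγ hfin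
    rw [superlevel_add_char, compl_glue] at hγ hfin
    have key : ∀ X, Separated ((superlevel ψ i)ᶜ \ I) (X ∩ I) := fun X =>
      separated_of_outer fun x y hadj hx hy => by
        simp only [Set.mem_compl_iff, mem_superlevel, not_le, not_lt]
        have := hside x y hadj hx hy
        omega
    have key' : ∀ X, Separated ((superlevel ψ (i - 1))ᶜ \ I) (X ∩ I) := fun X =>
      separated_of_outer fun x y hadj hx hy => by
        simp only [Set.mem_compl_iff, mem_superlevel, not_le, not_lt]
        have := hside x y hadj hx hy
        omega
    rcases isLoopOf_glue (key _) (key _) (key' _) hfin hγ with h | h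
    · exact ⟨i, by rwa [dualBoundary_compl] at h⟩
    · exact ⟨i - 1, by rwa [dualBoundary_compl] at h⟩
  · rw [superlevel_add_char] at hγ hfin
    have key : ∀ X, Separated (X \ I) (superlevel ψ i ∩ I) := fun X =>
      separated_of_inner fun x y hadj hx hy => by
        simp only [mem_superlevel, not_le, not_lt]
        have := hside x y hadj hx hy
        omega
    have key' : ∀ X, Separated (X \ I) (superlevel ψ (i - 1) ∩ I) := fun X =>
      separated_of_inner fun x y hadj hx hy => by
        simp only [mem_superlevel, not_le, not_lt]
        have := hside x y hadj hx hy
        omega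
    rcases isLoopOf_glue (key' _) (key _) (key' _) hfin hγ with h | h
    · exact ⟨i, h⟩
    · exact ⟨i - 1, h⟩

/-- Lowering the heights inside an up-contour by one creates no new loops. -/
theorem isLoopOf_lower {ψ : Site → ℤ} (hψ : {x | ψ x ≠ 0}.Finite) {I : Set Site} (hI : I.Finite)
    {j : ℤ} (hside : InnerSide (superlevel ψ j) I) {i : ℤ} {γ : Finset DualEdge}
    (hγ : IsLoopOf (dualBoundary (superlevel (fun x => ψ x + (-1) * char I x) i)) γ) :
    ∃ k, IsLoopOf (dualBoundary (superlevel ψ k)) γ := by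
  have hfin := finite_dualBoundary_superlevel (finite_support_add_char hψ hI (-1)) i
  simp only [InnerSide, Set.mem_compl_iff, mem_superlevel, not_le, not_lt] at hside
  -- The mirror image: heights are at least `j` inside and below `j` outside, so the superlevel sets
  -- are cut cleanly for `i ≥ j` and their complements for `i < j`.
  rcases le_or_gt j i with hij | hij
  · rw [superlevel_add_char] at hγ hfin
    have key : ∀ X, Separated (superlevel ψ i \ I) (X ∩ I) := fun X =>
      separated_of_outer fun x y hadj hx hy => by
        simp only [mem_superlevel, not_le, not_lt]
        have := hside x y hadj hx hy
        omega
    have key' : ∀ X, Separated (superlevel ψ (i - -1) \ I) (X ∩ I) := fun X =>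
      separated_of_outer fun x y hadj hx hy => by
        simp only [mem_superlevel, not_le, not_lt]
        have := hside x y hadj hx hy
        omega
    rcases isLoopOf_glue (key _) (key _) (key' _) hfin hγ with h | h
    · exact ⟨i, h⟩
    · exact ⟨i - -1, h⟩
  · rw [← dualBoundary_compl] at hγ hfin
    rw [superlevel_add_char, compl_glue] at hγ hfin
    have key : ∀ X, Separated (X \ I) ((superlevel ψ i)ᶜ ∩ I) := fun X =>
      separated_of_inner fun x y hadj hx hy => by
        simp only [Set.mem_compl_iff, mem_superlevel, not_le, not_lt]
        have := hside x y hadj hx hy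
        omega
    have key' : ∀ X, Separated (X \ I) ((superlevel ψ (i - -1))ᶜ ∩ I) := fun X =>
      separated_of_inner fun x y hadj hx hy => by
        simp only [Set.mem_compl_iff, mem_superlevel, not_le, not_lt]
        have := hside x y hadj hx hy
        omega
    rcases isLoopOf_glue (key' _) (key _) (key' _) hfin hγ with h | h
    · exact ⟨i, by rwa [dualBoundary_compl] at h⟩
    · exact ⟨i - -1, by rwa [dualBoundary_compl] at h⟩

/-! ### Configurations in relative heights -/

/-- The configurations in `V` with heights relative to the boundary height, with floor `f` and
boundary signing `η`, all of whose loops belong to `D`. -/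
def Conf (V : Set Site) (η : Site → Sgn) (f : Site → ℤ) (D : Set (Finset DualEdge)) :
    Set (Site → ℤ) :=
  {ψ | (∀ x, x ∉ V → ψ x = 0) ∧ (∀ x ∈ V, f x ≤ ψ x) ∧
    (∀ x ∈ innerBoundary V, (η x).Allows 0 (ψ x)) ∧
    ∀ j γ, IsLoopOf (dualBoundary (superlevel ψ j)) γ → γ ∈ D}

theorem Conf.mono {V : Set Site} {η : Site → Sgn} {f f' : Site → ℤ} {D D' : Set (Finset DualEdge)}
    (hf : ∀ x ∈ V, f' x ≤ f x) (hD : D ⊆ D') : Conf V η f D ⊆ Conf V η f' D' :=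
  fun _ h => ⟨h.1, fun x hx => (hf x hx).trans (h.2.1 x hx), h.2.2.1,
    fun j γ hγ => hD (h.2.2.2 j γ hγ)⟩

theorem Conf.finite_support {V : Set Site} (hV : V.Finite) {η : Site → Sgn} {f : Site → ℤ}
    {D : Set (Finset DualEdge)} {ψ : Site → ℤ} (h : ψ ∈ Conf V η f D) :
    {x | ψ x ≠ 0}.Finite :=
  hV.subset fun x hx => by_contra fun hc => hx (h.1 x hc)

theorem Conf.inside_subset {V : Set Site} (hV : V.Finite) (hVs : SimplyConnectedDomain V)
    {η : Site → Sgn} {f : Site → ℤ} {D : Set (Finset DualEdge)} {ψ : Site → ℤ}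
    (h : ψ ∈ Conf V η f D) {j : ℤ} {γ : Finset DualEdge}
    (hγ : IsLoopOf (dualBoundary (superlevel ψ j)) γ) : Inside γ ⊆ V :=
  hγ.inside_subset hVs hV fun x y hx hy => by
    rw [mem_superlevel, mem_superlevel, h.1 x hx, h.1 y hy]

/-- At an inner boundary site inside `γ`, a neighbour off `V` has height 0 and lies outside `γ`. So
the site is strictly below 0, and raising it by one does not pass 0: every boundary sign that
allowed the old height allows the new one. -/
theorem Conf.raise {V : Set Site} (hV : V.Finite) (hVs : SimplyConnectedDomain V)
    {η : Site → Sgn} {f : Site → ℤ} {D : Set (Finset DualEdge)} {ψ : Site → ℤ}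
    (h : ψ ∈ Conf V η f D) {j : ℤ} {γ : Finset DualEdge}
    (hγ : IsLoopOf (dualBoundary (superlevel ψ j)) γ)
    (hside : InnerSide (superlevel ψ j)ᶜ (Inside γ)) :
    (fun x => ψ x + 1 * char (Inside γ) x) ∈ Conf V η f D := by
  have hsub := Conf.inside_subset hV hVs h hγ
  refine ⟨fun x hx => ?_, fun x hx => ?_, fun x hx => ?_, fun i γ' hγ' => ?_⟩ <;> beta_reduce
  · rw [h.1 x hx, char_of_notMem fun hI => hx (hsub hI)]; rfl
  · have h1 := h.2.1 x hx
    by_cases hI : x ∈ Inside γ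
    · rw [char_of_mem hI]; omega
    · rw [char_of_notMem hI]; omega
  · have h1 := h.2.2.1 x hx
    by_cases hI : x ∈ Inside γ
    · obtain ⟨hxV, y, hy, hadj⟩ := hx
      have h2 := hside x y (Or.inl hadj) hI fun hyI => hy (hsub hyI)
      simp only [Set.mem_compl_iff, mem_superlevel, h.1 y hy, not_le, not_lt] at h2
      rw [char_of_mem hI]
      cases hη : η x <;> rw [hη] at h1 <;> simp only [Sgn.Allows] at * <;> omega
    · rw [char_of_notMem hI]
      simpa using h1
  · obtain ⟨k, hk⟩ := isLoopOf_raise (Conf.finite_support hV h)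
      hγ.isGeometricContour.finite_inside hside hγ'
    exact h.2.2.2 k γ' hk

/-- Boundary signs survive for the mirrored reason: the affected inner boundary sites are strictly
above 0. The floor may be violated by one unit, which the new floor records. -/
theorem Conf.lower {V : Set Site} (hV : V.Finite) (hVs : SimplyConnectedDomain V)
    {η : Site → Sgn} {f : Site → ℤ} {D : Set (Finset DualEdge)} {ψ : Site → ℤ}
    (h : ψ ∈ Conf V η f D) {j : ℤ} {γ : Finset DualEdge}
    (hγ : IsLoopOf (dualBoundary (superlevel ψ j)) γ)
    (hside : InnerSide (superlevel ψ j) (Inside γ)) :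
    (fun x => ψ x + (-1) * char (Inside γ) x) ∈ Conf V η (fun x => f x - char (Inside γ) x) D := by
  have hsub := Conf.inside_subset hV hVs h hγ
  refine ⟨fun x hx => ?_, fun x hx => ?_, fun x hx => ?_, fun i γ' hγ' => ?_⟩ <;> beta_reduce
  · rw [h.1 x hx, char_of_notMem fun hI => hx (hsub hI)]; rfl
  · have h1 := h.2.1 x hx
    omega
  · have h1 := h.2.2.1 x hx
    by_cases hI : x ∈ Inside γ
    · obtain ⟨hxV, y, hy, hadj⟩ := hx
      have h2 := hside x y (Or.inl hadj) hI fun hyI => hy (hsub hyI)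
      simp only [Set.mem_compl_iff, mem_superlevel, h.1 y hy, not_le, not_lt] at h2
      rw [char_of_mem hI]
      cases hη : η x <;> rw [hη] at h1 <;> simp only [Sgn.Allows] at * <;> omega
    · rw [char_of_notMem hI]
      simpa using h1
  · obtain ⟨k, hk⟩ := isLoopOf_lower (Conf.finite_support hV h)
      hγ.isGeometricContour.finite_inside hside hγ'
    exact h.2.2.2 k γ' hk

/-! ### Gibbs weights -/

theorem finite_support_gradient {ψ : Site → ℤ} {h : ℤ} (hψ : {x | ψ x ≠ h}.Finite) :
    (Function.support fun e : DualEdge => |(ψ e.side₁ : ℝ) - ψ e.side₂|).Finite := by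
  refine (finite_gradient hψ).subset fun e he => ?_
  simp only [Function.mem_support, Set.mem_ofPred_eq] at *
  intro hc
  simp [hc] at he

theorem finite_support_mass {ψ : Site → ℤ} (hψ : {x | ψ x ≠ 0}.Finite) :
    (Function.support fun x : Site => (ψ x : ℝ)).Finite := by
  refine hψ.subset fun e he => ?_
  simpa using he

theorem finsum_char {I : Set Site} (hI : I.Finite) : ∑ᶠ x, (char I x : ℝ) = I.ncard := by
  classical
  rw [finsum_eq_sum_of_support_subset (s := hI.toFinset)]
  · have h2 : ∀ x ∈ hI.toFinset, (char I x : ℝ) = 1 := by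
      intro x hx
      rw [char_of_mem (hI.mem_toFinset.1 hx)]; simp
    rw [Finset.sum_congr rfl h2, Finset.sum_const, nsmul_eq_mul, mul_one,
      Set.ncard_eq_toFinset_card _ hI]
  · intro x hx
    rw [Function.mem_support] at hx
    rw [Set.Finite.coe_toFinset]
    by_contra hc
    exact hx (by rw [char_of_notMem hc]; simp)

theorem mass_add_char {ψ : Site → ℤ} (hψ : {x | ψ x ≠ 0}.Finite) {I : Set Site} (hI : I.Finite)
    (s : ℤ) : mass (fun x => ψ x + s * char I x) = mass ψ + s * I.ncard := by
  have hfin : (Function.support fun x : Site => (s : ℝ) * (char I x : ℝ)).Finite := by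
    refine hI.subset fun x hx => ?_
    by_contra hc
    rw [Function.mem_support] at hx
    exact hx (by rw [char_of_notMem hc]; simp)
  rw [mass, mass, ← finsum_char hI, mul_finsum, ← finsum_add_distrib (finite_support_mass hψ) hfin]
  congr 1
  funext x
  push_cast
  rfl

/-- The gradient energy decreases by the length of the contour when the contour is removed. -/
theorem energy_remove {ψ ψ' : Site → ℤ} (hψ' : {x | ψ' x ≠ 0}.Finite) {γ : Finset DualEdge}
    (h1 : ∀ e ∈ γ, |ψ e.side₁ - ψ e.side₂| = |ψ' e.side₁ - ψ' e.side₂| + 1)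
    (h2 : ∀ e, e ∉ γ → ψ e.side₁ - ψ e.side₂ = ψ' e.side₁ - ψ' e.side₂) :
    energy ψ = energy ψ' + γ.card := by
  classical
  have hfin : (Function.support fun e : DualEdge => if e ∈ γ then (1 : ℝ) else 0).Finite := by
    refine γ.finite_toSet.subset fun e he => ?_
    rw [Function.mem_support] at he
    by_contra hc
    exact he (if_neg hc)
  have hcard : (γ.card : ℝ) = ∑ᶠ e : DualEdge, if e ∈ γ then (1 : ℝ) else 0 := by
    rw [finsum_eq_sum_of_support_subset (s := γ)]
    · simp
    · intro e he
      rw [Function.mem_support] at he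
      by_contra hc
      exact he (if_neg hc)
  rw [energy, energy, hcard, ← finsum_add_distrib (finite_support_gradient hψ') hfin]
  congr 1
  funext e
  split_ifs with he
  · exact_mod_cast h1 e he
  · rw [add_zero]
    have := h2 e he
    have h3 : (ψ e.side₁ : ℝ) - ψ e.side₂ = ψ' e.side₁ - ψ' e.side₂ := by exact_mod_cast this
    rw [h3]

theorem energy_raise {ψ : Site → ℤ} (hψ : {x | ψ x ≠ 0}.Finite) {j : ℤ} {γ : Finset DualEdge}
    (hγ : IsGeometricContour γ) (hside : InnerSide (superlevel ψ j)ᶜ (Inside γ)) :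
    energy ψ = energy (fun x => ψ x + 1 * char (Inside γ) x) + γ.card := by
  refine energy_remove (finite_support_add_char hψ hγ.finite_inside 1) (fun e he => ?_)
    (fun e he => ?_)
  · have h1 : e ∈ dualBoundary (Inside γ) := by rw [hγ.dualBoundary_inside]; exact he
    have ha := adj_sides e
    rw [mem_dualBoundary] at h1
    by_cases h2 : e.side₁ ∈ Inside γ
    · have h3 : e.side₂ ∉ Inside γ := by tauto
      have h4 := hside _ _ (Or.inl ha) h2 h3
      simp only [Set.mem_compl_iff, mem_superlevel, not_le, not_lt] at h4
      rw [char_of_mem h2, char_of_notMem h3, abs_of_nonpos (by omega), abs_of_nonpos (by omega)]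
      ring
    · have h3 : e.side₂ ∈ Inside γ := by tauto
      have h4 := hside _ _ (Or.inl ha.symm) h3 h2
      simp only [Set.mem_compl_iff, mem_superlevel, not_le, not_lt] at h4
      rw [char_of_mem h3, char_of_notMem h2, abs_of_nonneg (by omega), abs_of_nonneg (by omega)]
      ring
  · rw [char_sides_eq (by rw [hγ.dualBoundary_inside]; exact he)]
    ring

theorem energy_lower {ψ : Site → ℤ} (hψ : {x | ψ x ≠ 0}.Finite) {j : ℤ} {γ : Finset DualEdge}
    (hγ : IsGeometricContour γ) (hside : InnerSide (superlevel ψ j) (Inside γ)) :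
    energy ψ = energy (fun x => ψ x + (-1) * char (Inside γ) x) + γ.card := by
  refine energy_remove (finite_support_add_char hψ hγ.finite_inside (-1)) (fun e he => ?_)
    (fun e he => ?_)
  · have h1 : e ∈ dualBoundary (Inside γ) := by rw [hγ.dualBoundary_inside]; exact he
    have ha := adj_sides e
    rw [mem_dualBoundary] at h1
    by_cases h2 : e.side₁ ∈ Inside γ
    · have h3 : e.side₂ ∉ Inside γ := by tauto
      have h4 := hside _ _ (Or.inl ha) h2 h3
      simp only [mem_superlevel, not_le, not_lt] at h4
      rw [char_of_mem h2, char_of_notMem h3, abs_of_nonneg (by omega), abs_of_nonneg (by omega)]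
      ring
    · have h3 : e.side₂ ∈ Inside γ := by tauto
      have h4 := hside _ _ (Or.inl ha.symm) h3 h2
      simp only [mem_superlevel, not_le, not_lt] at h4
      rw [char_of_mem h3, char_of_notMem h2, abs_of_nonpos (by omega), abs_of_nonpos (by omega)]
      ring
  · rw [char_sides_eq (by rw [hγ.dualBoundary_inside]; exact he)]
    ring

/-- The Gibbs weight of a configuration in relative heights. -/
def gibbs (β lam : ℝ) (ψ : Site → ℤ) : ℝ≥0∞ :=
  ENNReal.ofReal (Real.exp (-β * energy ψ - lam * mass ψ))

/-- The cost of a contour that surrounds heights which are changed by `s`. -/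
def cost (β lam : ℝ) (s : ℤ) (γ : Finset DualEdge) : ℝ≥0∞ :=
  ENNReal.ofReal (Real.exp (-β * γ.card - lam * (s * (Inside γ).ncard)))

theorem gibbs_raise (β lam : ℝ) {ψ : Site → ℤ} (hψ : {x | ψ x ≠ 0}.Finite) {j : ℤ}
    {γ : Finset DualEdge} (hγ : IsGeometricContour γ)
    (hside : InnerSide (superlevel ψ j)ᶜ (Inside γ)) :
    gibbs β lam ψ = cost β lam (-1) γ * gibbs β lam (fun x => ψ x + 1 * char (Inside γ) x) := by
  rw [gibbs, gibbs, cost, ← ENNReal.ofReal_mul (Real.exp_pos _).le, ← Real.exp_add,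
    energy_raise hψ hγ hside, mass_add_char hψ hγ.finite_inside]
  congr 2
  push_cast
  ring

theorem gibbs_lower (β lam : ℝ) {ψ : Site → ℤ} (hψ : {x | ψ x ≠ 0}.Finite) {j : ℤ}
    {γ : Finset DualEdge} (hγ : IsGeometricContour γ)
    (hside : InnerSide (superlevel ψ j) (Inside γ)) :
    gibbs β lam ψ = cost β lam 1 γ * gibbs β lam (fun x => ψ x + (-1) * char (Inside γ) x) := by
  rw [gibbs, gibbs, cost, ← ENNReal.ofReal_mul (Real.exp_pos _).le, ← Real.exp_add,
    energy_lower hψ hγ hside, mass_add_char hψ hγ.finite_inside]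
  congr 2
  push_cast
  ring

/-! ### Sums of Gibbs weights -/

/-- The total Gibbs weight of a set of configurations. -/
def totalWeight (β lam : ℝ) (B : Set (Site → ℤ)) : ℝ≥0∞ := ∑' ψ : B, gibbs β lam ψ

theorem totalWeight_mono (β lam : ℝ) {B B' : Set (Site → ℤ)} (h : B ⊆ B') :
    totalWeight β lam B ≤ totalWeight β lam B' :=
  ENNReal.tsum_mono_subtype _ h

theorem totalWeight_union_le (β lam : ℝ) (B B' : Set (Site → ℤ)) :
    totalWeight β lam (B ∪ B') ≤ totalWeight β lam B + totalWeight β lam B' :=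
  ENNReal.tsum_union_le _ B B'

/-- The total weight of configurations that are mapped, with gain `c i`, into the sets `T i` by
injective maps. -/
theorem totalWeight_le_tsum {ι : Type*} (β lam : ℝ) {B : Set (Site → ℤ)} {c : ι → ℝ≥0∞}
    {T : ι → Set (Site → ℤ)} (F : ι → (Site → ℤ) → (Site → ℤ))
    (hF : ∀ i, Function.Injective (F i))
    (h : ∀ ψ ∈ B, ∃ i, F i ψ ∈ T i ∧ gibbs β lam ψ ≤ c i * gibbs β lam (F i ψ)) :
    totalWeight β lam B ≤ ∑' i, c i * totalWeight β lam (T i) := by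
  choose i hi hle using h
  simp only [totalWeight, ← ENNReal.tsum_mul_left]
  -- Remembering the index makes the choice of map injective on the whole of `B`, so a single
  -- comparison of sums suffices.
  rw [← ENNReal.tsum_sigma (fun (i : ι) (ψ : T i) => c i * gibbs β lam ψ)]
  let G : B → Σ i, T i := fun ψ => ⟨i ψ.1 ψ.2, F (i ψ.1 ψ.2) ψ, hi ψ ψ.2⟩
  have hG : Function.Injective G := by
    intro a b hab
    simp only [G, Sigma.mk.injEq] at hab
    obtain ⟨h1, h2⟩ := hab
    have h3 : F (i a.1 a.2) a = F (i b.1 b.2) b := by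
      have : ∀ (i j : ι) (x : T i) (y : T j), i = j → x ≍ y → x.1 = y.1 := by
        rintro i j x y rfl hxy
        rw [eq_of_heq hxy]
      exact this _ _ _ _ h1 h2
    rw [h1] at h3
    exact Subtype.ext (hF _ h3)
  refine le_trans ?_ (ENNReal.tsum_comp_le_tsum_of_injective hG _)
  exact ENNReal.tsum_le_tsum fun ψ => hle ψ ψ.2

theorem injective_add_char (I : Set Site) (s : ℤ) :
    Function.Injective fun (ψ : Site → ℤ) x => ψ x + s * char I x := by
  intro a b hab
  funext x
  have := congrFun hab x
  simpa using this

/-! ### Finiteness -/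

/-- A product of sums over single heights, unfolded one site at a time. -/
theorem tsum_supported_le (g : ℤ → ℝ≥0∞) (V : Finset Site) :
    ∑' ψ : {ψ : Site → ℤ | ∀ x, x ∉ V → ψ x = 0}, ∏ x ∈ V, g (ψ.1 x) ≤ (∑' t, g t) ^ V.card := by
  classical
  induction V using Finset.induction_on with
  | empty =>
    simp only [Finset.prod_empty, Finset.card_empty, pow_zero]
    have : Subsingleton {ψ : Site → ℤ | ∀ x, x ∉ (∅ : Finset Site) → ψ x = 0} :=
      ⟨fun a b => Subtype.ext (funext fun x => by rw [a.2 x (by simp), b.2 x (by simp)])⟩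
    rw [tsum_eq_single ⟨0, fun x _ => rfl⟩ (fun b hb => absurd (Subsingleton.elim _ _) hb)]
  | insert a V ha ih =>
    rw [Finset.card_insert_of_notMem ha, pow_succ']
    refine le_trans ?_ (mul_le_mul_right ih _)
    rw [← ENNReal.tsum_mul_right]
    simp only [← ENNReal.tsum_mul_left]
    rw [← ENNReal.tsum_prod (f := fun (t : ℤ)
      (ψ : {ψ : Site → ℤ | ∀ x, x ∉ V → ψ x = 0}) => g t * ∏ x ∈ V, g (ψ.1 x))]
    let G : {ψ : Site → ℤ | ∀ x, x ∉ insert a V → ψ x = 0} →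
        ℤ × {ψ : Site → ℤ | ∀ x, x ∉ V → ψ x = 0} := fun ψ =>
      (ψ.1 a, ⟨Function.update ψ.1 a 0, fun x hx => by
        by_cases h : x = a
        · rw [h, Function.update_self]
        · rw [Function.update_of_ne h]
          exact ψ.2 x (by simp [h, hx])⟩)
    have hG : Function.Injective G := by
      intro φ ψ h
      simp only [G, Prod.mk.injEq, Subtype.mk.injEq] at h
      refine Subtype.ext (funext fun x => ?_)
      by_cases hx : x = a
      · rw [hx, h.1]
      · have := congrFun h.2 x
        rwa [Function.update_of_ne hx, Function.update_of_ne hx] at this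
    refine le_trans ?_ (ENNReal.tsum_comp_le_tsum_of_injective hG _)
    refine ENNReal.tsum_le_tsum fun ψ => ?_
    rw [Finset.prod_insert ha]
    refine mul_le_mul_right (le_of_eq (Finset.prod_congr rfl fun x hx => ?_)) _
    have : x ≠ a := fun h => ha (h ▸ hx)
    simp only [G, Function.update_of_ne this]

/-- Telescope along the row to the east, up to a site where `ψ` vanishes. -/
theorem abs_le_energy {ψ : Site → ℤ} (hψ : {x | ψ x ≠ 0}.Finite) (x : Site) :
    |(ψ x : ℝ)| ≤ energy ψ := by
  classical
  obtain ⟨n, hn⟩ : ∃ n : ℕ, ψ (x.1 + n, x.2) = 0 := by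
    by_contra! hc
    refine Set.infinite_of_injective_forall_mem (f := fun n : ℕ => ((x.1 + n, x.2) : Site)) ?_
      hc hψ
    intro a b hab
    simpa using hab
  have h1 : (ψ x : ℝ) = ∑ i ∈ Finset.range n,
      ((ψ (x.1 + i, x.2) : ℝ) - ψ (x.1 + (i + 1 : ℕ), x.2)) := by
    rw [Finset.sum_range_sub' (fun i : ℕ => (ψ (x.1 + i, x.2) : ℝ)), hn]
    simp
  set T : Finset DualEdge := (Finset.range n).image fun i : ℕ => DualEdge.ver (x.1 + i, x.2 - 1)
  rw [h1]
  refine (Finset.abs_sum_le_sum_abs _ _).trans ?_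
  have h2 : ∑ i ∈ Finset.range n,
      |(ψ (x.1 + i, x.2) : ℝ) - ψ (x.1 + (i + 1 : ℕ), x.2)| =
      ∑ e ∈ T, |(ψ e.side₁ : ℝ) - ψ e.side₂| := by
    rw [Finset.sum_image]
    · refine Finset.sum_congr rfl fun i _ => ?_
      simp [DualEdge.side₁, DualEdge.side₂, add_assoc]
    · intro a _ b _ hab
      simpa using hab
  rw [h2, energy, finsum_eq_sum_of_support_subset
    (s := (finite_support_gradient hψ).toFinset ∪ T)]
  · exact Finset.sum_le_sum_of_subset_of_nonneg Finset.subset_union_right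
      fun _ _ _ => abs_nonneg _
  · intro e he
    simp only [Finset.coe_union, Set.Finite.coe_toFinset]
    exact Or.inl he

theorem tsum_exp_neg_abs_ne_top {c : ℝ} (hc : 0 < c) :
    ∑' t : ℤ, ENNReal.ofReal (Real.exp (-c * |(t : ℝ)|)) ≠ ∞ := by
  have h1 : Summable fun n : ℕ => Real.exp (-c * (n : ℝ)) := by
    have := Real.summable_exp_nat_mul_iff.2 (neg_lt_zero.2 hc)
    simpa [mul_comm] using this
  have h2 : Summable fun t : ℤ => Real.exp (-c * |(t : ℝ)|) := by
    refine Summable.of_nat_of_neg ?_ ?_ <;> simpa using h1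
  exact h2.tsum_ofReal_ne_top

theorem mass_ge {V : Set Site} (hV : V.Finite) {η : Site → Sgn} {f : Site → ℤ}
    {D : Set (Finset DualEdge)} {ψ : Site → ℤ} (h : ψ ∈ Conf V η f D) :
    ∑ x ∈ hV.toFinset, (f x : ℝ) ≤ mass ψ := by
  rw [mass, finsum_eq_sum_of_support_subset (s := hV.toFinset)]
  · exact Finset.sum_le_sum fun x hx => by exact_mod_cast h.2.1 x (hV.mem_toFinset.1 hx)
  · intro x hx
    rw [Set.Finite.coe_toFinset]
    by_contra hc
    rw [Function.mem_support] at hx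
    exact hx (by rw [h.1 x hc]; simp)

/-- Each height is at most the energy, so the energy dominates the sum of all `|ψ x|` up to the
factor `|V| + 1`, while the floor bounds the field term. The weight is then below a product of
convergent sums over single sites. -/
theorem totalWeight_conf_ne_top {β lam : ℝ} (hβ : 0 < β) (hlam : 0 ≤ lam) {V : Set Site}
    (hV : V.Finite) (η : Site → Sgn) (f : Site → ℤ) (D : Set (Finset DualEdge)) :
    totalWeight β lam (Conf V η f D) ≠ ∞ := by
  classical
  set U := hV.toFinset
  set c : ℝ := β / (U.card + 1)
  have hc : 0 < c := by positivity
  set g : ℤ → ℝ≥0∞ := fun t => ENNReal.ofReal (Real.exp (-c * |(t : ℝ)|))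
  set m := ∑ x ∈ U, (f x : ℝ)
  have hmem : ∀ x, x ∉ U ↔ x ∉ V := fun x => by simp [U]
  have h1 : totalWeight β lam (Conf V η f D) ≤ ENNReal.ofReal (Real.exp (-lam * m)) *
      ∑' ψ : {ψ : Site → ℤ | ∀ x, x ∉ U → ψ x = 0}, ∏ x ∈ U, g (ψ.1 x) := by
    rw [← ENNReal.tsum_mul_left]
    let G : Conf V η f D → {ψ : Site → ℤ | ∀ x, x ∉ U → ψ x = 0} := fun ψ =>
      ⟨ψ.1, fun x hx => ψ.2.1 x ((hmem x).1 hx)⟩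
    have hG : Function.Injective G := by
      intro a b hab
      simpa [G, Subtype.ext_iff] using hab
    refine le_trans ?_ (ENNReal.tsum_comp_le_tsum_of_injective hG _)
    refine ENNReal.tsum_le_tsum fun ψ => ?_
    simp only [G, g, gibbs]
    rw [← ENNReal.ofReal_prod_of_nonneg fun _ _ => (Real.exp_pos _).le, ← Real.exp_sum,
      ← ENNReal.ofReal_mul (Real.exp_pos _).le, ← Real.exp_add]
    refine ENNReal.ofReal_le_ofReal (Real.exp_le_exp.2 ?_)
    rw [← Finset.mul_sum]
    have h2 := mul_le_mul_of_nonneg_left (mass_ge hV ψ.2) hlam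
    have hs := Conf.finite_support hV ψ.2
    have h3 : ∑ x ∈ U, |(ψ.1 x : ℝ)| ≤ U.card * energy ψ.1 := by
      refine (Finset.sum_le_sum fun x _ => abs_le_energy hs x).trans ?_
      rw [Finset.sum_const, nsmul_eq_mul]
    have h4 : 0 ≤ energy ψ.1 := (abs_nonneg _).trans (abs_le_energy hs (0, 0))
    have h5 : c * ∑ x ∈ U, |(ψ.1 x : ℝ)| ≤ β * energy ψ.1 := by
      calc c * ∑ x ∈ U, |(ψ.1 x : ℝ)| ≤ c * ((U.card + 1) * energy ψ.1) := by
            gcongr; linarith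
        _ = β * energy ψ.1 := by
            simp only [c]; field_simp
    linarith
  refine ne_top_of_le_ne_top ?_ h1
  refine ENNReal.mul_ne_top ENNReal.ofReal_ne_top (ne_top_of_le_ne_top ?_ (tsum_supported_le g U))
  exact ENNReal.pow_ne_top (tsum_exp_neg_abs_ne_top hc)

open scoped ENNReal

/-! ### Contours around a given site -/

theorem char_nonneg (A : Set Site) (x : Site) : 0 ≤ char A x := by
  by_cases h : x ∈ A
  · rw [char_of_mem h]; omega
  · rw [char_of_notMem h]

theorem char_le_one (A : Set Site) (x : Site) : char A x ≤ 1 := by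
  by_cases h : x ∈ A
  · rw [char_of_mem h]
  · rw [char_of_notMem h]; omega

theorem superlevel_char_one (A : Set Site) : superlevel (char A) 1 = A := by
  ext x
  rw [mem_superlevel]
  by_cases h : x ∈ A
  · rw [char_of_mem h]; simp [h]
  · rw [char_of_notMem h]; simp [h]

theorem IsGeometricContour.exists_adj {γ : Finset DualEdge} (hγ : IsGeometricContour γ) :
    ∃ x y, Adj x y ∧ x ∈ Inside γ ∧ y ∉ Inside γ := by
  obtain ⟨e, he⟩ := IsLoopOf.nonempty hγ
  have h1 : e ∈ dualBoundary (Inside γ) := by rw [hγ.dualBoundary_inside]; exact he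
  rw [mem_dualBoundary] at h1
  by_cases h2 : e.side₁ ∈ Inside γ
  · exact ⟨_, _, adj_sides e, h2, by tauto⟩
  · exact ⟨_, _, (adj_sides e).symm, by tauto, h2⟩

/-- The signs of the contours of the indicator function of `A` that surround `x` add up to 1, so at
least one of them is an up-contour. -/
theorem exists_loop_around {A : Set Site} (hA : A.Finite) {x : Site} (hx : x ∈ A) :
    ∃ γ, IsLoopOf (dualBoundary A) γ ∧ InnerSide A (Inside γ) ∧ x ∈ Inside γ := by
  have hφ : {x | char A x ≠ 0}.Finite := hA.subset fun y hy => by_contra fun hc =>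
    hy (char_of_notMem hc)
  have h1 := sum_sign_mul_char hφ x
  rw [char_of_mem hx] at h1
  obtain ⟨c, hc, hpos⟩ : ∃ c ∈ (finite_contours hφ).toFinset,
      0 < c.sign * char (Inside c.loop) x := by
    by_contra! hc
    have := Finset.sum_nonpos hc
    omega
  rw [Set.Finite.mem_toFinset] at hc
  have h2 := isLoopOf_of_mem_contours hc
  have h3 := h2.nonempty
  have hlevel : c.level = 1 := by
    obtain ⟨e, he⟩ := h3
    have h4 := h2.1 he
    rw [mem_dualBoundary_superlevel, Finset.mem_Ioc] at h4
    have := char_nonneg A e.side₁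
    have := char_nonneg A e.side₂
    have := char_le_one A e.side₁
    have := char_le_one A e.side₂
    omega
  rw [hlevel, superlevel_char_one] at h2
  obtain ⟨γ, d, j⟩ := c
  have h0 := char_nonneg (Inside γ) x
  cases d with
  | down => simp only [Contour.sign] at hpos; omega
  | up =>
    have hxI : x ∈ Inside γ := by
      by_contra hxI
      simp [char_of_notMem hxI] at hpos
    refine ⟨γ, h2, ?_, hxI⟩
    rcases h2.innerSide_or with h4 | h4
    · exact h4
    · obtain ⟨y, z, hadj, hy, hz⟩ := h2.isGeometricContour.exists_adj
      have h5 := (h4 y z (Or.inl hadj) hy hz).1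
      have h6 : IsUpContour (char A) j γ := hc
      have h7 := h6.2.1 y ⟨hy, z, hz, hadj⟩
      have h8 : j = 1 := hlevel
      rw [char_of_notMem h5] at h7
      omega

theorem InnerSide.mem_of_triAdj {A I : Set Site} (h : InnerSide A I) {x y : Site}
    (hadj : TriAdj x y) (hx : x ∈ I) (hy : y ∈ A) : y ∈ I :=
  by_contra fun hc => (h x y hadj hx hc).2 hy

/-! ### The shortest contours and the loop around one site -/

theorem one_le_ncard_image {I : Set Site} (hI : I.Finite) (hne : I.Nonempty) (f : Site → ℤ) :
    1 ≤ (f '' I).ncard :=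
  (Set.ncard_pos (hI.image f)).2 (hne.image f)

theorem IsGeometricContour.four_le_card {γ : Finset DualEdge} (hγ : IsGeometricContour γ) :
    4 ≤ γ.card := by
  obtain ⟨x, -, -, hx, -⟩ := hγ.exists_adj
  have h1 := two_mul_rows_add_columns_le hγ.finite_inside hγ.dualBoundary_inside
  have h2 := one_le_ncard_image hγ.finite_inside ⟨x, hx⟩ Prod.fst
  have h3 := one_le_ncard_image hγ.finite_inside ⟨x, hx⟩ Prod.snd
  omega

/-- With two interior sites there are at least two nonempty rows or columns. This gap from 4 to 6 is
what makes single-site spikes dominant. -/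
theorem IsGeometricContour.six_le_card {γ : Finset DualEdge} (hγ : IsGeometricContour γ)
    (h : 1 < (Inside γ).ncard) : 6 ≤ γ.card := by
  obtain ⟨x, -, -, hx, -⟩ := hγ.exists_adj
  have h1 := two_mul_rows_add_columns_le hγ.finite_inside hγ.dualBoundary_inside
  have h2 := one_le_ncard_image hγ.finite_inside ⟨x, hx⟩ Prod.fst
  have h3 := one_le_ncard_image hγ.finite_inside ⟨x, hx⟩ Prod.snd
  have h4 := ncard_le_rows_mul_columns hγ.finite_inside
  by_contra! hc
  have h5 : (Prod.fst '' Inside γ).ncard = 1 := by omega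
  have h6 : (Prod.snd '' Inside γ).ncard = 1 := by omega
  rw [h5, h6] at h4
  omega

theorem mem_dualBoundary_singleton {x : Site} {e : DualEdge} :
    e ∈ dualBoundary {x} ↔ e.side₁ = x ∨ e.side₂ = x := by
  rw [mem_dualBoundary, Set.mem_singleton_iff, Set.mem_singleton_iff]
  have := adj_sides e
  constructor
  · tauto
  · rintro (rfl | rfl) h
    · rw [h.1 rfl] at this; simp [Adj] at this
    · rw [h.2 rfl] at this; simp [Adj] at this

/-- The boundary of a single site, as a finite set. -/
def unitLoop (x : Site) : Finset DualEdge :=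
  {.hor (x.1 - 1, x.2), .hor (x.1 - 1, x.2 - 1), .ver (x.1, x.2 - 1), .ver (x.1 - 1, x.2 - 1)}

theorem card_unitLoop_le (x : Site) : (unitLoop x).card ≤ 4 := Finset.card_le_four

theorem coe_unitLoop (x : Site) : (unitLoop x : Set DualEdge) = dualBoundary {x} := by
  obtain ⟨a, b⟩ := x
  ext e
  rw [mem_dualBoundary_singleton]
  obtain ⟨c, d⟩ | ⟨c, d⟩ := e <;>
    simp [unitLoop, DualEdge.side₁, DualEdge.side₂] <;> omega

theorem eq_unitLoop_of_isLoopOf {x : Site} {γ : Finset DualEdge}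
    (hγ : IsLoopOf (dualBoundary {x}) γ) : γ = unitLoop x := by
  refine Finset.eq_of_subset_of_card_le ?_ ?_
  · rw [← Finset.coe_subset, coe_unitLoop]; exact hγ.1
  · exact (card_unitLoop_le x).trans hγ.isGeometricContour.four_le_card

theorem isLoopOf_unitLoop (x : Site) : IsLoopOf (dualBoundary {x}) (unitLoop x) := by
  obtain ⟨γ, hγ, -, -⟩ := exists_loop_around (Set.finite_singleton x) (Set.mem_singleton x)
  rwa [← eq_unitLoop_of_isLoopOf hγ]

theorem card_unitLoop (x : Site) : (unitLoop x).card = 4 :=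
  le_antisymm (card_unitLoop_le x) (isLoopOf_unitLoop x).isGeometricContour.four_le_card

/-- Some loop of `{x}` surrounds `x`, and it is the unit loop; with only four edges it cannot
surround a second site. -/
theorem inside_unitLoop (x : Site) : Inside (unitLoop x) = {x} := by
  obtain ⟨γ, hγ, -, hx⟩ := exists_loop_around (Set.finite_singleton x) (Set.mem_singleton x)
  rw [eq_unitLoop_of_isLoopOf hγ] at hx
  have hg := (isLoopOf_unitLoop x).isGeometricContour
  have h1 : (Inside (unitLoop x)).ncard ≤ 1 := by
    by_contra! hc
    have := hg.six_le_card hc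
    rw [card_unitLoop] at this
    omega
  rw [Set.ncard_le_one hg.finite_inside] at h1
  ext y
  exact ⟨fun hy => h1 y hy x hx, fun hy => hy ▸ hx⟩

theorem contourDiam_unitLoop_le (x : Site) : contourDiam (unitLoop x) ≤ 1 := by
  refine contourDiam_le_of_touch (I := {x}) zero_le_one ?_ ?_ fun e he => ?_
  · rintro _ rfl _ rfl; simp
  · rintro _ rfl _ rfl; simp
  · have : e ∈ dualBoundary {x} := by rw [← coe_unitLoop]; exact he
    exact mem_dualBoundary_singleton.1 this

/-! ### Sums over contours -/

/-- The contours of length at least `n` that surround `x`. -/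
def bigContours (x : Site) (n : ℕ) : Set (Finset DualEdge) :=
  {γ | IsGeometricContour γ ∧ x ∈ Inside γ ∧ n ≤ γ.card}

theorem natCast_mul_four_pow_le (n : ℕ) : ((n * 4 ^ n : ℕ) : ℝ) ≤ Real.exp (3 * n) := by
  have h1 : (n : ℝ) ≤ Real.exp n := (by linarith : (n : ℝ) ≤ n + 1).trans (Real.add_one_le_exp _)
  have h2 : (4 : ℝ) ≤ Real.exp 2 := by
    have h3 := Real.exp_one_gt_d9
    have : Real.exp 2 = Real.exp 1 * Real.exp 1 := by rw [← Real.exp_add]; norm_num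
    nlinarith
  have h3 : (4 : ℝ) ^ n ≤ Real.exp (2 * n) := by
    rw [mul_comm, Real.exp_nat_mul]
    gcongr
  push_cast
  calc (n : ℝ) * 4 ^ n ≤ Real.exp n * Real.exp (2 * n) := by gcongr
    _ = Real.exp (3 * n) := by rw [← Real.exp_add]; ring_nf

/-- The count `n * 4 ^ n ≤ exp (3 * n)` leaves a geometric series of ratio `exp (-(κ - 3)) ≤ 1 / 2`,
which is why `κ ≥ 4` is required and the factor 2 appears. -/
theorem tsum_bigContours_le {κ : ℝ} (hκ : 4 ≤ κ) (x : Site) (n : ℕ) :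
    ∑' γ : bigContours x n, ENNReal.ofReal (Real.exp (-κ * γ.1.card)) ≤
      ENNReal.ofReal (2 * Real.exp (-(κ - 3) * n)) := by
  let G : bigContours x n → Σ i : ℕ, contoursAround x (n + i) := fun γ =>
    ⟨γ.1.card - n, γ.1, γ.2.1, by have := γ.2.2.2; omega, γ.2.2.1⟩
  have hG : Function.Injective G := by
    intro a b hab
    have : ∀ (i j : ℕ) (x' : contoursAround x (n + i)) (y : contoursAround x (n + j)),
        i = j → x' ≍ y → x'.1 = y.1 := by
      rintro i j x' y rfl hxy
      rw [eq_of_heq hxy]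
    simp only [G, Sigma.mk.injEq] at hab
    exact Subtype.ext (this _ _ _ _ hab.1 hab.2)
  calc ∑' γ : bigContours x n, ENNReal.ofReal (Real.exp (-κ * γ.1.card))
      ≤ ∑' p : (Σ i : ℕ, contoursAround x (n + i)),
          ENNReal.ofReal (Real.exp (-κ * p.2.1.card)) :=
        ENNReal.tsum_comp_le_tsum_of_injective hG _
    _ = ∑' (i : ℕ) (γ : contoursAround x (n + i)),
          ENNReal.ofReal (Real.exp (-κ * γ.1.card)) := ENNReal.tsum_sigma' _
    _ ≤ ∑' i : ℕ, ENNReal.ofReal (Real.exp (-(κ - 3) * n)) * 2⁻¹ ^ i := by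
        refine ENNReal.tsum_le_tsum fun i => ?_
        have h1 : ∑' γ : contoursAround x (n + i), ENNReal.ofReal (Real.exp (-κ * γ.1.card)) =
            (contoursAround x (n + i)).encard *
              ENNReal.ofReal (Real.exp (-κ * (n + i : ℕ))) := by
          rw [← ENNReal.tsum_set_const]
          refine tsum_congr fun γ => ?_
          rw [γ.2.2.1]
        rw [h1]
        have h2 : ((contoursAround x (n + i)).encard : ℝ≥0∞) ≤
            ENNReal.ofReal (Real.exp (3 * (n + i : ℕ))) := by
          refine le_trans (ENat.toENNReal_le.2 (encard_contoursAround_le x (n + i))) ?_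
          rw [ENat.toENNReal_coe, ← ENNReal.ofReal_natCast]
          exact ENNReal.ofReal_le_ofReal (natCast_mul_four_pow_le _)
        refine (mul_le_mul_left h2 _).trans ?_
        have h3 : (2⁻¹ : ℝ≥0∞) = ENNReal.ofReal 2⁻¹ := by
          rw [ENNReal.ofReal_inv_of_pos (by norm_num)]; simp
        rw [h3, ← ENNReal.ofReal_pow (by norm_num), ← ENNReal.ofReal_mul (Real.exp_pos _).le,
          ← ENNReal.ofReal_mul (Real.exp_pos _).le, ← Real.exp_add]
        refine ENNReal.ofReal_le_ofReal ?_
        have h4 : Real.exp (-1) ≤ 2⁻¹ := Real.exp_neg_one_lt_d9.le.trans (by norm_num)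
        have h5 : Real.exp (-(κ - 3) * i) ≤ 2⁻¹ ^ i := by
          calc Real.exp (-(κ - 3) * i) ≤ Real.exp (i * (-1)) := by
                refine Real.exp_le_exp.2 ?_
                have : (0 : ℝ) ≤ i := by positivity
                nlinarith
            _ = Real.exp (-1) ^ i := Real.exp_nat_mul _ _
            _ ≤ _ := by gcongr
        calc _ = Real.exp (-(κ - 3) * n) * Real.exp (-(κ - 3) * i) := by
              rw [← Real.exp_add]; push_cast; ring_nf
          _ ≤ _ := by gcongr
    _ = ENNReal.ofReal (2 * Real.exp (-(κ - 3) * n)) := by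
        rw [ENNReal.tsum_mul_left, ENNReal.tsum_geometric, ENNReal.one_sub_inv_two, inv_inv,
          mul_comm, ENNReal.ofReal_mul (by norm_num)]
        simp

/-- The interior of a contour whose diameter is at most `1 / lam`. -/
theorem lam_mul_ncard_inside_le {lam : ℝ} {γ : Finset DualEdge}
    (hlam : 0 ≤ lam) (hγ : IsGeometricContour γ) (hd : lam * contourDiam γ ≤ 1) :
    lam * (Inside γ).ncard ≤ γ.card / 2 := by
  have h1 := ncard_le_contourDiam_mul hγ.finite_inside hγ.dualBoundary_inside
  calc lam * (Inside γ).ncard ≤ lam * (contourDiam γ * (γ.card / 2)) := by gcongr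
    _ = lam * contourDiam γ * (γ.card / 2) := by ring
    _ ≤ 1 * (γ.card / 2) := by gcongr
    _ = γ.card / 2 := one_mul _

theorem cost_neg_one_le {β lam : ℝ} {γ : Finset DualEdge} (hlam : 0 ≤ lam)
    (hγ : IsGeometricContour γ) (hd : lam * contourDiam γ ≤ 1) :
    cost β lam (-1) γ ≤ ENNReal.ofReal (Real.exp (-(β - 1) * γ.card)) := by
  refine ENNReal.ofReal_le_ofReal (Real.exp_le_exp.2 ?_)
  have := lam_mul_ncard_inside_le hlam hγ hd
  have h0 : (0 : ℝ) ≤ γ.card := by positivity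
  push_cast
  linarith

theorem cost_one_le {β lam : ℝ} (γ : Finset DualEdge) (hlam : 0 ≤ lam) :
    cost β lam 1 γ ≤ ENNReal.ofReal (Real.exp (-β * γ.card)) := by
  refine ENNReal.ofReal_le_ofReal (Real.exp_le_exp.2 ?_)
  have : 0 ≤ lam * (Inside γ).ncard := by positivity
  push_cast
  linarith

open scoped ENNReal

/-! ### Low heights are unlikely -/

section

variable {β lam : ℝ} {V : Set Site} {η : Site → Sgn} {f : Site → ℤ} {D : Set (Finset DualEdge)}

theorem Conf.exists_loop_below (hV : V.Finite) {ψ : Site → ℤ} (h : ψ ∈ Conf V η f D) {x : Site}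
    {l : ℤ} (hl : l ≤ 0) (hx : ψ x < l) : ∃ γ, IsLoopOf (dualBoundary (superlevel ψ l)) γ ∧
      InnerSide (superlevel ψ l)ᶜ (Inside γ) ∧ x ∈ Inside γ := by
  have hA : (superlevel ψ l)ᶜ.Finite := hV.subset fun y hy => by_contra fun hc => by
    rw [Set.mem_compl_iff, mem_superlevel, h.1 y hc] at hy
    omega
  obtain ⟨γ, h1, h2, h3⟩ := exists_loop_around hA (x := x) (by
    rw [Set.mem_compl_iff, mem_superlevel]; omega)
  rw [dualBoundary_compl] at h1
  exact ⟨γ, h1, h2, h3⟩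

theorem Conf.exists_loop_above (hV : V.Finite) {ψ : Site → ℤ} (h : ψ ∈ Conf V η f D) {x : Site}
    {l : ℤ} (hl : 0 < l) (hx : l ≤ ψ x) : ∃ γ, IsLoopOf (dualBoundary (superlevel ψ l)) γ ∧
      InnerSide (superlevel ψ l) (Inside γ) ∧ x ∈ Inside γ := by
  have hA : (superlevel ψ l).Finite := hV.subset fun y hy => by_contra fun hc => by
    rw [mem_superlevel, h.1 y hc] at hy
    omega
  exact exists_loop_around hA (x := x) hx

theorem cost_unitLoop (β lam : ℝ) (x : Site) :
    cost β lam (-1) (unitLoop x) = ENNReal.ofReal (Real.exp (-(4 * β - lam))) := by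
  rw [cost, card_unitLoop, inside_unitLoop, Set.ncard_singleton]
  congr 2
  push_cast
  ring

/-- The configurations with a large contour around `x` that can be removed by raising the
heights. -/
theorem totalWeight_raise_le (hβ : 5 ≤ β) (hlam : 0 ≤ lam) (hV : V.Finite)
    (hD : ∀ γ ∈ D, lam * contourDiam γ ≤ 1) {B T : Set (Site → ℤ)} (x : Site) (n : ℕ)
    (hB : B ⊆ Conf V η f D)
    (h : ∀ ψ ∈ B, ∃ j γ, IsLoopOf (dualBoundary (superlevel ψ j)) γ ∧
      InnerSide (superlevel ψ j)ᶜ (Inside γ) ∧ γ ∈ bigContours x n ∧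
      (fun y => ψ y + 1 * char (Inside γ) y) ∈ T) :
    totalWeight β lam B ≤
      ENNReal.ofReal (2 * Real.exp (-(β - 4) * n)) * totalWeight β lam T := by
  have h1 := totalWeight_le_tsum β lam (ι := bigContours x n) (B := B)
    (c := fun γ => ENNReal.ofReal (Real.exp (-(β - 1) * γ.1.card)))
    (T := fun _ => T) (fun γ ψ y => ψ y + 1 * char (Inside γ.1) y)
    (fun γ => injective_add_char _ _) (by
      intro ψ hψ
      obtain ⟨j, γ, h1, h2, h3, h4⟩ := h ψ hψ
      refine ⟨⟨γ, h3⟩, h4, ?_⟩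
      have h5 := hB hψ
      rw [gibbs_raise β lam (Conf.finite_support hV h5) h1.isGeometricContour h2]
      gcongr
      exact cost_neg_one_le hlam h1.isGeometricContour (hD _ (h5.2.2.2 _ _ h1)))
  refine h1.trans ?_
  rw [ENNReal.tsum_mul_right]
  gcongr
  refine (tsum_bigContours_le (by linarith) x n).trans (le_of_eq ?_)
  ring_nf

theorem char_singleton_self (x : Site) : char {x} x = 1 := char_of_mem rfl

theorem char_singleton_of_ne {x y : Site} (h : y ≠ x) : char {x} y = 0 := char_of_notMem h

/-- Here `a j` stands for depth `j` at one site and `b j` for depth `j` also at a neighbour. The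
combination `10 * a j + b j` contracts by `p`, because the surplus `20 * b (j + 1)` is at most `p *
b j`. -/
theorem pow_bound_of_recursion {a b : ℕ → ℝ≥0∞} {p X : ℝ≥0∞}
    (ha : ∀ j, a (j + 1) ≤ p * a j + b (j + 1)) (hb : ∀ j, 20 * b (j + 1) ≤ p * b j)
    (ha0 : a 0 ≤ X) (hb0 : b 0 ≤ X) (j : ℕ) : 10 * a j ≤ 11 * (p ^ j * X) := by
  have key : ∀ j, 10 * a j + b j ≤ 11 * (p ^ j * X) := by
    intro j
    induction j with
    | zero =>
      calc 10 * a 0 + b 0 ≤ 10 * X + X := by gcongr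
        _ = 11 * (p ^ 0 * X) := by ring
    | succ j ih =>
      calc 10 * a (j + 1) + b (j + 1) ≤ 10 * (p * a j + b (j + 1)) + 10 * b (j + 1) := by
            gcongr
            · exact ha j
            · exact le_mul_of_one_le_left' (by norm_num)
        _ = 10 * (p * a j) + 20 * b (j + 1) := by ring
        _ ≤ 10 * (p * a j) + p * b j := add_le_add_right (hb j) _
        _ = p * (10 * a j + b j) := by ring
        _ ≤ p * (11 * (p ^ j * X)) := by gcongr
        _ = 11 * (p ^ (j + 1) * X) := by ring
  exact le_self_add.trans (key j)

/-- The weight of the configurations with a height of at most `-j` at `x`. -/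
theorem totalWeight_below_le (hβ : 20 ≤ β) (hlam : 0 ≤ lam) (hV : V.Finite)
    (hVs : SimplyConnectedDomain V) (hD : ∀ γ ∈ D, lam * contourDiam γ ≤ 1) (x : Site) (j : ℕ) :
    10 * totalWeight β lam {ψ ∈ Conf V η f D | ψ x ≤ -(j : ℤ)} ≤
      11 * (ENNReal.ofReal (Real.exp (-(4 * β - lam))) ^ j * totalWeight β lam (Conf V η f D)) := by
  -- Either all triangular neighbours of `x` are strictly higher than `-(j + 1)`, and then the top
  -- layer of the hole is the unit loop of `x`; or some neighbour is as deep, which is the event in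
  -- `b`.
  refine pow_bound_of_recursion
    (a := fun j => totalWeight β lam {ψ ∈ Conf V η f D | ψ x ≤ -(j : ℤ)})
    (b := fun j => totalWeight β lam
      {ψ ∈ Conf V η f D | ψ x ≤ -(j : ℤ) ∧ ∃ y, TriAdj x y ∧ y ≠ x ∧ ψ y ≤ -(j : ℤ)})
    (fun j => ?_) (fun j => ?_) (totalWeight_mono _ _ fun ψ h => h.1)
    (totalWeight_mono _ _ fun ψ h => h.1) j
  · have hsplit : {ψ ∈ Conf V η f D | ψ x ≤ -((j + 1 : ℕ) : ℤ)} ⊆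
        {ψ ∈ Conf V η f D | ψ x ≤ -((j + 1 : ℕ) : ℤ) ∧ ∀ y, TriAdj x y → y ≠ x →
          -((j + 1 : ℕ) : ℤ) < ψ y} ∪
        {ψ ∈ Conf V η f D | ψ x ≤ -((j + 1 : ℕ) : ℤ) ∧
          ∃ y, TriAdj x y ∧ y ≠ x ∧ ψ y ≤ -((j + 1 : ℕ) : ℤ)} := by
      rintro ψ ⟨h1, h2⟩
      by_cases h3 : ∃ y, TriAdj x y ∧ y ≠ x ∧ ψ y ≤ -((j + 1 : ℕ) : ℤ)
      · exact Or.inr ⟨h1, h2, h3⟩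
      · push Not at h3
        exact Or.inl ⟨h1, h2, h3⟩
    refine ((totalWeight_mono _ _ hsplit).trans (totalWeight_union_le _ _ _ _)).trans ?_
    gcongr
    have h1 := totalWeight_le_tsum β lam (ι := Unit)
      (B := {ψ ∈ Conf V η f D | ψ x ≤ -((j + 1 : ℕ) : ℤ) ∧ ∀ y, TriAdj x y → y ≠ x →
          -((j + 1 : ℕ) : ℤ) < ψ y})
      (c := fun _ => ENNReal.ofReal (Real.exp (-(4 * β - lam))))
      (T := fun _ => {ψ ∈ Conf V η f D | ψ x ≤ -(j : ℤ)})
      (fun _ ψ y => ψ y + 1 * char {x} y) (fun _ => injective_add_char _ _) (by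
        rintro ψ ⟨h1, h2, h3⟩
        refine ⟨(), ?_, ?_⟩
        all_goals
          have hside : InnerSide (superlevel ψ (-(j : ℤ)))ᶜ (Inside (unitLoop x)) := by
            rw [inside_unitLoop]
            rintro _ y hadj rfl hy
            have := h3 y hadj hy
            simp only [Set.mem_compl_iff, mem_superlevel]
            push_cast at *
            omega
          have hloop : IsLoopOf (dualBoundary (superlevel ψ (-(j : ℤ)))) (unitLoop x) := by
            rw [← dualBoundary_compl]
            have hx : x ∈ (superlevel ψ (-(j : ℤ)))ᶜ := by
              simp only [Set.mem_compl_iff, mem_superlevel]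
              push_cast at *
              omega
            have hsep : Separated ((superlevel ψ (-(j : ℤ)))ᶜ \ {x}) {x} := by
              rintro y ⟨hy, hyx⟩ _ rfl
              refine ⟨hyx, fun hadj => ?_⟩
              have := h3 y hadj.symm hyx
              simp only [Set.mem_compl_iff, mem_superlevel] at hy
              push_cast at *
              omega
            have h4 := hsep.symm.isLoopOf (isLoopOf_unitLoop x)
            rwa [Set.union_sdiff_cancel (Set.singleton_subset_iff.2 hx)] at h4
        · have h5 := Conf.raise hV hVs h1 hloop hside
          rw [inside_unitLoop] at h5
          refine ⟨h5, ?_⟩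
          beta_reduce
          rw [char_singleton_self]
          push_cast at *
          omega
        · rw [gibbs_raise β lam (Conf.finite_support hV h1) hloop.isGeometricContour hside,
            cost_unitLoop, inside_unitLoop])
    simpa using h1
  -- The contour at level `-j` around `x` also encloses the low neighbour, so it has length at least
  -- 6. Removing it leads from the event at depth `j + 1` to the same event at depth `j`.
  · have h1 := totalWeight_raise_le (β := β) (by linarith) hlam hV hD
      (B := {ψ ∈ Conf V η f D | ψ x ≤ -((j + 1 : ℕ) : ℤ) ∧
          ∃ y, TriAdj x y ∧ y ≠ x ∧ ψ y ≤ -((j + 1 : ℕ) : ℤ)})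
      (T := {ψ ∈ Conf V η f D | ψ x ≤ -(j : ℤ) ∧
          ∃ y, TriAdj x y ∧ y ≠ x ∧ ψ y ≤ -(j : ℤ)}) x 6 (fun ψ h => h.1) (by
        rintro ψ ⟨h1, h2, y, h3, hne, h4⟩
        obtain ⟨γ, h5, h6, h7⟩ := Conf.exists_loop_below hV h1 (x := x) (l := -(j : ℤ))
          (by omega) (by push_cast at h2; omega)
        have hy : y ∈ Inside γ := h6.mem_of_triAdj h3 h7 (by
          simp only [Set.mem_compl_iff, mem_superlevel]
          push_cast at h4
          omega)
        have hg := h5.isGeometricContour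
        refine ⟨_, γ, h5, h6, ⟨hg, h7, hg.six_le_card ?_⟩, Conf.raise hV hVs h1 h5 h6, ?_, y, h3,
          hne, ?_⟩
        · rw [Set.one_lt_ncard hg.finite_inside]
          exact ⟨y, hy, x, h7, hne⟩
        · beta_reduce; rw [char_of_mem h7]; push_cast at h2; omega
        · beta_reduce; rw [char_of_mem hy]; push_cast at h4; omega)
    refine (mul_le_mul_right h1 _).trans ?_
    rw [← mul_assoc]
    gcongr
    rw [show (20 : ℝ≥0∞) = ENNReal.ofReal 20 by simp, ← ENNReal.ofReal_mul (by norm_num)]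
    refine ENNReal.ofReal_le_ofReal ?_
    -- The constant 20 of the recursion times the 2 of the contour sum is absorbed by `exp 4`; the
    -- rest is `4 - 6 * (β - 4) ≤ -(4 * β - lam)`, which holds for large `β`.
    have h2 : (40 : ℝ) ≤ Real.exp 4 := by
      have h3 := Real.exp_one_gt_d9
      have : Real.exp 4 = Real.exp 1 ^ 4 := by rw [← Real.exp_nat_mul]; norm_num
      rw [this]
      calc (40 : ℝ) ≤ 2.7 ^ 4 := by norm_num
        _ ≤ _ := by gcongr; linarith
    calc 20 * (2 * Real.exp (-(β - 4) * (6 : ℕ))) = 40 * Real.exp (-(β - 4) * (6 : ℕ)) := by ring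
      _ ≤ Real.exp 4 * Real.exp (-(β - 4) * (6 : ℕ)) := by gcongr
      _ ≤ Real.exp (-(4 * β - lam)) := by
        rw [← Real.exp_add]
        refine Real.exp_le_exp.2 ?_
        push_cast
        linarith

/-! ### Lowering the floor -/

/-- The absorption step of each Peierls estimate: if the exceptional part is a fraction `q` of a
finite total, the rest carries a fraction at least `1 - q`. -/
theorem le_ofReal_mul_of_le_add {X Y : ℝ≥0∞} {q E : ℝ} (hX : X ≠ ∞) (hq : 0 ≤ q) (hE : 0 ≤ E)
    (h : X ≤ Y + ENNReal.ofReal q * X) (hqE : 1 ≤ E * (1 - q)) : X ≤ ENNReal.ofReal E * Y := by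
  have hE0 : 0 < E := by
    rcases hE.eq_or_lt with rfl | h
    · norm_num at hqE
    · exact h
  rcases eq_or_ne Y ∞ with rfl | hY
  · rw [ENNReal.mul_top (by simpa using hE0)]
    exact le_top
  · lift X to NNReal using hX
    lift Y to NNReal using hY
    rw [← ENNReal.ofReal_coe_nnreal, ← ENNReal.ofReal_coe_nnreal, ← ENNReal.ofReal_mul hq,
      ← ENNReal.ofReal_add (NNReal.coe_nonneg _) (by positivity),
      ENNReal.ofReal_le_ofReal_iff (by positivity)] at h
    rw [← ENNReal.ofReal_coe_nnreal, ← ENNReal.ofReal_coe_nnreal, ← ENNReal.ofReal_mul hE]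
    refine ENNReal.ofReal_le_ofReal ?_
    have hXn : (0 : ℝ) ≤ X := NNReal.coe_nonneg _
    nlinarith

/-- The probability, up to a constant, of a spike that reaches the floor at depth `k + 1`. -/
def spike (β lam : ℝ) (k : ℕ) : ℝ := Real.exp (-(4 * β - lam) * (k + 1))

theorem spike_pos (β lam : ℝ) (k : ℕ) : 0 < spike β lam k := Real.exp_pos _

theorem spike_le (hβ : 20 ≤ β) (hlam : lam ≤ 1) (k : ℕ) : spike β lam k ≤ 1 / 100 := by
  have h2 : (100 : ℝ) ≤ Real.exp 5 := by
    have h3 := Real.exp_one_gt_d9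
    have : Real.exp 5 = Real.exp 1 ^ 5 := by rw [← Real.exp_nat_mul]; norm_num
    rw [this]
    calc (100 : ℝ) ≤ 2.7 ^ 5 := by norm_num
      _ ≤ _ := by gcongr; linarith
  have h3 : spike β lam k ≤ Real.exp (-5) := by
    refine Real.exp_le_exp.2 ?_
    have : (0 : ℝ) ≤ k := by positivity
    nlinarith
  refine h3.trans ?_
  rw [Real.exp_neg, ← one_div]
  gcongr

theorem ofReal_spike (β lam : ℝ) (k : ℕ) :
    ENNReal.ofReal (Real.exp (-(4 * β - lam))) ^ (k + 1) = ENNReal.ofReal (spike β lam k) := by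
  rw [← ENNReal.ofReal_pow (Real.exp_pos _).le, spike, ← Real.exp_nat_mul]
  push_cast
  ring_nf

/-- A configuration above `f'` but not above `f` has depth at least `k + 1` at `x`, an event of
relative weight at most `1.1 * spike β lam k`. The bound closes since `(1 + 1.5 * s) * (1 - 1.1 * s)
≥ 1` for `s ≤ 1 / 100`. -/
theorem totalWeight_floor_le_single (hβ : 20 ≤ β) (hlam : 0 ≤ lam) (hlam1 : lam ≤ 1)
    (hV : V.Finite) (hVs : SimplyConnectedDomain V) (hD : ∀ γ ∈ D, lam * contourDiam γ ≤ 1)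
    {f' : Site → ℤ} (x : Site) (k : ℕ) (hfx : f x ≤ -(k : ℤ))
    (hf : ∀ y ∈ V, y ≠ x → f y ≤ f' y) :
    totalWeight β lam (Conf V η f' D) ≤
      ENNReal.ofReal (Real.exp (1.5 * spike β lam k)) * totalWeight β lam (Conf V η f D) := by
  have h1 := totalWeight_below_le (η := η) (f := f') hβ hlam hV hVs hD x (k + 1)
  rw [ofReal_spike] at h1
  have hp := spike_pos β lam k
  have hp' := spike_le hβ hlam1 k
  have hsplit : Conf V η f' D ⊆ Conf V η f D ∪ {ψ ∈ Conf V η f' D | ψ x ≤ -((k + 1 : ℕ) : ℤ)} := by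
    intro ψ hψ
    by_cases hx : ψ x ≤ -((k + 1 : ℕ) : ℤ)
    · exact Or.inr ⟨hψ, hx⟩
    · refine Or.inl ⟨hψ.1, fun y hy => ?_, hψ.2.2⟩
      by_cases hyx : y = x
      · rw [hyx]; push_cast at hx; omega
      · exact (hf y hy hyx).trans (hψ.2.1 y hy)
  have h2 := (totalWeight_mono β lam hsplit).trans (totalWeight_union_le β lam _ _)
  refine le_ofReal_mul_of_le_add (q := 1.1 * spike β lam k)
    (totalWeight_conf_ne_top (by linarith) hlam hV _ _ _) (by positivity) (Real.exp_pos _).le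
    (h2.trans ?_) ?_
  · gcongr
    have h10 : (10 : ℝ≥0∞) ≠ 0 := by norm_num
    refine (ENNReal.mul_le_mul_iff_right h10 (by norm_num)).1 (h1.trans (le_of_eq ?_))
    rw [← mul_assoc, ← mul_assoc]
    congr 1
    rw [show (11 : ℝ≥0∞) = ENNReal.ofReal 11 by simp, show (10 : ℝ≥0∞) = ENNReal.ofReal 10 by simp,
      ← ENNReal.ofReal_mul (by norm_num), ← ENNReal.ofReal_mul (by norm_num)]
    congr 1
    ring
  · have := Real.add_one_le_exp (1.5 * spike β lam k)
    nlinarith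

/-- Lowering the floor at finitely many sites, at which it is at most `-k` before. -/
theorem totalWeight_floor_le (hβ : 20 ≤ β) (hlam : 0 ≤ lam) (hlam1 : lam ≤ 1)
    (hV : V.Finite) (hVs : SimplyConnectedDomain V) (hD : ∀ γ ∈ D, lam * contourDiam γ ≤ 1)
    (k : ℕ) (S : Finset Site) (f' : Site → ℤ) (hfS : ∀ x ∈ S, f x ≤ -(k : ℤ))
    (hf : ∀ y ∈ V, y ∉ S → f y ≤ f' y) :
    totalWeight β lam (Conf V η f' D) ≤
      ENNReal.ofReal (Real.exp (1.5 * spike β lam k * S.card)) *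
        totalWeight β lam (Conf V η f D) := by
  classical
  induction S using Finset.induction_on generalizing f' with
  | empty =>
    simp only [Finset.card_empty, Nat.cast_zero, mul_zero, Real.exp_zero, ENNReal.ofReal_one,
      one_mul]
    exact totalWeight_mono _ _ (Conf.mono (fun y hy => hf y hy (by simp)) subset_rfl)
  | insert a S ha ih =>
    have h1 := ih (Function.update f' a (f a)) (fun x hx => hfS x (by simp [hx])) (by
      intro y hy hyS
      by_cases hya : y = a
      · rw [hya, Function.update_self]
      · rw [Function.update_of_ne hya]
        exact hf y hy (by simp [hya, hyS]))
    have h2 := totalWeight_floor_le_single (η := η) (f := Function.update f' a (f a)) (f' := f')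
      hβ hlam hlam1 hV hVs hD a k (by rw [Function.update_self]; exact hfS a (by simp)) (by
        intro y _ hya
        rw [Function.update_of_ne hya])
    refine h2.trans ((mul_le_mul_right h1 _).trans (le_of_eq ?_))
    rw [← mul_assoc, ← ENNReal.ofReal_mul (Real.exp_pos _).le, ← Real.exp_add,
      Finset.card_insert_of_notMem ha]
    push_cast
    ring_nf

end

open scoped ENNReal

/-! ### Large contours are unlikely -/

section

variable {β lam : ℝ} {V : Set Site} {η : Site → Sgn} {f : Site → ℤ} {D : Set (Finset DualEdge)}

/-- This is the purpose of the bound `exp (3 * β * (m + 1))` on elementary diameters: its product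
with the spike factor is at most 1, so the price of lowering the floor inside `γ` is dominated by
the length of `γ`. -/
theorem spike_mul_ncard_inside_le {m : ℕ} {γ : Finset DualEdge} (hβ : 20 ≤ β) (hlam1 : lam ≤ 1)
    (hγ : IsGeometricContour γ) (hd : contourDiam γ ≤ Real.exp (3 * β * (m + 1))) :
    1.5 * spike β lam m * (Inside γ).ncard ≤ γ.card := by
  have h1 := ncard_le_contourDiam_mul hγ.finite_inside hγ.dualBoundary_inside
  have h2 : spike β lam m * contourDiam γ ≤ 1 := by
    calc spike β lam m * contourDiam γ ≤
          Real.exp (-(4 * β - lam) * (m + 1)) * Real.exp (3 * β * (m + 1)) := by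
          rw [spike]; gcongr
      _ = Real.exp ((lam - β) * (m + 1)) := by rw [← Real.exp_add]; ring_nf
      _ ≤ 1 := by
          rw [Real.exp_le_one_iff]
          exact mul_nonpos_of_nonpos_of_nonneg (by linarith) (by positivity)
  have hp := spike_pos β lam m
  calc 1.5 * spike β lam m * (Inside γ).ncard
      ≤ 1.5 * spike β lam m * (contourDiam γ * (γ.card / 2)) := by gcongr
    _ = 0.75 * (spike β lam m * contourDiam γ) * γ.card := by ring
    _ ≤ 0.75 * 1 * γ.card := by gcongr
    _ ≤ γ.card := by
        have : (0 : ℝ) ≤ γ.card := by positivity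
        linarith

/-- The configurations with a contour of length at least `n` around `x`. -/
theorem totalWeight_big_le (hβ : 20 ≤ β) (hlam : 0 ≤ lam) (hlam1 : lam ≤ 1)
    (hV : V.Finite) (hVs : SimplyConnectedDomain V) (hD : ∀ γ ∈ D, lam * contourDiam γ ≤ 1)
    {m : ℕ} (hDm : ∀ γ ∈ D, contourDiam γ ≤ Real.exp (3 * β * (m + 1)))
    (hf : ∀ x, f x ≤ -(m : ℤ)) (x : Site) (n : ℕ) :
    totalWeight β lam {ψ ∈ Conf V η f D |
      ∃ j γ, IsLoopOf (dualBoundary (superlevel ψ j)) γ ∧ γ ∈ bigContours x n} ≤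
      ENNReal.ofReal (4 * Real.exp (-(β - 4) * n)) * totalWeight β lam (Conf V η f D) := by
  have hsplit : {ψ ∈ Conf V η f D |
      ∃ j γ, IsLoopOf (dualBoundary (superlevel ψ j)) γ ∧ γ ∈ bigContours x n} ⊆
      {ψ ∈ Conf V η f D | ∃ j γ, IsLoopOf (dualBoundary (superlevel ψ j)) γ ∧
        InnerSide (superlevel ψ j) (Inside γ) ∧ γ ∈ bigContours x n} ∪
      {ψ ∈ Conf V η f D | ∃ j γ, IsLoopOf (dualBoundary (superlevel ψ j)) γ ∧
        InnerSide (superlevel ψ j)ᶜ (Inside γ) ∧ γ ∈ bigContours x n} := by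
    rintro ψ ⟨h1, j, γ, h2, h3⟩
    rcases h2.innerSide_or with h4 | h4
    · exact Or.inl ⟨h1, j, γ, h2, h4, h3⟩
    · exact Or.inr ⟨h1, j, γ, h2, h4, h3⟩
  refine ((totalWeight_mono _ _ hsplit).trans (totalWeight_union_le _ _ _ _)).trans ?_
  have hraise := totalWeight_raise_le (β := β) (lam := lam) (T := Conf V η f D)
    (B := {ψ ∈ Conf V η f D | ∃ j γ, IsLoopOf (dualBoundary (superlevel ψ j)) γ ∧
        InnerSide (superlevel ψ j)ᶜ (Inside γ) ∧ γ ∈ bigContours x n})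
    (by linarith) hlam hV hD x n (fun ψ h => h.1) (by
      rintro ψ ⟨h1, j, γ, h2, h3, h4⟩
      exact ⟨j, γ, h2, h3, h4, Conf.raise hV hVs h1 h2 h3⟩)
  -- Removing an up-contour lowers the floor inside it. The index set is cut down to `D`, so that
  -- the diameter bound is available for each contour in the sum.
  have hlower := totalWeight_le_tsum β lam (ι := (bigContours x n ∩ D : Set (Finset DualEdge)))
    (B := {ψ ∈ Conf V η f D | ∃ j γ, IsLoopOf (dualBoundary (superlevel ψ j)) γ ∧
        InnerSide (superlevel ψ j) (Inside γ) ∧ γ ∈ bigContours x n})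
    (c := fun γ => ENNReal.ofReal (Real.exp (-β * γ.1.card)))
    (T := fun γ => Conf V η (fun y => f y - char (Inside γ.1) y) D)
    (fun γ ψ y => ψ y + (-1) * char (Inside γ.1) y) (fun γ => injective_add_char _ _) (by
      rintro ψ ⟨h1, j, γ, h2, h3, h4⟩
      refine ⟨⟨γ, h4, h1.2.2.2 j γ h2⟩, Conf.lower hV hVs h1 h2 h3, ?_⟩
      rw [gibbs_lower β lam (Conf.finite_support hV h1) h2.isGeometricContour h3]
      gcongr
      exact cost_one_le γ hlam)
  have hsum : ∑' γ : (bigContours x n ∩ D : Set (Finset DualEdge)),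
      ENNReal.ofReal (Real.exp (-β * γ.1.card)) *
        totalWeight β lam (Conf V η (fun y => f y - char (Inside γ.1) y) D) ≤
      ENNReal.ofReal (2 * Real.exp (-(β - 4) * n)) * totalWeight β lam (Conf V η f D) := by
    calc _ ≤ ∑' γ : (bigContours x n ∩ D : Set (Finset DualEdge)),
          ENNReal.ofReal (Real.exp (-(β - 1) * γ.1.card)) * totalWeight β lam (Conf V η f D) := by
          refine ENNReal.tsum_le_tsum fun γ => ?_
          have hg := γ.2.1.1
          -- Restoring the floor costs at most `exp |γ|`, so the exponent `β` drops to `β - 1`, the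
          -- same rate as for down-contours.
          have h1 := totalWeight_floor_le (η := η) hβ hlam hlam1 hV hVs hD m
            hg.finite_inside.toFinset (fun y => f y - char (Inside γ.1) y) (f := f)
            (fun y _ => hf y) (fun y _ hy => by
              rw [Set.Finite.mem_toFinset] at hy
              rw [char_of_notMem hy]; omega)
          refine (mul_le_mul_right h1 _).trans ?_
          rw [← mul_assoc, ← ENNReal.ofReal_mul (Real.exp_pos _).le, ← Real.exp_add,
            ← Set.ncard_eq_toFinset_card _ hg.finite_inside]
          gcongr
          have := spike_mul_ncard_inside_le hβ hlam1 hg (hDm _ γ.2.2)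
          linarith
      _ ≤ ∑' γ : bigContours x n,
          ENNReal.ofReal (Real.exp (-(β - 1) * γ.1.card)) * totalWeight β lam (Conf V η f D) :=
          ENNReal.tsum_mono_subtype
            (fun γ : Finset DualEdge => ENNReal.ofReal (Real.exp (-(β - 1) * γ.card)) *
              totalWeight β lam (Conf V η f D)) Set.inter_subset_left
      _ ≤ _ := by
          rw [ENNReal.tsum_mul_right]
          gcongr
          refine (tsum_bigContours_le (by linarith) x n).trans (le_of_eq ?_)
          ring_nf
  refine (add_le_add (hlower.trans hsum) hraise).trans (le_of_eq ?_)
  rw [← add_mul, ← ENNReal.ofReal_add (by positivity) (by positivity)]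
  congr 2
  ring

/-- Forbidding the loops outside `D'`, if they are long. -/
theorem totalWeight_forbid_le (hβ : 20 ≤ β) (hlam : 0 ≤ lam) (hlam1 : lam ≤ 1)
    (hV : V.Finite) (hVs : SimplyConnectedDomain V) (hD : ∀ γ ∈ D, lam * contourDiam γ ≤ 1)
    {m : ℕ} (hDm : ∀ γ ∈ D, contourDiam γ ≤ Real.exp (3 * β * (m + 1)))
    (hf : ∀ x, f x ≤ -(m : ℤ)) {D' : Set (Finset DualEdge)} {n : ℕ}
    (hn : ∀ γ ∈ D, γ ∉ D' → IsGeometricContour γ → n ≤ γ.card) {r : ℝ} (hr : r ≤ 1)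
    (hnr : 8 * Real.exp (-(β - 4) * n) ≤ r) :
    totalWeight β lam (Conf V η f D) ≤
      ENNReal.ofReal (Real.exp (r * V.ncard)) * totalWeight β lam (Conf V η f D') := by
  classical
  have hq := Real.exp_pos (-(β - 4) * n)
  -- Loops outside `D'` are forbidden site by site: after the sites in `S` have been treated, such a
  -- loop may surround no site of `S`.
  have key : ∀ S : Finset Site, totalWeight β lam (Conf V η f D) ≤
      ENNReal.ofReal (Real.exp (r * S.card)) *
        totalWeight β lam (Conf V η f {γ ∈ D | γ ∈ D' ∨ ∀ x ∈ S, x ∉ Inside γ}) := by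
    intro S
    induction S using Finset.induction_on with
    | empty => simp
    | insert a S ha ih =>
      have hsub : {γ ∈ D | γ ∈ D' ∨ ∀ x ∈ S, x ∉ Inside γ} ⊆ D := fun γ h => h.1
      have hbig := totalWeight_big_le (η := η) (f := f)
        (D := {γ ∈ D | γ ∈ D' ∨ ∀ x ∈ S, x ∉ Inside γ}) hβ hlam hlam1 hV hVs
        (fun γ h => hD γ h.1) (fun γ h => hDm γ h.1) hf a n
      have hsplit : Conf V η f {γ ∈ D | γ ∈ D' ∨ ∀ x ∈ S, x ∉ Inside γ} ⊆
          Conf V η f {γ ∈ D | γ ∈ D' ∨ ∀ x ∈ insert a S, x ∉ Inside γ} ∪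
          {ψ ∈ Conf V η f {γ ∈ D | γ ∈ D' ∨ ∀ x ∈ S, x ∉ Inside γ} |
            ∃ j γ, IsLoopOf (dualBoundary (superlevel ψ j)) γ ∧ γ ∈ bigContours a n} := by
        intro ψ hψ
        by_cases h : ∃ j γ, IsLoopOf (dualBoundary (superlevel ψ j)) γ ∧ γ ∈ bigContours a n
        · exact Or.inr ⟨hψ, h⟩
        · refine Or.inl ⟨hψ.1, hψ.2.1, hψ.2.2.1, fun j γ hγ => ?_⟩
          have h1 := hψ.2.2.2 j γ hγ
          refine ⟨h1.1, ?_⟩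
          by_cases h2 : γ ∈ D'
          · exact Or.inl h2
          · refine Or.inr fun x hx => ?_
            rcases Finset.mem_insert.1 hx with rfl | hx
            · exact fun hxI => h ⟨j, γ, hγ, hγ.isGeometricContour, hxI,
                hn γ h1.1 h2 hγ.isGeometricContour⟩
            · exact (h1.2.resolve_left h2) x hx
      have h2 := (totalWeight_mono β lam hsplit).trans (totalWeight_union_le β lam _ _)
      have h3 := le_ofReal_mul_of_le_add (q := 4 * Real.exp (-(β - 4) * n)) (E := Real.exp r)
        (totalWeight_conf_ne_top (by linarith) hlam hV _ _ _) (by positivity) (Real.exp_pos _).le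
        -- The excluded fraction is at most `r / 2`, and `(1 + r) * (1 - r / 2) ≥ 1` for `0 ≤ r ≤
        -- 1`.
        (h2.trans (add_le_add_right hbig _)) (by
          have := Real.add_one_le_exp r
          nlinarith)
      refine ih.trans ((mul_le_mul_right h3 _).trans (le_of_eq ?_))
      rw [← mul_assoc, ← ENNReal.ofReal_mul (Real.exp_pos _).le, ← Real.exp_add,
        Finset.card_insert_of_notMem ha]
      push_cast
      ring_nf
  have h1 := key hV.toFinset
  rw [← Set.ncard_eq_toFinset_card _ hV] at h1
  refine h1.trans ?_
  gcongr
  -- The interior of a loop is nonempty and contained in `V`, so a loop surrounding no site of `V`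
  -- cannot exist.
  refine totalWeight_mono _ _ fun ψ hψ => ⟨hψ.1, hψ.2.1, hψ.2.2.1, fun j γ hγ => ?_⟩
  have h2 := Conf.inside_subset hV hVs hψ hγ
  refine (hψ.2.2.2 j γ hγ).2.resolve_right fun hc => ?_
  obtain ⟨x, -, -, hx, -⟩ := hγ.isGeometricContour.exists_adj
  exact hc x (hV.mem_toFinset.2 (h2 hx)) hx

/-! ### Spikes -/

/-- `ψ` vanishes at `x` and at its neighbours. -/
def FlatAt (ψ : Site → ℤ) (x : Site) : Prop := ψ x = 0 ∧ ∀ y, TriAdj x y → ψ y = 0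

/-- Each layer of the spike is a unit down-contour, with its exact cost; flatness is needed because
of the absolute values in the energy. -/
theorem gibbs_spike {ψ : Site → ℤ} (hψ : {x | ψ x ≠ 0}.Finite) {x : Site} (hx : FlatAt ψ x)
    (i : ℕ) : gibbs β lam (fun y => ψ y + (-(i : ℤ)) * char {x} y) =
      ENNReal.ofReal (Real.exp (-(4 * β - lam))) ^ i * gibbs β lam ψ := by
  induction i with
  | zero => simp
  | succ i ih =>
    have hfin := finite_support_add_char hψ (Set.finite_singleton x) (-((i + 1 : ℕ) : ℤ))
    have hside : InnerSide
        (superlevel (fun y => ψ y + (-((i + 1 : ℕ) : ℤ)) * char {x} y) (-(i : ℤ)))ᶜ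
        (Inside (unitLoop x)) := by
      rw [inside_unitLoop]
      rintro _ y hadj rfl hy
      simp only [Set.mem_compl_iff, mem_superlevel, char_singleton_self, char_singleton_of_ne hy,
        hx.1, hx.2 y hadj]
      push_cast
      omega
    have h1 := gibbs_raise β lam hfin (isLoopOf_unitLoop x).isGeometricContour hside
    rw [cost_unitLoop, inside_unitLoop] at h1
    have h2 : (fun y => ψ y + (-((i + 1 : ℕ) : ℤ)) * char {x} y + 1 * char {x} y) =
        fun y => ψ y + (-(i : ℤ)) * char {x} y := by
      funext y
      push_cast
      ring
    rw [h1, h2, ih, pow_succ']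
    ring

/-- The only new loop is the unit loop at `x`: flatness keeps `x` away from the rest of each
sublevel set it joins. The strict interior is needed since the boundary signs may forbid negative
heights on the inner boundary. -/
theorem Conf.spike (hV : V.Finite) {ψ : Site → ℤ} (hψ : ψ ∈ Conf V η f D) {x : Site}
    (hxV : x ∈ strictInterior V) (hx : FlatAt ψ x) (hunit : unitLoop x ∈ D) (k : ℕ) :
    (fun y => ψ y + (-((k + 1 : ℕ) : ℤ)) * char {x} y) ∈
      Conf V η (Function.update f x (-((k + 1 : ℕ) : ℤ))) D := by
  have hfin := finite_support_add_char (Conf.finite_support hV hψ) (Set.finite_singleton x)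
    (-((k + 1 : ℕ) : ℤ))
  have hval : ∀ y, y ≠ x → ψ y + (-((k + 1 : ℕ) : ℤ)) * char {x} y = ψ y := fun y hy => by
    rw [char_singleton_of_ne hy]; ring
  have hvalx : ψ x + (-((k + 1 : ℕ) : ℤ)) * char {x} x = -((k + 1 : ℕ) : ℤ) := by
    rw [char_singleton_self, hx.1]; ring
  refine ⟨fun y hy => ?_, fun y hy => ?_, fun y hy => ?_, fun i γ hγ => ?_⟩
  · beta_reduce
    rw [hval y fun h => hy (h ▸ hxV.1)]
    exact hψ.1 y hy
  · beta_reduce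
    by_cases hyx : y = x
    · rw [hyx, Function.update_self, hvalx]
    · rw [Function.update_of_ne hyx, hval y hyx]
      exact hψ.2.1 y hy
  · beta_reduce
    rw [hval y fun h => hxV.2 (h ▸ hy)]
    exact hψ.2.2.1 y hy
  · by_cases hi : -((k + 1 : ℕ) : ℤ) < i ∧ i ≤ 0
    · have hset : (superlevel (fun y => ψ y + (-((k + 1 : ℕ) : ℤ)) * char {x} y) i)ᶜ =
          (superlevel ψ i)ᶜ ∪ {x} := by
        ext y
        simp only [Set.mem_compl_iff, mem_superlevel, Set.mem_union, Set.mem_singleton_iff]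
        by_cases hyx : y = x
        · rw [hyx, hvalx]
          simp only [not_le, hi.1, or_true]
        · rw [hval y hyx]
          simp only [hyx, or_false]
      have hfin2 := finite_dualBoundary_superlevel hfin i
      rw [← dualBoundary_compl, hset] at hγ hfin2
      have hsep : Separated (superlevel ψ i)ᶜ {x} := by
        rintro y hy _ rfl
        rw [Set.mem_compl_iff, mem_superlevel] at hy
        refine ⟨fun h => ?_, fun h => ?_⟩
        · rw [h, hx.1] at hy; omega
        · rw [hx.2 y h.symm] at hy; omega
      rcases hsep.isLoopOf_or hfin2 hγ with h | h
      · rw [dualBoundary_compl] at h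
        exact hψ.2.2.2 i γ h
      · rw [eq_unitLoop_of_isLoopOf h]
        exact hunit
    · have hset : superlevel (fun y => ψ y + (-((k + 1 : ℕ) : ℤ)) * char {x} y) i =
          superlevel ψ i := by
        ext y
        rw [mem_superlevel, mem_superlevel]
        by_cases hyx : y = x
        · rw [hyx, hvalx, hx.1]; omega
        · rw [hval y hyx]
      rw [hset] at hγ
      exact hψ.2.2.2 i γ hγ

theorem mem_box_of_triAdj {x y : Site} (h : TriAdj x y) :
    y ∈ Finset.Icc (x.1 - 1) (x.1 + 1) ×ˢ Finset.Icc (x.2 - 1) (x.2 + 1) := by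
  unfold TriAdj at h
  rw [adj_iff] at h
  rw [Finset.mem_product, Finset.mem_Icc, Finset.mem_Icc]
  omega

/-- If `ψ` is not flat, one of the nine sites of the box around `x` has nonzero height and hence a
surrounding contour, of length at least 4. The union bound is `9 * 4 * exp (-4 * (β - 4)) ≤ 0.1`. -/
theorem totalWeight_not_flat_le (hβ : 20 ≤ β) (hlam : 0 ≤ lam) (hlam1 : lam ≤ 1)
    (hV : V.Finite) (hVs : SimplyConnectedDomain V) (hD : ∀ γ ∈ D, lam * contourDiam γ ≤ 1)
    {m : ℕ} (hDm : ∀ γ ∈ D, contourDiam γ ≤ Real.exp (3 * β * (m + 1)))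
    (hf : ∀ x, f x ≤ -(m : ℤ)) (x : Site) :
    totalWeight β lam {ψ ∈ Conf V η f D | ¬ FlatAt ψ x} ≤
      ENNReal.ofReal 0.1 * totalWeight β lam (Conf V η f D) := by
  set N := Finset.Icc (x.1 - 1) (x.1 + 1) ×ˢ Finset.Icc (x.2 - 1) (x.2 + 1)
  have hN : N.card = 9 := by
    simp only [N, Finset.card_product, Int.card_Icc]
    have h1 : (x.1 + 1 + 1 - (x.1 - 1)).toNat = 3 := by omega
    have h2 : (x.2 + 1 + 1 - (x.2 - 1)).toNat = 3 := by omega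
    rw [h1, h2]
  have hsub : {ψ ∈ Conf V η f D | ¬ FlatAt ψ x} ⊆ ⋃ y ∈ N, {ψ ∈ Conf V η f D |
      ∃ j γ, IsLoopOf (dualBoundary (superlevel ψ j)) γ ∧ γ ∈ bigContours y 4} := by
    rintro ψ ⟨h1, h2⟩
    obtain ⟨y, hyN, hy⟩ : ∃ y ∈ N, ψ y ≠ 0 := by
      by_contra! hc
      refine h2 ⟨hc x ?_, fun y hy => hc y (mem_box_of_triAdj hy)⟩
      simp only [N, Finset.mem_product, Finset.mem_Icc]
      omega
    simp only [Set.mem_iUnion]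
    refine ⟨y, hyN, h1, ?_⟩
    rcases lt_or_gt_of_ne hy with hy | hy
    · obtain ⟨γ, h3, -, h4⟩ := Conf.exists_loop_below hV h1 le_rfl hy
      exact ⟨_, γ, h3, h3.isGeometricContour, h4, h3.isGeometricContour.four_le_card⟩
    · obtain ⟨γ, h3, -, h4⟩ := Conf.exists_loop_above hV h1 zero_lt_one hy
      exact ⟨_, γ, h3, h3.isGeometricContour, h4, h3.isGeometricContour.four_le_card⟩
  calc _ ≤ totalWeight β lam (⋃ y ∈ N, {ψ ∈ Conf V η f D |
        ∃ j γ, IsLoopOf (dualBoundary (superlevel ψ j)) γ ∧ γ ∈ bigContours y 4}) :=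
        totalWeight_mono _ _ hsub
    _ ≤ ∑ y ∈ N, totalWeight β lam {ψ ∈ Conf V η f D |
        ∃ j γ, IsLoopOf (dualBoundary (superlevel ψ j)) γ ∧ γ ∈ bigContours y 4} :=
        ENNReal.tsum_biUnion_le _ _ _
    _ ≤ ∑ y ∈ N, ENNReal.ofReal (4 * Real.exp (-(β - 4) * (4 : ℕ))) *
        totalWeight β lam (Conf V η f D) :=
        Finset.sum_le_sum fun y _ => totalWeight_big_le hβ hlam hlam1 hV hVs hD hDm hf y 4
    _ ≤ _ := by
        rw [Finset.sum_const, hN, nsmul_eq_mul, ← mul_assoc,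
          show ((9 : ℕ) : ℝ≥0∞) = ENNReal.ofReal 9 by simp, ← ENNReal.ofReal_mul (by norm_num)]
        gcongr
        have h1 : Real.exp (-(β - 4) * (4 : ℕ)) ≤ Real.exp (-(6 : ℝ)) :=
          Real.exp_le_exp.2 (by push_cast; linarith)
        have h2 : (360 : ℝ) ≤ Real.exp 6 := by
          have h3 := Real.exp_one_gt_d9
          have : Real.exp 6 = Real.exp 1 ^ 6 := by rw [← Real.exp_nat_mul]; norm_num
          rw [this]
          calc (360 : ℝ) ≤ 2.7 ^ 6 := by norm_num
            _ ≤ _ := by gcongr; linarith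
        have h4 : Real.exp (-(6 : ℝ)) ≤ 1 / 360 := by
          rw [Real.exp_neg, ← one_div]; gcongr
        calc 9 * (4 * Real.exp (-(β - 4) * (4 : ℕ))) ≤ 9 * (4 * (1 / 360)) := by
              gcongr; exact h1.trans h4
          _ ≤ 0.1 := by norm_num

theorem totalWeight_deepen_single (hβ : 20 ≤ β) (hlam : 0 ≤ lam) (hlam1 : lam ≤ 1)
    (hV : V.Finite) (hVs : SimplyConnectedDomain V) (hD : ∀ γ ∈ D, lam * contourDiam γ ≤ 1)
    {k : ℕ} (hDk : ∀ γ ∈ D, contourDiam γ ≤ Real.exp (3 * β * (k + 1)))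
    (hf : ∀ x, f x ≤ -(k : ℤ)) {x : Site} (hunit : unitLoop x ∈ D) (hxV : x ∈ strictInterior V)
    (hfx : f x = -(k : ℤ)) :
    ENNReal.ofReal (Real.exp (0.5 * spike β lam k)) * totalWeight β lam (Conf V η f D) ≤
      totalWeight β lam (Conf V η (Function.update f x (-((k + 1 : ℕ) : ℤ))) D) := by
  set X := totalWeight β lam (Conf V η f D) with hX
  have hXtop : X ≠ ∞ := totalWeight_conf_ne_top (by linarith) hlam hV _ _ _
  set Fl := {ψ ∈ Conf V η f D | FlatAt ψ x} with hFl
  set G : (Site → ℤ) → (Site → ℤ) := fun ψ y => ψ y + (-((k + 1 : ℕ) : ℤ)) * char {x} y with hG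
  have h1 : X ≤ totalWeight β lam Fl + ENNReal.ofReal 0.1 * X := by
    have hsplit : Conf V η f D ⊆ Fl ∪ {ψ ∈ Conf V η f D | ¬ FlatAt ψ x} := by
      intro ψ hψ
      by_cases h : FlatAt ψ x
      · exact Or.inl ⟨hψ, h⟩
      · exact Or.inr ⟨hψ, h⟩
    refine ((totalWeight_mono _ _ hsplit).trans (totalWeight_union_le _ _ _ _)).trans ?_
    gcongr
    exact totalWeight_not_flat_le hβ hlam hlam1 hV hVs hD hDk hf x
  have h2 : ENNReal.ofReal 0.9 * X ≤ totalWeight β lam Fl := by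
    have h3 : X = ENNReal.ofReal 0.9 * X + ENNReal.ofReal 0.1 * X := by
      rw [← add_mul, ← ENNReal.ofReal_add (by norm_num) (by norm_num)]
      norm_num
    nth_rewrite 1 [h3] at h1
    exact (ENNReal.add_le_add_iff_right (ENNReal.mul_ne_top ENNReal.ofReal_ne_top hXtop)).1 h1
  have h3 : totalWeight β lam (G '' Fl) = ENNReal.ofReal (spike β lam k) * totalWeight β lam Fl := by
    rw [totalWeight, tsum_image (gibbs β lam) (injective_add_char _ _).injOn, totalWeight,
      ← ENNReal.tsum_mul_left]
    refine tsum_congr fun ψ => ?_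
    rw [← ofReal_spike]
    exact gibbs_spike (Conf.finite_support hV ψ.2.1) ψ.2.2 (k + 1)
  have h4 : X + totalWeight β lam (G '' Fl) ≤
      totalWeight β lam (Conf V η (Function.update f x (-((k + 1 : ℕ) : ℤ))) D) := by
    -- The planted spike has depth `k + 1` at `x`, below the old floor `-k`, so the new
    -- configurations are not counted twice.
    have hdisj : Disjoint (Conf V η f D) (G '' Fl) := by
      rw [Set.disjoint_left]
      rintro _ h ⟨ψ, hψ, rfl⟩
      have h5 := h.2.1 x hxV.1
      simp only [G, char_singleton_self, hψ.2.1, hfx] at h5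
      push_cast at h5
      omega
    rw [hX, totalWeight, totalWeight, ← Summable.tsum_union_disjoint hdisj ENNReal.summable
      ENNReal.summable]
    refine totalWeight_mono _ _ (Set.union_subset (Conf.mono (fun y _ => ?_) subset_rfl) ?_)
    · by_cases hyx : y = x
      · rw [hyx, Function.update_self, hfx]; push_cast; omega
      · rw [Function.update_of_ne hyx]
    · rintro _ ⟨ψ, hψ, rfl⟩
      exact Conf.spike hV hψ.1 hxV hψ.2 hunit k
  have hp := spike_pos β lam k
  have hp' := spike_le hβ hlam1 k
  refine le_trans ?_ h4
  rw [h3]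
  calc ENNReal.ofReal (Real.exp (0.5 * spike β lam k)) * X
      ≤ ENNReal.ofReal (1 + spike β lam k * 0.9) * X := by
        gcongr
        -- With `t = 0.5 * s`, `exp t ≤ 1 + t + t ^ 2 ≤ 1 + 0.9 * s` because `s` is small.
        have h5 := Real.abs_exp_sub_one_sub_id_le (x := 0.5 * spike β lam k)
          (by rw [abs_of_nonneg (by positivity)]; linarith)
        have h6 := (abs_le.1 h5).2
        nlinarith
    _ = X + ENNReal.ofReal (spike β lam k) * (ENNReal.ofReal 0.9 * X) := by
        rw [ENNReal.ofReal_add zero_le_one (by positivity), ENNReal.ofReal_mul hp.le,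
          ENNReal.ofReal_one]
        ring
    _ ≤ _ := by gcongr

/-- Lowering the floor in the strict interior. -/
theorem totalWeight_deepen (hβ : 20 ≤ β) (hlam : 0 ≤ lam) (hlam1 : lam ≤ 1)
    (hV : V.Finite) (hVs : SimplyConnectedDomain V) (hD : ∀ γ ∈ D, lam * contourDiam γ ≤ 1)
    {k : ℕ} (hDk : ∀ γ ∈ D, contourDiam γ ≤ Real.exp (3 * β * (k + 1)))
    (hunit : ∀ x, unitLoop x ∈ D) :
    ENNReal.ofReal (Real.exp (0.5 * spike β lam k * (strictInterior V).ncard)) *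
        totalWeight β lam (Conf V η (fun _ => -(k : ℤ)) D) ≤
      totalWeight β lam (Conf V η (fun _ => -((k + 1 : ℕ) : ℤ)) D) := by
  classical
  have key : ∀ S : Finset Site, (∀ x ∈ S, x ∈ strictInterior V) →
      ENNReal.ofReal (Real.exp (0.5 * spike β lam k * S.card)) *
        totalWeight β lam (Conf V η (fun _ => -(k : ℤ)) D) ≤
      totalWeight β lam
        (Conf V η (fun x => if x ∈ S then -((k + 1 : ℕ) : ℤ) else -(k : ℤ)) D) := by
    intro S
    induction S using Finset.induction_on with
    | empty => simp
    | insert a S ha ih =>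
      intro hS
      have h1 := ih fun x hx => hS x (by simp [hx])
      have h2 := totalWeight_deepen_single (η := η) (x := a)
        (f := fun x => if x ∈ S then -((k + 1 : ℕ) : ℤ) else -(k : ℤ)) hβ hlam hlam1 hV hVs hD hDk
        (fun x => by split_ifs <;> push_cast <;> omega) (hunit a) (hS a (by simp))
        (if_neg ha)
      have h3 : Function.update (fun x => if x ∈ S then -((k + 1 : ℕ) : ℤ) else -(k : ℤ)) a
          (-((k + 1 : ℕ) : ℤ)) =
          fun x => if x ∈ insert a S then -((k + 1 : ℕ) : ℤ) else -(k : ℤ) := by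
        funext x
        by_cases hx : x = a
        · rw [hx, Function.update_self, if_pos (by simp)]
        · rw [Function.update_of_ne hx]
          simp [hx]
      rw [h3] at h2
      refine le_trans (le_trans (le_of_eq ?_) (mul_le_mul_right h1 _)) h2
      rw [← mul_assoc, ← ENNReal.ofReal_mul (Real.exp_pos _).le, ← Real.exp_add,
        Finset.card_insert_of_notMem ha]
      push_cast
      ring_nf
  have hfin : (strictInterior V).Finite := hV.subset Set.sdiff_subset
  have h1 := key hfin.toFinset fun x hx => hfin.mem_toFinset.1 hx
  rw [← Set.ncard_eq_toFinset_card _ hfin] at h1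
  refine h1.trans (totalWeight_mono _ _ (Conf.mono (fun x _ => ?_) subset_rfl))
  split_ifs <;> push_cast <;> omega

end

open scoped ENNReal

/-! ### Partition functions as sums over configurations -/

section

variable {β lam : ℝ} {V : Set Site} {η : Site → Sgn}

theorem superlevel_add_const (ψ : Site → ℤ) (h j : ℤ) :
    superlevel (fun x => ψ x + h) j = superlevel ψ (j - h) := by
  ext x
  rw [mem_superlevel, mem_superlevel]
  omega

theorem Sgn.allows_add_iff (s : Sgn) (h a : ℤ) : s.Allows h (a + h) ↔ s.Allows 0 a := by
  cases s <;> simp [Sgn.Allows]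

theorem finite_ne_add {ψ : Site → ℤ} (hψ : {x | ψ x ≠ 0}.Finite) (h : ℤ) :
    {x | ψ x + h ≠ h}.Finite := by
  simpa using hψ

theorem energy_add_const (ψ : Site → ℤ) (h : ℤ) : energy (fun x => ψ x + h) = energy ψ := by
  simp [energy]

theorem mapsTo_contours {h : ℤ} {D : Set (Finset DualEdge)} {ψ : Site → ℤ}
    (hψ : ψ ∈ Conf V η (fun _ => -h) D) :
    contours (fun x => ψ x + h) ∈ Collections η h V ∧
      ∀ c ∈ contours (fun x => ψ x + h), c.loop ∈ D := by
  refine ⟨⟨_, ⟨fun x hx => ?_, fun x hx => ?_, fun x hx => ?_⟩, rfl⟩, fun c hc => ?_⟩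
  · rw [hψ.1 x hx, zero_add]
  · have := hψ.2.1 x hx
    beta_reduce at *
    omega
  · exact (Sgn.allows_add_iff _ _ _).2 (hψ.2.2.1 x hx)
  · have h1 := isLoopOf_of_mem_contours hc
    rw [superlevel_add_const] at h1
    exact hψ.2.2.2 _ _ h1

theorem exists_conf_of_mem_collections {h : ℤ} {D : Set (Finset DualEdge)} {Γ : Set Contour}
    (hΓ : Γ ∈ Collections η h V) (hD : ∀ c ∈ Γ, c.loop ∈ D) :
    ∃ ψ ∈ Conf V η (fun _ => -h) D, contours (fun x => ψ x + h) = Γ := by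
  obtain ⟨φ, ⟨h1, h2, h3⟩, rfl⟩ := hΓ
  have hφ : (fun x => φ x - h + h) = φ := by funext x; ring
  refine ⟨fun x => φ x - h, ⟨fun x hx => ?_, fun x hx => ?_, fun x hx => ?_, fun j γ hγ => ?_⟩, ?_⟩
  · beta_reduce
    rw [h1 x hx, sub_self]
  · have := h2 x hx
    beta_reduce
    omega
  · rw [← Sgn.allows_add_iff _ h, sub_add_cancel]
    exact h3 x hx
  · have h4 := superlevel_add_const (fun x => φ x - h) h (j + h)
    beta_reduce at h4
    rw [add_sub_cancel_right, hφ] at h4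
    rw [← h4] at hγ
    obtain ⟨c, hc, hcγ, -⟩ := exists_contour_of_isLoopOf hγ
    exact hcγ ▸ hD c hc
  · beta_reduce
    rw [hφ]

theorem ofReal_collectionWeight_contours {ψ : Site → ℤ} (hψ : {x | ψ x ≠ 0}.Finite) (h : ℤ) :
    collectionWeight β lam (contours (fun x => ψ x + h)) = (gibbs β lam ψ).toReal := by
  rw [collectionWeight_contours β lam (finite_ne_add hψ h), energy_add_const, gibbs,
    ENNReal.toReal_ofReal (Real.exp_pos _).le]
  simp

/-- The collections with loops in `D` correspond to the configurations with loops in `D`. -/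
def confEquiv (hV : V.Finite) (η : Site → Sgn) (h : ℤ) (D : Set (Finset DualEdge)) :
    Conf V η (fun _ => -h) D ≃ {Γ | Γ ∈ Collections η h V ∧ ∀ c ∈ Γ, c.loop ∈ D} :=
  Equiv.ofBijective (fun ψ => ⟨contours (fun x => ψ.1 x + h), mapsTo_contours ψ.2⟩) (by
    constructor
    · intro ψ ψ' heq
      have h1 := eq_of_contours_eq (finite_ne_add (Conf.finite_support hV ψ.2) h)
        (finite_ne_add (Conf.finite_support hV ψ'.2) h) (congrArg Subtype.val heq)
      refine Subtype.ext (funext fun x => ?_)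
      have := congrFun h1 x
      beta_reduce at this
      omega
    · rintro ⟨Γ, hΓ, hD⟩
      obtain ⟨ψ, hψ, heq⟩ := exists_conf_of_mem_collections hΓ hD
      exact ⟨⟨ψ, hψ⟩, Subtype.ext heq⟩)

theorem summable_collectionWeight (hβ : 0 < β) (hlam : 0 ≤ lam) (hV : V.Finite) (h : ℤ)
    (D : Set (Finset DualEdge)) :
    Summable fun Γ : {Γ | Γ ∈ Collections η h V ∧ ∀ c ∈ Γ, c.loop ∈ D} =>
      collectionWeight β lam Γ := by
  rw [← (confEquiv hV η h D).summable_iff]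
  have h1 := ENNReal.summable_toReal (totalWeight_conf_ne_top hβ hlam hV η (fun _ => -h) D)
  refine h1.congr fun ψ => ?_
  exact (ofReal_collectionWeight_contours (Conf.finite_support hV ψ.2) h).symm

theorem tsum_collectionWeight (hV : V.Finite) (h : ℤ) (D : Set (Finset DualEdge)) :
    ∑' Γ : {Γ | Γ ∈ Collections η h V ∧ ∀ c ∈ Γ, c.loop ∈ D}, collectionWeight β lam Γ =
      (totalWeight β lam (Conf V η (fun _ => -h) D)).toReal := by
  rw [← (confEquiv hV η h D).tsum_eq, totalWeight, ENNReal.tsum_toReal_eq]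
  · refine tsum_congr fun ψ => ?_
    exact ofReal_collectionWeight_contours (Conf.finite_support hV ψ.2) h
  · exact fun ψ => ENNReal.ofReal_ne_top

theorem collections_eq (η : Site → Sgn) (h : ℤ) (V : Set Site) : Collections η h V =
    {Γ | Γ ∈ Collections η h V ∧ ∀ c ∈ Γ, c.loop ∈ (Set.univ : Set (Finset DualEdge))} := by
  simp

theorem Z_eq (hV : V.Finite) (h : ℤ) : Z β lam η h V = Real.exp (-lam * h * V.ncard) *
    (totalWeight β lam (Conf V η (fun _ => -h) Set.univ)).toReal := by
  rw [Z, ← tsum_collectionWeight hV h, ← collections_eq]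

theorem Zel_eq (hV : V.Finite) (h : ℤ) : Zel β lam η h V = Real.exp (-lam * h * V.ncard) *
    (totalWeight β lam (Conf V η (fun _ => -h) {γ | IsElementary β lam h γ})).toReal := by
  rw [Zel, ← tsum_collectionWeight hV h]
  rfl

theorem zero_mem_conf (V : Set Site) (η : Site → Sgn) (k : ℕ) (D : Set (Finset DualEdge)) :
    (fun _ => 0) ∈ Conf V η (fun _ => -(k : ℤ)) D := by
  refine ⟨fun x _ => rfl, fun x _ => by simp, fun x _ => ?_, fun j γ hγ => ?_⟩
  · cases η x <;> simp [Sgn.Allows]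
  · obtain ⟨e, he⟩ := hγ.nonempty
    have h1 := hγ.1 he
    rw [mem_dualBoundary_superlevel] at h1
    simp at h1

theorem totalWeight_conf_pos (hβ : 0 < β) (hlam : 0 ≤ lam) (hV : V.Finite) (k : ℕ)
    (D : Set (Finset DualEdge)) :
    0 < (totalWeight β lam (Conf V η (fun _ => -(k : ℤ)) D)).toReal := by
  refine ENNReal.toReal_pos (fun h0 => ?_) (totalWeight_conf_ne_top hβ hlam hV _ _ _)
  have h1 := ENNReal.tsum_eq_zero.1 h0 ⟨_, zero_mem_conf V η k D⟩
  simp only [gibbs, ENNReal.ofReal_eq_zero] at h1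
  exact absurd h1 (not_le.2 (Real.exp_pos _))

/-! ### Ratios of partition functions -/

theorem toReal_le_of_le_ofReal_mul {X Y : ℝ≥0∞} {E : ℝ} (hY : Y ≠ ∞) (hE : 0 ≤ E)
    (h : X ≤ ENNReal.ofReal E * Y) : X.toReal ≤ E * Y.toReal := by
  have := ENNReal.toReal_mono (ENNReal.mul_ne_top ENNReal.ofReal_ne_top hY) h
  rwa [ENNReal.toReal_mul, ENNReal.toReal_ofReal hE] at this

/-- Non-elementary loops are exponentially long, but the linear bound `n ≥ 3 * β * (k + 1) + 1`
already makes their Peierls factor smaller than a spike. -/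
theorem eight_mul_exp_le (hβ : 20 ≤ β) (hlam : 0 ≤ lam) (k n : ℕ)
    (hn : Real.exp (3 * β * (k + 1)) ≤ n) :
    8 * Real.exp (-(β - 4) * n) ≤ 0.5 * spike β lam k := by
  have h2 : (16 : ℝ) ≤ Real.exp 3 := by
    have h3 := Real.exp_one_gt_d9
    have : Real.exp 3 = Real.exp 1 ^ 3 := by rw [← Real.exp_nat_mul]; norm_num
    rw [this]
    calc (16 : ℝ) ≤ 2.7 ^ 3 := by norm_num
      _ ≤ _ := by gcongr; linarith
  have h3 : 3 * β * (k + 1) + 1 ≤ n := (Real.add_one_le_exp _).trans hn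
  have h4 : 16 * Real.exp (-(β - 4) * n) ≤ spike β lam k := by
    calc 16 * Real.exp (-(β - 4) * n) ≤ Real.exp 3 * Real.exp (-(β - 4) * n) := by gcongr
      _ ≤ spike β lam k := by
        rw [spike, ← Real.exp_add]
        refine Real.exp_le_exp.2 ?_
        have h0 : (0 : ℝ) ≤ k := by positivity
        have h5 : 0 ≤ β * (k + 1) := by positivity
        have h6 : 0 ≤ lam * (k + 1) := by positivity
        nlinarith
  linarith

theorem isElementary_unitLoop (hβ : 0 < β) (hlam1 : lam ≤ 1) (hlam : 0 ≤ lam) (k : ℕ) (x : Site) :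
    IsElementary β lam k (unitLoop x) := by
  have h1 := contourDiam_unitLoop_le x
  have h2 := contourDiam_nonneg (unitLoop x)
  refine ⟨by nlinarith, h1.trans (Real.one_le_exp ?_)⟩
  push_cast
  positivity

theorem totalWeight_elementary_lower (hβ : 20 ≤ β) (hlam : 0 ≤ lam) (hlam1 : lam ≤ 1)
    (hV : V.Finite) (hVs : SimplyConnectedDomain V) (k m : ℕ) :
    totalWeight β lam (Conf V η (fun _ => -(m : ℤ)) {γ | IsElementary β lam m γ}) ≤
      ENNReal.ofReal (Real.exp (2 * V.ncard * spike β lam k)) *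
        totalWeight β lam (Conf V η (fun _ => -(k : ℤ)) {γ | IsElementary β lam k γ}) := by
  -- The two costs per site, `0.5 * s` for forbidding loops and `1.5 * s` for raising the floor to
  -- `-k`, add up to the constant 2 of the theorem. The loops that get forbidden satisfy the field
  -- condition, so they are long because of their diameter.
  have h1 := totalWeight_forbid_le (η := η) (D := {γ | IsElementary β lam m γ}) (m := m)
    (f := fun _ => -(m : ℤ)) (D' := {γ | IsElementary β lam k γ})
    (n := ⌈Real.exp (3 * β * (k + 1))⌉₊) (r := 0.5 * spike β lam k) hβ hlam hlam1 hV hVs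
    (fun γ hγ => hγ.1) (fun γ hγ => by simpa using hγ.2) (fun x => le_rfl)
    (fun γ hγ hγ' hg => by
      refine Nat.ceil_le.2 (le_trans ?_ (IsLoopOf.contourDiam_le_card hg))
      by_contra! hc
      exact hγ' ⟨hγ.1, by simpa using hc.le⟩)
    (by have := spike_le hβ hlam1 k; linarith)
    (eight_mul_exp_le hβ hlam k _ (Nat.le_ceil _))
  have h2 := totalWeight_floor_le (η := η) (f := fun _ => -(k : ℤ)) hβ hlam hlam1 hV hVs
    (D := {γ | IsElementary β lam k γ}) (fun γ hγ => hγ.1) k hV.toFinset (fun _ => -(m : ℤ))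
    (fun _ _ => le_rfl) (fun y hy hy' => absurd (hV.mem_toFinset.2 hy) hy')
  rw [← Set.ncard_eq_toFinset_card _ hV] at h2
  refine h1.trans ((mul_le_mul_right h2 _).trans (le_of_eq ?_))
  rw [← mul_assoc, ← ENNReal.ofReal_mul (Real.exp_pos _).le, ← Real.exp_add]
  ring_nf

/-- Deepening the floor by one level already gives the gain; passing from `k + 1` to `m` and
enlarging the class of loops only adds configurations. -/
theorem totalWeight_elementary_upper (hβ : 20 ≤ β) (hlam : 0 ≤ lam) (hlam1 : lam ≤ 1)
    (hV : V.Finite) (hVs : SimplyConnectedDomain V) {k m : ℕ} (hkm : k < m) :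
    ENNReal.ofReal (Real.exp (0.5 * spike β lam k * (strictInterior V).ncard)) *
        totalWeight β lam (Conf V η (fun _ => -(k : ℤ)) {γ | IsElementary β lam k γ}) ≤
      totalWeight β lam (Conf V η (fun _ => -(m : ℤ)) {γ | IsElementary β lam m γ}) := by
  refine (totalWeight_deepen (η := η) hβ hlam hlam1 hV hVs (fun γ hγ => hγ.1)
    (fun γ hγ => by simpa using hγ.2)
    (fun x => isElementary_unitLoop (by linarith) hlam1 hlam k x)).trans ?_
  refine totalWeight_mono _ _ (Conf.mono (fun _ _ => by omega) fun γ hγ => ⟨hγ.1, hγ.2.trans ?_⟩)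
  have : (k : ℝ) ≤ m := by exact_mod_cast hkm.le
  push_cast
  gcongr

theorem Zel_ratio_eq (hβ : 0 < β) (hlam : 0 ≤ lam) (hV : V.Finite) (k m : ℕ) :
    Real.exp (-lam * (m - k) * V.ncard) * (Zel β lam η k V / Zel β lam η m V) =
      (totalWeight β lam (Conf V η (fun _ => -(k : ℤ)) {γ | IsElementary β lam k γ})).toReal /
      (totalWeight β lam (Conf V η (fun _ => -(m : ℤ)) {γ | IsElementary β lam m γ})).toReal := by
  have h1 := totalWeight_conf_pos (η := η) hβ hlam hV m {γ | IsElementary β lam m γ}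
  rw [Zel_eq hV, Zel_eq hV, mul_div_mul_comm, ← Real.exp_sub, ← mul_assoc, ← Real.exp_add]
  rw [show -lam * (m - k) * V.ncard + (-lam * ((k : ℤ) : ℝ) * V.ncard -
    -lam * ((m : ℤ) : ℝ) * V.ncard) = 0 by push_cast; ring, Real.exp_zero, one_mul]

/-! ### Renormalized weights -/

theorem contourDiam_le_of_isLoopOf {γ γ' : Finset DualEdge} (hγ : IsGeometricContour γ)
    {A : Set Site} (hA : ∀ x y, x ∉ Inside γ → y ∉ Inside γ → (x ∈ A ↔ y ∈ A))
    (hγ' : IsLoopOf (dualBoundary A) γ') : contourDiam γ' ≤ contourDiam γ := by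
  have hI := hγ.finite_inside
  have hb := hγ.dualBoundary_inside
  refine contourDiam_le_of_touch (I := Inside γ) (contourDiam_nonneg γ)
    (fun s hs t ht => width_le_contourDiam hI hb hs ht)
    (fun s hs t ht => height_le_contourDiam hI hb hs ht) fun e he => ?_
  by_contra! hc
  have h1 := hγ'.1 he
  rw [mem_dualBoundary] at h1
  exact h1 (hA _ _ hc.1 hc.2)

/-- Every loop of such a configuration touches `Inside γ`, so its diameter is at most that of `γ`.
Thus the full partition functions satisfy the restrictions under which the floor estimates hold. -/
theorem conf_inside_univ {γ : Finset DualEdge} (hγ : IsGeometricContour γ) (η : Site → Sgn)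
    (f : Site → ℤ) : Conf (Inside γ) η f Set.univ =
      Conf (Inside γ) η f {γ' | contourDiam γ' ≤ contourDiam γ} := by
  refine Set.Subset.antisymm (fun ψ hψ => ⟨hψ.1, hψ.2.1, hψ.2.2.1, fun j γ' hγ' => ?_⟩)
    (Conf.mono (fun _ _ => le_rfl) (Set.subset_univ _))
  exact contourDiam_le_of_isLoopOf hγ
    (fun x y hx hy => by rw [mem_superlevel, mem_superlevel, hψ.1 x hx, hψ.1 y hy]) hγ'

theorem IsGeometricContour.simplyConnectedDomain_inside {γ : Finset DualEdge}
    (hγ : IsGeometricContour γ) : SimplyConnectedDomain (Inside γ) :=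
  ⟨γ, hγ, hγ.dualBoundary_inside.symm⟩

/-- Going from `h` to `h + 1` lowers the relative floor by one throughout the interior, at a cost of
at most `exp |γ|`; the field factor only helps. -/
theorem renormalizedWeight_up_le (hβ : 20 ≤ β) (hlam : 0 ≤ lam) (hlam1 : lam ≤ 1) (h : ℕ)
    {γ : Finset DualEdge} (hγ : IsGeometricContour γ) (hel : IsElementary β lam h γ) :
    renormalizedWeight β lam h γ .up ≤ Real.exp (-(β - 2) * γ.card) := by
  have hI := hγ.finite_inside
  have hpos := totalWeight_conf_pos (β := β) (lam := lam) (η := fun _ => Sgn.plus) (by linarith)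
    hlam hI h Set.univ
  have hne := totalWeight_conf_ne_top (β := β) (lam := lam) (by linarith)
    hlam hI (fun _ => Sgn.plus) (fun _ => -(h : ℤ)) Set.univ
  have h1 := totalWeight_floor_le (η := fun _ => Sgn.plus) (f := fun _ => -(h : ℤ)) hβ hlam hlam1
    hI hγ.simplyConnectedDomain_inside (D := {γ' | contourDiam γ' ≤ contourDiam γ})
    (fun γ' hγ' => (mul_le_mul_of_nonneg_left hγ' hlam).trans hel.1) h hI.toFinset
    (fun _ => -((h : ℤ) + 1)) (fun _ _ => le_rfl)
    (fun y hy hy' => absurd (hI.mem_toFinset.2 hy) hy')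
  rw [← conf_inside_univ hγ, ← conf_inside_univ hγ, ← Set.ncard_eq_toFinset_card _ hI] at h1
  have h2 := toReal_le_of_le_ofReal_mul hne (Real.exp_pos _).le h1
  have h3 := spike_mul_ncard_inside_le (m := h) hβ hlam1 hγ (by simpa using hel.2)
  have h4 : 0 ≤ lam * (Inside γ).ncard := by positivity
  rw [renormalizedWeight, Z_eq hI, Z_eq hI, mul_div_mul_comm, ← Real.exp_sub]
  calc _ ≤ Real.exp (-β * γ.card) *
        (Real.exp (-lam * ((h + 1 : ℤ) : ℝ) * (Inside γ).ncard -
          -lam * ((h : ℤ) : ℝ) * (Inside γ).ncard) *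
          Real.exp (1.5 * spike β lam h * (Inside γ).ncard)) := by
        gcongr
        rwa [div_le_iff₀ hpos]
    _ ≤ _ := by
        rw [← Real.exp_add, ← Real.exp_add]
        refine Real.exp_le_exp.2 ?_
        push_cast
        have : (0 : ℝ) ≤ γ.card := by positivity
        linarith

/-- The floor is raised, so the sum over configurations decreases; the field factor is at most `exp
(|γ| / 2)` by the isoperimetric bound. For `h = 0` the numerator has floor 1, and monotonicity still
applies. -/
theorem renormalizedWeight_down_le (hβ : 0 < β) (hlam : 0 ≤ lam) (h : ℕ)
    {γ : Finset DualEdge} (hγ : IsGeometricContour γ) (hel : IsElementary β lam h γ) :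
    renormalizedWeight β lam h γ .down ≤ Real.exp (-(β - 2) * γ.card) := by
  have hI := hγ.finite_inside
  have hpos := totalWeight_conf_pos (β := β) (lam := lam) (η := fun _ => Sgn.minus) hβ
    hlam hI h Set.univ
  have hne := totalWeight_conf_ne_top (β := β) (lam := lam) hβ
    hlam hI (fun _ => Sgn.minus) (fun _ => -(h : ℤ)) Set.univ
  have h1 : totalWeight β lam
      (Conf (Inside γ) (fun _ => Sgn.minus) (fun _ => -((h : ℤ) - 1)) Set.univ) ≤
      totalWeight β lam (Conf (Inside γ) (fun _ => Sgn.minus) (fun _ => -(h : ℤ)) Set.univ) :=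
    totalWeight_mono _ _ (Conf.mono (fun _ _ => by omega) subset_rfl)
  have h2 := ENNReal.toReal_mono hne h1
  have h3 := lam_mul_ncard_inside_le hlam hγ hel.1
  rw [renormalizedWeight, Z_eq hI, Z_eq hI, mul_div_mul_comm, ← Real.exp_sub]
  calc _ ≤ Real.exp (-β * γ.card) *
        (Real.exp (-lam * ((h - 1 : ℤ) : ℝ) * (Inside γ).ncard -
          -lam * ((h : ℤ) : ℝ) * (Inside γ).ncard) * 1) := by
        gcongr
        rwa [div_le_one hpos]
    _ ≤ _ := by
        rw [mul_one, ← Real.exp_add]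
        refine Real.exp_le_exp.2 ?_
        push_cast
        have : (0 : ℝ) ≤ γ.card := by positivity
        linarith

end

end

end SOS

/-! ### Assembly of the three statements -/

theorem theorem3p1 :
    ∃ β₀ : ℝ, 0 < β₀ ∧ ∀ β : ℝ, β₀ < β → ∀ lam : ℝ, 0 ≤ lam → lam ≤ 1 →
      -- all partition functions are given by convergent series
      (∀ V : Set SOS.Site, V.Finite → SOS.SimplyConnectedDomain V →
        ∀ (η : SOS.Site → SOS.Sgn) (h : ℤ),
          Summable (fun Γ : SOS.Collections η h V => SOS.collectionWeight β lam Γ)) ∧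
      -- ratios of elementary partition functions
      (∀ V : Set SOS.Site, V.Finite → SOS.SimplyConnectedDomain V →
        ∀ (η : SOS.Site → SOS.Sgn) (k m : ℕ), k < m →
          Real.exp (-2 * V.ncard * Real.exp (-(4 * β - lam) * (k + 1))) ≤
            Real.exp (-lam * (m - k) * V.ncard) *
              (SOS.Zel β lam η k V / SOS.Zel β lam η m V) ∧
          Real.exp (-lam * (m - k) * V.ncard) *
              (SOS.Zel β lam η k V / SOS.Zel β lam η m V) ≤
            2 * Real.exp (-(1 / 2) * (SOS.strictInterior V).ncard *
              Real.exp (-(4 * β - lam) * (k + 1)))) ∧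
      -- renormalized weights of elementary contours
      (∀ (h : ℕ) (γ : Finset SOS.DualEdge) (s : SOS.Direction),
        SOS.IsGeometricContour γ → SOS.IsElementary β lam h γ →
          SOS.renormalizedWeight β lam h γ s ≤ Real.exp (-(β - 2) * γ.card)) := by
  refine ⟨20, by norm_num, fun β hβ lam hlam hlam1 => ⟨?_, ?_, ?_⟩⟩
  · intro V hV _ η h
    rw [SOS.collections_eq]
    exact SOS.summable_collectionWeight (by linarith) hlam hV h Set.univ
  · intro V hV hVs η k m hkm
    rw [SOS.Zel_ratio_eq (by linarith) hlam hV]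
    have hm := SOS.totalWeight_conf_pos (β := β) (lam := lam) (η := η) (by linarith) hlam hV m
      {γ | SOS.IsElementary β lam m γ}
    constructor
    · have h1 := SOS.toReal_le_of_le_ofReal_mul
        (SOS.totalWeight_conf_ne_top (by linarith) hlam hV _ _ _) (Real.exp_pos _).le
        (SOS.totalWeight_elementary_lower (η := η) hβ.le hlam hlam1 hV hVs k m)
      rw [le_div_iff₀ hm]
      refine (mul_le_mul_of_nonneg_left h1 (Real.exp_pos _).le).trans (le_of_eq ?_)
      rw [← mul_assoc, ← Real.exp_add, SOS.spike]
      ring_nf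
      simp
    · have h1 := ENNReal.toReal_mono (SOS.totalWeight_conf_ne_top (by linarith) hlam hV _ _ _)
        (SOS.totalWeight_elementary_upper (η := η) hβ.le hlam hlam1 hV hVs hkm)
      rw [ENNReal.toReal_mul, ENNReal.toReal_ofReal (Real.exp_pos _).le] at h1
      rw [div_le_iff₀ hm]
      calc _ = Real.exp (-(1 / 2) * (SOS.strictInterior V).ncard *
            Real.exp (-(4 * β - lam) * (k + 1))) *
            (Real.exp (0.5 * SOS.spike β lam k * (SOS.strictInterior V).ncard) *
            (SOS.totalWeight β lam (SOS.Conf V η (fun _ => -(k : ℤ))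
              {γ | SOS.IsElementary β lam k γ})).toReal) := by
            rw [← mul_assoc, ← Real.exp_add, SOS.spike]
            ring_nf
            simp
        _ ≤ Real.exp (-(1 / 2) * (SOS.strictInterior V).ncard *
            Real.exp (-(4 * β - lam) * (k + 1))) *
            (SOS.totalWeight β lam (SOS.Conf V η (fun _ => -(m : ℤ))
              {γ | SOS.IsElementary β lam m γ})).toReal := by gcongr
        -- The factor 2 in the upper bound is slack: the estimate has been proved without it.
        _ ≤ _ := by
            gcongr
            exact le_mul_of_one_le_left (Real.exp_pos _).le (by norm_num)
  · intro h γ s hγ hel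
    cases s
    · exact SOS.renormalizedWeight_up_le hβ.le hlam hlam1 h hγ hel
    · exact SOS.renormalizedWeight_down_le (by linarith) hlam h hγ hel
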